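/- For $c\in\mathbb{C}$ let $Q_c(z)=z^2+c$ and $f_c(z)=\bar z^2+c$. For an integer $n\ge 0$ put $N=2n+3$ and $c_n=\min\{c\in\mathbb{R} : Q_c^N(0)=0\}$, and let $\hat c=-2$. For $c$ near $\hat c$ let $\beta_c$ be the landing point of the dynamical ray of angle $0$ of $f_c$, i.e. the limit as $s\to 0^+$ of the continuous curve $\gamma:(0,\infty)\to\mathbb{C}$ with $f_c(\gamma(s))=\gamma(2s)$ and $\gamma(s)e^{-s}\to 1$ as $s\to\infty$. Let $\lambda_c=(f_c^2)'(\beta_c)$ and $\Lambda=|\lambda_{\hat c}|$. Let $\phi_c$ be the Koenigs coordinate at $\beta_c$, i.e. the function, holomorphic on a convex open set containing $\beta_c$ and $0$, with $\phi_c(f_c^2(w))=\lambda_c\phi_c(w)$ for $w$ near $\beta_c$, $\phi_c(\beta_c)=0$, and normalized by $\phi_c(0)=1$. Let $a_c=\phi_c'(0)$, define $A_i(c)$ by $\phi_c(f_c^3(z))=\sum_{i\ge0}A_i(c)\bar z^i$ near $z=0$, and let $$b_0=\frac{\partial A_0}{\partial c}(\hat c),\qquad b_0^*=\frac{\partial A_0}{\partial\bar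 c}(\hat c).$$ Then these objects are well defined: the minimum $c_n$ exists for every $n$ and $c_n\to\hat c=-2$; for all $c$ near $\hat c$ the ray of angle $0$ has a unique landing point, and $\phi_c$ exists, is unique, and its domain can be taken to contain $f_c^3(0)$; $\Lambda=16$; $a_{\hat c}\neq0$ and $A_2(\hat c)\ne0$; and $A_0$ is real-differentiable at $\hat c$. Moreover, let $$\frac34<\delta<1,\qquad \frac12<\gamma<1,$$ let $\alpha_n\in\mathbb{C}$ satisfy $$|\alpha_n|=\left|\frac{\lambda_{\hat c}^nA_2(\hat c)}{a_{\hat c}}\right|,\qquad 3\arg\alpha_n\equiv-\arg\left(\frac{\lambda_{\hat c}^nA_2(\hat c)}{a_{\hat c}}\right)\pmod{2\pi},$$ and set $$k_n=\frac{a_{\hat c}}{\alpha_n\lambda_{c_n}^n},\qquad \rho_n(t)=k_n\overline{b_0}\,t-\overline{k_n}\,b_0^*\,\bar t,\qquad g^n_c(Z)=\alpha_nf_c^N(Z/\alpha_n).$$ Then $g^n_{c_n+\rho_n(t)}(Z)$ converges to $\bar Z^2+(|b_0|^2-|b_0^*|^2)t$ exponentially fast, uniformly for $|Z|=O(\Lambda^{(1-\delta)n})$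 and $t=O(\Lambda^{(1-\gamma)n})$. That is, there is $\eta\in(0,1)$, depending only on $\delta$ and $\gamma$, such that for all $M_1,M_2$ there are $C$ and $n_0$ such that for every $n\ge n_0$, every admissible $\alpha_n$, and all $Z,t\in\mathbb{C}$ with $|Z|\le M_1\Lambda^{(1-\delta)n}$ and $|t|\le M_2\Lambda^{(1-\gamma)n}$, $$\left|g^n_{c_n+\rho_n(t)}(Z)-\left(\bar Z^2+(|b_0|^2-|b_0^*|^2)t\right)\right|\le C\eta^n .$$ -/

import Mathlib

open Filter Topology ComplexConjugate

noncomputable section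

namespace Tricorn

/-- The holomorphic quadratic polynomial `Q_c(z) = z² + c`. -/
def quad (c z : ℂ) : ℂ := z ^ 2 + c

/-- The anti-holomorphic quadratic polynomial `f_c(z) = z̄² + c`. -/
def antiQuad (c z : ℂ) : ℂ := conj z ^ 2 + c

/-- The real parameters `c` with `Q_c^N(0) = 0`, where `N = 2n + 3`. -/
def centerSet (n : ℕ) : Set ℝ := {c : ℝ | (quad (c : ℂ))^[2 * n + 3] 0 = 0}

/-- `c_n = min {c ∈ ℝ | Q_c^N(0) = 0}`. -/
def center (n : ℕ) : ℝ := sInf (centerSet n)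

/-- The limit parameter `ĉ = -2`. -/
def cHat : ℂ := -2

/-- `γ` parametrizes the dynamical ray of angle `0` of `f_c` by the potential `s > 0`. The Böttcher
coordinate `φ_c` is tangent to the identity at `∞` and satisfies `φ_c ∘ f_c = conj(φ_c)²`, so that
the point `γ s` with `φ_c (γ s) = exp s` satisfies `f_c (γ s) = γ (2 s)` and `γ s ∼ exp s` as
`s → ∞`; conversely, a continuous curve with these two properties satisfies `φ_c (γ s) = exp s` for
all large `s`, and its remaining part is the lift of this end under the iterates of `f_c`. -/
structure IsZeroRay (c : ℂ) (γ : ℝ → ℂ) : Prop where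
  continuousOn : ContinuousOn γ (Set.Ioi 0)
  map_eq : ∀ s : ℝ, 0 < s → antiQuad c (γ s) = γ (2 * s)
  asymptotic : Tendsto (fun s : ℝ => γ s / (Real.exp s : ℂ)) atTop (𝓝 1)

/-- The dynamical ray of angle `0` of `f_c` lands at `b`. -/
def ZeroRayLandsAt (c b : ℂ) : Prop :=
  ∃ γ : ℝ → ℂ, IsZeroRay c γ ∧ Tendsto γ (𝓝[>] 0) (𝓝 b)

/-- The `β`-fixed point `β_c` of `f_c`: the landing point of the dynamical ray of angle `0`. -/
def betaPt (c : ℂ) : ℂ := Classical.epsilon fun b => ZeroRayLandsAt c b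

/-- The multiplier `λ_c = (f_c²)'(β_c)`; `f_c²` is holomorphic. -/
def mult (c : ℂ) : ℂ := deriv (antiQuad c)^[2] (betaPt c)

/-- `Λ = |λ_ĉ|`. -/
def bigLambda : ℝ := ‖mult cHat‖

/-- `K` is a linearizing (Koenigs) coordinate of `f_c²` at `β_c`, continued holomorphically to a
convex open set `U` that contains `β_c` and `0`, and normalized by `K 0 = 1`. -/
structure IsKoenigs (c : ℂ) (U : Set ℂ) (K : ℂ → ℂ) : Prop where
  isOpen : IsOpen U
  convex : Convex ℝ U
  beta_mem : betaPt c ∈ U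
  zero_mem : (0 : ℂ) ∈ U
  differentiableOn : DifferentiableOn ℂ K U
  map_eq : ∀ᶠ w in 𝓝 (betaPt c), K ((antiQuad c)^[2] w) = mult c * K w
  map_beta : K (betaPt c) = 0
  map_zero : K 0 = 1

/-- The value at `z` of the normalized Koenigs coordinate of `f_c²` at `β_c`. By the identity
theorem on the convex set `U ∩ U'`, the value does not depend on the choice of `(U, K)`. -/
def koenigs (c z : ℂ) : ℂ :=
  Classical.epsilon fun v => ∃ (U : Set ℂ) (K : ℂ → ℂ), IsKoenigs c U K ∧ z ∈ U ∧ K z = v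

/-- The coefficient `a_c` in `K_c(z) = 1 + a_c z + O(z²)` near `z = 0`. -/
def aCoeff (c : ℂ) : ℂ := deriv (koenigs c) 0

/-- The coefficients `A_i(c)` in `K_c(f_c³(z)) = ∑ A_i(c) z̄ⁱ` near `z = 0`. -/
def ACoeff (i : ℕ) (c : ℂ) : ℂ :=
  iteratedDeriv i (fun w => koenigs c ((antiQuad c)^[3] (conj w))) 0 / (i.factorial : ℂ)

/-- `b₀ = B(ĉ)`, where `A_0(c) = (c - ĉ) B(c) + conj(c - ĉ) B*(c)`: the Wirtinger derivative
`∂A_0/∂c` at `ĉ`. -/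
def b0 : ℂ :=
  (fderiv ℝ (ACoeff 0) cHat 1 - Complex.I * fderiv ℝ (ACoeff 0) cHat Complex.I) / 2

/-- `b₀* = B*(ĉ)`, where `A_0(c) = (c - ĉ) B(c) + conj(c - ĉ) B*(c)`: the Wirtinger derivative
`∂A_0/∂c̄` at `ĉ`. -/
def b0Star : ℂ :=
  (fderiv ℝ (ACoeff 0) cHat 1 + Complex.I * fderiv ℝ (ACoeff 0) cHat Complex.I) / 2

/-- `λ_ĉⁿ A_2(ĉ) / a_ĉ`. -/
def scaleBase (n : ℕ) : ℂ := mult cHat ^ n * ACoeff 2 cHat / aCoeff cHat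

/-- The admissible scaling factors `α = α_n`: `|α| = |λ_ĉⁿ A_2(ĉ) / a_ĉ|` and
`arg α = -(1/3) arg (λ_ĉⁿ A_2(ĉ) / a_ĉ)` for some determination of the arguments,
that is, `3 arg α = -arg (λ_ĉⁿ A_2(ĉ) / a_ĉ)` modulo `2π`. -/
def IsScaling (n : ℕ) (α : ℂ) : Prop :=
  ‖α‖ = ‖scaleBase n‖ ∧
    3 • (Complex.arg α : Real.Angle) = -(Complex.arg (scaleBase n) : Real.Angle)

/-- `k_n = a_ĉ / (α_n λ_{c_n}ⁿ)`, for `α_n = α`. -/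
def kConst (n : ℕ) (α : ℂ) : ℂ := aCoeff cHat / (α * mult (center n : ℂ) ^ n)

/-- `ρ_n(t) = k_n conj(b₀) t - conj(k_n) b₀* conj(t)`, for `α_n = α`. -/
def rho (n : ℕ) (α t : ℂ) : ℂ :=
  kConst n α * conj b0 * t - conj (kConst n α) * b0Star * conj t

/-- `gⁿ_c(Z) = α_n f_c^N(Z / α_n)` with `N = 2n + 3`, for `α_n = α`. -/
def renorm (n : ℕ) (α c Z : ℂ) : ℂ := α * (antiQuad c)^[2 * n + 3] (Z / α)

end Tricorn

end

namespace Tricorn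

open Metric

/-! Treat `c` and `d = conj c` as independent. The second iterate is then `F(w) = (w² + d)² + c`,
holomorphic in all variables, and every estimate is made for functions of `(c, d, w)` near `(-2, -2,
·)`, restricted at the end to `d = conj c`.

The inverse branch `G` of `F` contracts the half-plane `Re w > -1` to a fixed point `β` near `2`,
with multiplier `λ` near `16`. The limit of `λᵏ (Gᵏ w - β)` linearizes `F`; the convergence is
locally uniform in `(c, d, w)`, so the limit is jointly holomorphic. A pull-back of the real axis
shows that `β` is the landing point of the ray of angle `0`. At `c = -2` the map is the Chebyshev
map and the linearizer at `2 cos θ` is `-θ²`, which gives all the nonvanishing that is needed.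

Write `φ` for the linearizer with `φ(0) = 1`, and `ψ(c, d, u)` for `φ` at the third iterate, where
`u = z̄²`. If `φ(w) = λⁿ ψ` with `w` near `0`, then `Gⁿ w` and `f_c³(z)` both lie near `2`, where
`φ` is injective; hence they agree and `f_c^N(z) = w` (`exists_return`). For the centre, minimality
of `c_n` makes its real critical orbit positive until it returns to `0`, so that orbit is a backward
orbit under `G` and `λⁿ A_0(c_n) = 1` (`exists_center_bounds`).

Subtracting this identity from `φ(w) = λⁿ ψ` and expanding to first order, with `c = c_n + ρ`, gives
`a w ≈ λ_{c_n}ⁿ (b₀ ρ + b₀* conj ρ) + 16ⁿ A_2 z̄²` (`exists_return_estimate`). If `ρ` and `z̄²` are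
`O(s_n)`, the error is `O(n (16ⁿ s_n)²)`. The choice of `α_n` turns the last term into `Z̄²`, and
`ρ_n` inverts the real-linear map `ρ ↦ b₀ ρ + b₀* conj ρ` up to the determinant `|b₀|² - |b₀*|²`. In
the stated ranges `s_n = 16^(-mn)` with `m > 3/2`, so after multiplication by `|α_n| ≍ 16ⁿ` the
error still decays exponentially. -/

theorem tendstoUniformlyOn_of_le_geometric {α F : Type*} [NormedAddCommGroup F] {f : ℕ → α → F}
    {g : α → F} {s : Set α} {C q : ℝ} (hq0 : 0 ≤ q) (hq : q < 1)
    (h : ∀ n, ∀ x ∈ s, ‖f (n + 1) x - f n x‖ ≤ C * q ^ n)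
    (hlim : ∀ x ∈ s, Tendsto (fun n => f n x) atTop (𝓝 (g x))) :
    TendstoUniformlyOn f g atTop s := by
  rw [Metric.tendstoUniformlyOn_iff]
  intro ε hε
  have ht : Tendsto (fun n : ℕ => C * q ^ n / (1 - q)) atTop (𝓝 0) := by
    simpa using ((tendsto_pow_atTop_nhds_zero_of_lt_one hq0 hq).const_mul C).div_const (1 - q)
  filter_upwards [ht.eventually_lt_const hε] with n hn x hx
  rw [dist_comm]
  refine (dist_le_of_le_geometric_of_tendsto q C hq (fun m => ?_) (hlim x hx) n).trans_lt hn
  rw [dist_comm, dist_eq_norm]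
  exact h m x hx

/-! ### Holomorphic maps on normed spaces: uniform limits and Taylor bounds -/

section ComplexAnalysis

variable {E F : Type*} [NormedAddCommGroup E] [NormedSpace ℂ E] [NormedAddCommGroup F]
  [NormedSpace ℂ F]

/-- Cauchy's estimate for the Fréchet derivative of a bounded holomorphic map. -/
theorem norm_fderiv_le_of_norm_le {f : E → F} {x : E} {R M : ℝ} (hR : 0 < R)
    (hf : DifferentiableOn ℂ f (ball x R)) (hM : ∀ y ∈ ball x R, ‖f y‖ ≤ M) :
    ‖fderiv ℂ f x‖ ≤ 2 * M / R := by
  refine Complex.norm_fderiv_le_div_of_mapsTo_ball hf (fun y hy => ?_) hR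
  rw [mem_closedBall, dist_eq_norm]
  have h1 := hM y hy
  have h2 := hM x (mem_ball_self hR)
  have h3 := norm_sub_le (f y) (f x)
  linarith

/-- A uniform limit of holomorphic maps on a ball of a complex normed space is holomorphic at the
centre. -/
theorem differentiableAt_of_tendstoUniformlyOn_ball [CompleteSpace F] {f : ℕ → E → F} {g : E → F}
    {x : E} {R : ℝ} (hR : 0 < R) (hf : ∀ n, DifferentiableOn ℂ (f n) (ball x R))
    (h : TendstoUniformlyOn f g atTop (ball x R)) : DifferentiableAt ℂ g x := by
  have hsub : ∀ y ∈ ball x (R / 2), ball y (R / 2) ⊆ ball x R := fun y hy =>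
    ball_subset_ball' (by have := mem_ball.1 hy; linarith)
  have hdiff : ∀ n, ∀ y ∈ ball x R, DifferentiableAt ℂ (f n) y := fun n y hy =>
    (hf n).differentiableAt (isOpen_ball.mem_nhds hy)
  -- Cauchy's estimate on balls of radius `R / 2`, applied to `f m - f n`, makes the derivatives
  -- uniformly Cauchy, so the limit can be differentiated termwise.
  have hC : UniformCauchySeqOn (fun n => fderiv ℂ (f n)) atTop (ball x (R / 2)) := by
    rw [Metric.uniformCauchySeqOn_iff]
    intro ε hε
    have hε' : 0 < ε * R / 8 := by positivity
    obtain ⟨N, hN⟩ := Metric.uniformCauchySeqOn_iff.1 h.uniformCauchySeqOn _ hε'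
    refine ⟨N, fun m hm n hn y hy => ?_⟩
    have hyR : y ∈ ball x R := hsub y hy (mem_ball_self (by linarith))
    rw [dist_eq_norm, ← fderiv_sub (hdiff m y hyR) (hdiff n y hyR)]
    refine (norm_fderiv_le_of_norm_le (M := ε * R / 8) (half_pos hR)
      (((hf m).sub (hf n)).mono (hsub y hy)) fun z hz => ?_).trans_lt ?_
    · have := (hN m hm n hn z (hsub y hy hz)).le
      rwa [dist_eq_norm] at this
    · have : 2 * (ε * R / 8) / (R / 2) = ε / 2 := by field_simp; norm_num
      linarith
  have hlim : ∀ y ∈ ball x (R / 2), ∃ A, Tendsto (fun n => fderiv ℂ (f n) y) atTop (𝓝 A) :=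
    fun y hy => cauchySeq_tendsto_of_complete (hC.cauchySeq hy)
  choose! g' hg' using hlim
  have hU := hC.tendstoUniformlyOn_of_tendsto hg'
  have hxx : x ∈ ball x (R / 2) := mem_ball_self (half_pos hR)
  refine (hasFDerivAt_of_tendstoUniformlyOn (f := f) isOpen_ball hU (fun n y hy => ?_)
    (fun y hy => ?_) hxx).differentiableAt
  · exact (hdiff n y (hsub y hy (mem_ball_self (half_pos hR)))).hasFDerivAt
  · exact h.tendsto_at (hsub y hy (mem_ball_self (half_pos hR)))

/-- First order expansion, with a quadratic error, of a map that is holomorphic near a point. -/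
theorem exists_taylor_bound {f : E → F} {x : E} (hf : ∀ᶠ y in 𝓝 x, DifferentiableAt ℂ f y) :
    ∃ r > 0, ∃ L > 0, (∀ p ∈ ball x r, DifferentiableAt ℂ f p) ∧
      (∀ p ∈ ball x r, ∀ q ∈ ball x r, ‖f p - f q‖ ≤ L * ‖p - q‖) ∧
      ∀ p ∈ ball x r, ∀ q ∈ ball x r, ‖f p - f q - fderiv ℂ f x (p - q)‖ ≤
        L * (‖p - x‖ + ‖q - x‖) * ‖p - q‖ := by
  have hcont : ∀ᶠ y in 𝓝 x, ‖f y‖ < ‖f x‖ + 1 :=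
    hf.self_of_nhds.continuousAt.norm.eventually_lt_const (lt_add_one _)
  obtain ⟨R, hR, hball⟩ := Metric.eventually_nhds_iff_ball.1 (hf.and hcont)
  set M := ‖f x‖ + 1 with hMdef
  have hM : 0 < M := by positivity
  -- Every point of the ball of radius `3r` keeps room `r` for Cauchy's estimate, and translating
  -- the ball of radius `r` by `p - x` stays within `3r`.
  set r := R / 4 with hr
  have hr0 : 0 < r := by positivity
  have hRr : R = 4 * r := by rw [hr]; ring
  have hd : ∀ y ∈ ball x R, DifferentiableAt ℂ f y := fun y hy => (hball y hy).1
  set L₁ := 2 * M / r with hL1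
  have hL10 : 0 < L₁ := by positivity
  have hb1 : ∀ y ∈ ball x (3 * r), ‖fderiv ℂ f y‖ ≤ L₁ := fun y hy => by
    have hs : ball y r ⊆ ball x R := ball_subset_ball' (by have := mem_ball.1 hy; linarith)
    exact norm_fderiv_le_of_norm_le hr0 (fun z hz => (hd z (hs hz)).differentiableWithinAt)
      fun z hz => (hball z (hs hz)).2.le
  let : NormedSpace ℝ E := NormedSpace.restrictScalars ℝ ℂ E
  have hlip : ∀ p ∈ ball x (3 * r), ∀ q ∈ ball x (3 * r), ‖f p - f q‖ ≤ L₁ * ‖p - q‖ :=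
    fun p hp q hq => (convex_ball x (3 * r)).norm_image_sub_le_of_norm_fderiv_le
      (fun y hy => hd y (ball_subset_ball (by linarith) hy)) hb1 hq hp
  set L₂ := 2 * L₁ / r with hL2
  have hL20 : 0 < L₂ := by positivity
  -- The Lipschitz bound for the derivative is Cauchy's estimate for `y ↦ f (y + (p - x)) - f y`,
  -- which is at most `L₁ ‖p - x‖`.
  have hder : ∀ p ∈ ball x r, ‖fderiv ℂ f p - fderiv ℂ f x‖ ≤ L₂ * ‖p - x‖ := by
    intro p hp
    have hshift : HasFDerivAt (fun y => f (y + (p - x))) (fderiv ℂ f p) x := by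
      have h1 : HasFDerivAt f (fderiv ℂ f p) (x + (p - x)) := by
        rw [add_sub_cancel]
        exact (hd p (ball_subset_ball (by linarith) hp)).hasFDerivAt
      exact (hasFDerivAt_comp_add_right (p - x)).2 h1
    have hfx := (hd x (mem_ball_self hR)).hasFDerivAt
    rw [← (hshift.sub hfx).fderiv]
    have hpx : ‖p - x‖ < r := by rwa [← dist_eq_norm]
    have hmem : ∀ y ∈ ball x r, y + (p - x) ∈ ball x (3 * r) := fun y hy => by
      rw [mem_ball, dist_eq_norm] at hy ⊢
      have := norm_add_le (y - x) (p - x)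
      rw [show y + (p - x) - x = (y - x) + (p - x) by abel]
      linarith
    refine (norm_fderiv_le_of_norm_le (M := L₁ * ‖p - x‖) hr0 (fun y hy => ?_)
      fun y hy => ?_).trans_eq (by rw [hL2]; ring)
    · refine DifferentiableAt.differentiableWithinAt (DifferentiableAt.sub ?_ ?_)
      · have := (hd _ (ball_subset_ball (by linarith) (hmem y hy))).hasFDerivAt
        exact ((hasFDerivAt_comp_add_right (p - x)).2 this).differentiableAt
      · exact hd y (ball_subset_ball (by linarith) hy)
    · have := hlip _ (hmem y hy) y (ball_subset_ball (by linarith) hy)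
      simpa using this
  refine ⟨r, hr0, max L₁ L₂, lt_max_of_lt_left hL10,
    fun p hp => hd p (ball_subset_ball (by linarith) hp), fun p hp q hq => ?_, fun p hp q hq => ?_⟩
  · exact (hlip p (ball_subset_ball (by linarith) hp) q (ball_subset_ball (by linarith) hq)).trans
      (mul_le_mul_of_nonneg_right (le_max_left _ _) (norm_nonneg _))
  · set m := max ‖p - x‖ ‖q - x‖
    have hmr : m < r := max_lt (by rwa [← dist_eq_norm]) (by rwa [← dist_eq_norm])
    have hcb : ∀ y ∈ closedBall x m, y ∈ ball x r := fun y hy => closedBall_subset_ball hmr hy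
    have hp' : p ∈ closedBall x m := by rw [mem_closedBall, dist_eq_norm]; exact le_max_left _ _
    have hq' : q ∈ closedBall x m := by rw [mem_closedBall, dist_eq_norm]; exact le_max_right _ _
    refine ((convex_closedBall x m).norm_image_sub_le_of_norm_fderiv_le' (C := L₂ * m)
      (fun y hy => hd y (ball_subset_ball (by linarith) (hcb y hy))) (fun y hy => ?_)
      hq' hp').trans ?_
    · refine (hder y (hcb y hy)).trans ?_
      rw [mem_closedBall, dist_eq_norm] at hy
      gcongr
    · gcongr
      · exact le_max_right _ _
      · exact max_le_add_of_nonneg (norm_nonneg _) (norm_nonneg _)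

end ComplexAnalysis

/-! ### The principal square root -/

section SquareRoot

theorem csqrt_sq (z : ℂ) : Complex.sqrt z ^ 2 = z := by
  simp [Complex.sqrt]

theorem csqrt_re_nonneg (z : ℂ) : 0 ≤ (Complex.sqrt z).re := by
  rw [Complex.sqrt, Complex.cpow_inv_two_re]
  exact Real.sqrt_nonneg _

/-- For `s = √z` one has `Re z = (Re s)² - (Im s)² ≤ (Re s)²`, and `Re s ≥ 0`. -/
theorem le_csqrt_re {r : ℝ} {z : ℂ} (h : r ^ 2 ≤ z.re) : r ≤ (Complex.sqrt z).re := by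
  have h1 : z.re = (Complex.sqrt z).re ^ 2 - (Complex.sqrt z).im ^ 2 := by
    conv_lhs => rw [← csqrt_sq z]
    rw [sq, Complex.mul_re]; ring
  refine le_of_abs_le (abs_le_of_sq_le_sq ?_ (csqrt_re_nonneg z))
  nlinarith [sq_nonneg (Complex.sqrt z).im]

theorem csqrt_eq_of_sq_eq {s z : ℂ} (hs : 0 < s.re) (h : s ^ 2 = z) : Complex.sqrt z = s := by
  have h1 : Complex.sqrt z ^ 2 = s ^ 2 := by rw [csqrt_sq, h]
  rcases sq_eq_sq_iff_eq_or_eq_neg.1 h1 with h2 | h2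
  · exact h2
  · have := csqrt_re_nonneg z
    rw [h2, Complex.neg_re] at this
    linarith

theorem csqrt_conj {z : ℂ} (hz : 0 < z.re) : Complex.sqrt (conj z) = conj (Complex.sqrt z) := by
  refine csqrt_eq_of_sq_eq ?_ (by rw [← map_pow, csqrt_sq])
  rw [Complex.conj_re]
  have : √z.re ≤ (Complex.sqrt z).re := le_csqrt_re (by rw [Real.sq_sqrt hz.le])
  exact (Real.sqrt_pos.2 hz).trans_le this

theorem re_add_re_le_norm (a b : ℂ) : a.re + b.re ≤ ‖a + b‖ := by
  rw [← Complex.add_re]; exact Complex.re_le_norm _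

/-- Difference of squares, in the form used to see that square roots contract. -/
theorem norm_sub_mul_le {a b : ℂ} {r s : ℝ} (ha : r ≤ a.re) (hb : s ≤ b.re) :
    (r + s) * ‖a - b‖ ≤ ‖a ^ 2 - b ^ 2‖ := by
  rw [show a ^ 2 - b ^ 2 = (a + b) * (a - b) by ring, norm_mul]
  gcongr
  exact le_trans (by linarith) (re_add_re_le_norm a b)

end SquareRoot

/-! ### The contracting inverse branch, its fixed point and its linearizer -/

section InverseBranch

/-- The parameters close to `-2` for which the constructions below are made. -/
def nearHat : Set ℂ := ball (-2) (1 / 100)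

/-- The half-plane on which the inverse branches are defined. -/
def halfPlane : Set ℂ := {w | -1 < w.re}

theorem isOpen_nearHat : IsOpen nearHat := isOpen_ball

theorem neg_two_mem_nearHat : (-2 : ℂ) ∈ nearHat := mem_ball_self (by norm_num)

theorem nearHat_mem_nhds : nearHat ∈ 𝓝 (-2 : ℂ) := isOpen_nearHat.mem_nhds neg_two_mem_nearHat

theorem conj_mem_nearHat {c : ℂ} (hc : c ∈ nearHat) : conj c ∈ nearHat := by
  rw [nearHat, mem_ball, dist_eq_norm] at hc ⊢
  rw [show conj c - -2 = conj (c - -2) by simp [Complex.conj_ofNat], RCLike.norm_conj]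
  exact hc

theorem norm_le_of_mem_nearHat {c : ℂ} (hc : c ∈ nearHat) : ‖c‖ ≤ 201 / 100 := by
  rw [nearHat, mem_ball, dist_eq_norm] at hc
  have := norm_add_le (c - -2) (-2)
  rw [sub_add_cancel, norm_neg, Complex.norm_ofNat] at this
  linarith

theorem re_le_of_mem_nearHat {c : ℂ} (hc : c ∈ nearHat) : c.re ≤ -199 / 100 := by
  rw [nearHat, mem_ball, dist_eq_norm] at hc
  have := (Complex.re_le_norm (c - -2)).trans hc.le
  simp at this
  linarith

theorem isOpen_halfPlane : IsOpen halfPlane := isOpen_lt continuous_const Complex.continuous_re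

theorem convex_halfPlane : Convex ℝ halfPlane := convex_halfSpace_re_gt _

/-- The radicand has real part above `-1 + 1.99 = 0.99 ≥ 0.99²`. -/
theorem csqrt_sub_re {c w : ℂ} (hc : c ∈ nearHat) (hw : w ∈ halfPlane) :
    99 / 100 ≤ (Complex.sqrt (w - c)).re := by
  refine le_csqrt_re ?_
  have h1 := re_le_of_mem_nearHat hc
  have h2 : -1 < w.re := hw
  rw [Complex.sub_re]
  linarith

/-- The inverse branch of `w ↦ (w² + d)² + c` that fixes a point near `2`. -/
noncomputable def invBranch (c d w : ℂ) : ℂ := Complex.sqrt (Complex.sqrt (w - c) - d)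

variable {c d : ℂ} {w w' : ℂ}

theorem invBranch_leftInverse (c d w : ℂ) : (invBranch c d w ^ 2 + d) ^ 2 + c = w := by
  rw [invBranch, csqrt_sq, sub_add_cancel, csqrt_sq, sub_add_cancel]

/-- The outer radicand has real part at least `0.99 + 1.99 = 2.98 ≥ 1.7²`. -/
theorem invBranch_re (hc : c ∈ nearHat) (hd : d ∈ nearHat) (hw : w ∈ halfPlane) :
    17 / 10 ≤ (invBranch c d w).re := by
  refine le_csqrt_re ?_
  have h1 := csqrt_sub_re hc hw
  have h2 := re_le_of_mem_nearHat hd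
  rw [Complex.sub_re]
  linarith

theorem invBranch_mem (hc : c ∈ nearHat) (hd : d ∈ nearHat) (hw : w ∈ halfPlane) :
    invBranch c d w ∈ halfPlane := by
  have h := invBranch_re hc hd hw
  change -1 < (invBranch c d w).re
  linarith

theorem invBranch_iterate_mem (hc : c ∈ nearHat) (hd : d ∈ nearHat) (hw : w ∈ halfPlane) (k : ℕ) :
    (invBranch c d)^[k] w ∈ halfPlane := by
  induction k with
  | zero => exact hw
  | succ k ih => rw [Function.iterate_succ_apply']; exact invBranch_mem hc hd ih

/-- A square root divides distances by the sum of the real parts of its values; the two roots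
together give `1.98 * 3.4 > 6`. -/
theorem invBranch_contract (hc : c ∈ nearHat) (hd : d ∈ nearHat) (hw : w ∈ halfPlane)
    (hw' : w' ∈ halfPlane) : ‖invBranch c d w - invBranch c d w'‖ ≤ 1 / 6 * ‖w - w'‖ := by
  have h1 := norm_sub_mul_le (csqrt_sub_re hc hw) (csqrt_sub_re hc hw')
  have h2 := norm_sub_mul_le (invBranch_re hc hd hw) (invBranch_re hc hd hw')
  rw [csqrt_sq, csqrt_sq, sub_sub_sub_cancel_right] at h1
  rw [invBranch, invBranch, csqrt_sq, csqrt_sq, sub_sub_sub_cancel_right] at h2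
  rw [invBranch, invBranch]
  linarith [norm_nonneg (Complex.sqrt (w - c) - Complex.sqrt (w' - c))]

theorem two_mem_halfPlane : (2 : ℂ) ∈ halfPlane := by simp [halfPlane]; norm_num

theorem zero_mem_halfPlane : (0 : ℂ) ∈ halfPlane := by simp [halfPlane]

theorem norm_csqrt_le {z : ℂ} {r : ℝ} (hr : 0 ≤ r) (h : ‖z‖ ≤ r ^ 2) : ‖Complex.sqrt z‖ ≤ r := by
  refine le_of_abs_le (abs_le_of_sq_le_sq ?_ hr)
  rwa [← norm_pow, csqrt_sq]

theorem norm_invBranch_two_sub (hc : c ∈ nearHat) (hd : d ∈ nearHat) :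
    ‖invBranch c d 2 - 2‖ ≤ 5 := by
  have h1 : ‖Complex.sqrt (2 - c)‖ ≤ 3 := norm_csqrt_le (by norm_num) (by
    have := norm_sub_le 2 c
    have := norm_le_of_mem_nearHat hc
    rw [Complex.norm_ofNat] at *
    linarith)
  have h2 : ‖invBranch c d 2‖ ≤ 3 := norm_csqrt_le (by norm_num) (by
    have := norm_sub_le (Complex.sqrt (2 - c)) d
    have := norm_le_of_mem_nearHat hd
    linarith)
  have := norm_sub_le (invBranch c d 2) 2
  rw [Complex.norm_ofNat] at this
  linarith

theorem invBranch_iterate_contract (hc : c ∈ nearHat) (hd : d ∈ nearHat) (hw : w ∈ halfPlane)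
    (hw' : w' ∈ halfPlane) (k : ℕ) :
    ‖(invBranch c d)^[k] w - (invBranch c d)^[k] w'‖ ≤ (1 / 6) ^ k * ‖w - w'‖ := by
  induction k with
  | zero => simp
  | succ k ih =>
    rw [Function.iterate_succ_apply', Function.iterate_succ_apply']
    refine (invBranch_contract hc hd (invBranch_iterate_mem hc hd hw k)
      (invBranch_iterate_mem hc hd hw' k)).trans ?_
    rw [pow_succ]
    linarith

theorem norm_invBranch_iterate_succ_sub (hc : c ∈ nearHat) (hd : d ∈ nearHat) (k : ℕ) :
    ‖(invBranch c d)^[k + 1] 2 - (invBranch c d)^[k] 2‖ ≤ 5 * (1 / 6) ^ k := by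
  rw [Function.iterate_succ_apply]
  refine (invBranch_iterate_contract hc hd (invBranch_mem hc hd two_mem_halfPlane)
    two_mem_halfPlane k).trans ?_
  rw [mul_comm]
  gcongr
  exact norm_invBranch_two_sub hc hd

/-- The fixed point near `2` of `w ↦ (w² + d)² + c`. -/
noncomputable def fixPt (c d : ℂ) : ℂ := limUnder atTop fun k : ℕ => (invBranch c d)^[k] 2

theorem tendsto_fixPt (hc : c ∈ nearHat) (hd : d ∈ nearHat) :
    Tendsto (fun k : ℕ => (invBranch c d)^[k] 2) atTop (𝓝 (fixPt c d)) := by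
  refine (cauchySeq_of_le_geometric (1 / 6) 5 (by norm_num) fun k => ?_).tendsto_limUnder
  rw [dist_comm, dist_eq_norm]
  exact norm_invBranch_iterate_succ_sub hc hd k

theorem fixPt_re' (hc : c ∈ nearHat) (hd : d ∈ nearHat) : 17 / 10 ≤ (fixPt c d).re := by
  refine ge_of_tendsto ((Complex.continuous_re.tendsto _).comp (tendsto_fixPt hc hd)) ?_
  filter_upwards [eventually_ge_atTop 1] with k hk
  obtain ⟨m, rfl⟩ := Nat.exists_eq_add_of_le' hk
  simp only [Function.comp_apply]
  rw [Function.iterate_succ_apply']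
  exact invBranch_re hc hd (invBranch_iterate_mem hc hd two_mem_halfPlane m)

theorem fixPt_mem (hc : c ∈ nearHat) (hd : d ∈ nearHat) : fixPt c d ∈ halfPlane := by
  have h := fixPt_re' hc hd
  change -1 < (fixPt c d).re
  linarith

theorem invBranch_fixPt (hc : c ∈ nearHat) (hd : d ∈ nearHat) :
    invBranch c d (fixPt c d) = fixPt c d := by
  have h1 : Tendsto (fun k : ℕ => invBranch c d ((invBranch c d)^[k] 2)) atTop
      (𝓝 (invBranch c d (fixPt c d))) := by
    rw [tendsto_iff_norm_sub_tendsto_zero]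
    have h2 := (tendsto_iff_norm_sub_tendsto_zero.1 (tendsto_fixPt hc hd)).const_mul (1 / 6)
    rw [mul_zero] at h2
    exact squeeze_zero (fun _ => norm_nonneg _) (fun k => invBranch_contract hc hd
      (invBranch_iterate_mem hc hd two_mem_halfPlane k) (fixPt_mem hc hd)) h2
  refine tendsto_nhds_unique h1 (((tendsto_add_atTop_iff_nat 1).2 (tendsto_fixPt hc hd)).congr
    fun k => ?_)
  rw [Function.iterate_succ_apply']

theorem invBranch_iterate_fixPt (hc : c ∈ nearHat) (hd : d ∈ nearHat) (k : ℕ) :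
    (invBranch c d)^[k] (fixPt c d) = fixPt c d :=
  Function.iterate_fixed (invBranch_fixPt hc hd) k

theorem eq_fixPt_of_fixed (hc : c ∈ nearHat) (hd : d ∈ nearHat) (hw : w ∈ halfPlane)
    (h : invBranch c d w = w) : w = fixPt c d := by
  have := invBranch_contract hc hd hw (fixPt_mem hc hd)
  rw [h, invBranch_fixPt hc hd] at this
  rw [← sub_eq_zero, ← norm_eq_zero]
  linarith [norm_nonneg (w - fixPt c d)]

theorem fixPt_eq (hc : c ∈ nearHat) (hd : d ∈ nearHat) :
    (fixPt c d ^ 2 + d) ^ 2 + c = fixPt c d := by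
  conv_lhs => rw [← invBranch_fixPt hc hd]
  exact invBranch_leftInverse _ _ _

theorem csqrt_fixPt (hc : c ∈ nearHat) (hd : d ∈ nearHat) :
    Complex.sqrt (fixPt c d - c) = fixPt c d ^ 2 + d := by
  conv_rhs => rw [← invBranch_fixPt hc hd, invBranch, csqrt_sq, sub_add_cancel]

theorem fixPt_sq_add_re (hc : c ∈ nearHat) (hd : d ∈ nearHat) :
    19 / 10 ≤ (fixPt c d ^ 2 + d).re := by
  rw [← csqrt_fixPt hc hd]
  refine le_csqrt_re ?_
  have h1 := re_le_of_mem_nearHat hc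
  have h2 := fixPt_re' hc hd
  rw [Complex.sub_re]
  linarith

theorem fixPt_re (hc : c ∈ nearHat) (hd : d ∈ nearHat) : 19 / 10 ≤ (fixPt c d).re := by
  rw [← invBranch_fixPt hc hd]
  refine le_csqrt_re ?_
  have h1 := re_le_of_mem_nearHat hd
  have h2 := fixPt_sq_add_re hc hd
  rw [Complex.sub_re, csqrt_fixPt hc hd]
  linarith

/-- The two points are exchanged by the quadratic maps with parameters `d` and `c`, so the larger
modulus `M` satisfies `M² ≤ M + 2.01`, which forces `M ≤ 2.1`. -/
theorem norm_fixPt_le (hc : c ∈ nearHat) (hd : d ∈ nearHat) :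
    ‖fixPt c d‖ ≤ 21 / 10 ∧ ‖fixPt c d ^ 2 + d‖ ≤ 21 / 10 := by
  have h1 : ‖fixPt c d‖ ^ 2 ≤ ‖fixPt c d ^ 2 + d‖ + 201 / 100 := by
    have h := norm_sub_le (fixPt c d ^ 2 + d) d
    rw [add_sub_cancel_right, norm_pow] at h
    linarith [norm_le_of_mem_nearHat hd]
  have h2 : ‖fixPt c d ^ 2 + d‖ ^ 2 ≤ ‖fixPt c d‖ + 201 / 100 := by
    have h := norm_sub_le (fixPt c d) c
    have h' : fixPt c d - c = (fixPt c d ^ 2 + d) ^ 2 := by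
      rw [sub_eq_iff_eq_add, fixPt_eq hc hd]
    rw [h', norm_pow] at h
    linarith [norm_le_of_mem_nearHat hc]
  have p1 := norm_nonneg (fixPt c d)
  have p2 := norm_nonneg (fixPt c d ^ 2 + d)
  rcases le_total ‖fixPt c d‖ ‖fixPt c d ^ 2 + d‖ with h | h
  · have : ‖fixPt c d ^ 2 + d‖ ≤ 21 / 10 := by nlinarith
    exact ⟨h.trans this, this⟩
  · have : ‖fixPt c d‖ ≤ 21 / 10 := by nlinarith
    exact ⟨this, h.trans this⟩

/-- With one of the points at `β` the real parts are larger: `(0.99 + 1.9)(1.7 + 1.9) > 10`. The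
sharper rate matters because convergence of `koenigsApprox` needs `|λ| / 10² < 1`. -/
theorem invBranch_sub_fixPt (hc : c ∈ nearHat) (hd : d ∈ nearHat) (hw : w ∈ halfPlane) :
    ‖invBranch c d w - fixPt c d‖ ≤ 1 / 10 * ‖w - fixPt c d‖ := by
  have h1 := norm_sub_mul_le (csqrt_sub_re hc hw) (fixPt_sq_add_re hc hd)
  have h2 := norm_sub_mul_le (invBranch_re hc hd hw) (fixPt_re hc hd)
  have h3 : (fixPt c d ^ 2 + d) ^ 2 = fixPt c d - c := by
    rw [eq_sub_iff_add_eq, fixPt_eq hc hd]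
  rw [csqrt_sq, h3, sub_sub_sub_cancel_right] at h1
  have h4 : invBranch c d w ^ 2 - fixPt c d ^ 2 =
      Complex.sqrt (w - c) - (fixPt c d ^ 2 + d) := by
    rw [invBranch, csqrt_sq]; ring
  rw [h4] at h2
  linarith [norm_nonneg (w - fixPt c d)]

theorem invBranch_iterate_sub_fixPt (hc : c ∈ nearHat) (hd : d ∈ nearHat) (hw : w ∈ halfPlane)
    (k : ℕ) : ‖(invBranch c d)^[k] w - fixPt c d‖ ≤ (1 / 10) ^ k * ‖w - fixPt c d‖ := by
  induction k with
  | zero => simp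
  | succ k ih =>
    rw [Function.iterate_succ_apply']
    refine (invBranch_sub_fixPt hc hd (invBranch_iterate_mem hc hd hw k)).trans ?_
    rw [pow_succ]
    linarith

theorem tendsto_invBranch_iterate (hc : c ∈ nearHat) (hd : d ∈ nearHat) (hw : w ∈ halfPlane) :
    Tendsto (fun k : ℕ => (invBranch c d)^[k] w) atTop (𝓝 (fixPt c d)) := by
  rw [tendsto_iff_norm_sub_tendsto_zero]
  refine squeeze_zero (fun _ => norm_nonneg _) (invBranch_iterate_sub_fixPt hc hd hw) ?_
  simpa using (tendsto_pow_atTop_nhds_zero_of_lt_one (r := (1 / 10 : ℝ)) (by norm_num)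
    (by norm_num)).mul_const ‖w - fixPt c d‖

/-- The multiplier of `w ↦ (w² + d)² + c` at its fixed point near `2`. -/
noncomputable def fixMult (c d : ℂ) : ℂ := 4 * fixPt c d * (fixPt c d ^ 2 + d)

theorem norm_fixMult_le (hc : c ∈ nearHat) (hd : d ∈ nearHat) : ‖fixMult c d‖ ≤ 20 := by
  obtain ⟨h1, h2⟩ := norm_fixPt_le hc hd
  rw [fixMult, norm_mul, norm_mul, Complex.norm_ofNat]
  nlinarith [norm_nonneg (fixPt c d), norm_nonneg (fixPt c d ^ 2 + d)]

theorem fixMult_ne_zero (hc : c ∈ nearHat) (hd : d ∈ nearHat) : fixMult c d ≠ 0 := by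
  have h1 := fixPt_re hc hd
  have h2 := fixPt_sq_add_re hc hd
  refine mul_ne_zero (mul_ne_zero (by norm_num) ?_) ?_ <;> intro h
  · rw [h, Complex.zero_re] at h1; linarith
  · rw [h, Complex.zero_re] at h2; linarith

/-- The approximations `λᵏ (Gᵏ w - β)` of the linearizing coordinate. -/
noncomputable def koenigsApprox (k : ℕ) (c d w : ℂ) : ℂ :=
  fixMult c d ^ k * ((invBranch c d)^[k] w - fixPt c d)

/-- The linear part of `F(b + h) - F(b)` is `λ h`, so it cancels, leaving `λᵏ h²` times a bounded
factor. As `|λ| ≤ 20` and `|h| ≤ 10⁻ᵏ |w - b|`, the ratio is `20 / 100 = 1/5`. -/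
theorem norm_koenigsApprox_succ_sub (hc : c ∈ nearHat) (hd : d ∈ nearHat) (hw : w ∈ halfPlane)
    (k : ℕ) : ‖koenigsApprox (k + 1) c d w - koenigsApprox k c d w‖ ≤
      (‖w - fixPt c d‖ ^ 2 * (31 + 9 * ‖w - fixPt c d‖ + ‖w - fixPt c d‖ ^ 2)) * (1 / 5) ^ k := by
  set v := (invBranch c d)^[k] w with hv
  have hvU : v ∈ halfPlane := invBranch_iterate_mem hc hd hw k
  set b := fixPt c d with hb
  set h := invBranch c d v - b with hh
  have hg : invBranch c d v = b + h := by rw [hh]; ring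
  have hF : v - b = (b + h + b) * ((b + h) ^ 2 + b ^ 2 + 2 * d) * h := by
    have e1 := invBranch_leftInverse c d v
    have e2 := fixPt_eq hc hd
    rw [hg] at e1
    rw [← hb] at e2
    linear_combination -e1 + e2
  have key : koenigsApprox (k + 1) c d w - koenigsApprox k c d w =
      -(fixMult c d ^ k * h ^ 2 * (6 * b ^ 2 + 4 * b * h + h ^ 2 + 2 * d)) := by
    rw [koenigsApprox, koenigsApprox, Function.iterate_succ_apply', ← hv, ← hb, ← hh, hF, pow_succ]
    conv_lhs => enter [1, 1, 2]; rw [fixMult, ← hb]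
    ring
  have hN : ‖h‖ ≤ (1 / 10) ^ (k + 1) * ‖w - b‖ := by
    have := invBranch_iterate_sub_fixPt hc hd hw (k + 1)
    rwa [Function.iterate_succ_apply', ← hv, ← hb, ← hh] at this
  have hN1 : ‖h‖ ≤ ‖w - b‖ := hN.trans
    (mul_le_of_le_one_left (norm_nonneg _) (pow_le_one₀ (by norm_num) (by norm_num)))
  have hN2 : ‖h‖ ≤ (1 / 10) ^ k * ‖w - b‖ := hN.trans (mul_le_mul_of_nonneg_right
    (pow_le_pow_of_le_one (by norm_num) (by norm_num) (Nat.le_succ k)) (norm_nonneg _))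
  have hbn : ‖b‖ ≤ 21 / 10 := (norm_fixPt_le hc hd).1
  have hdn := norm_le_of_mem_nearHat hd
  have hlast : ‖6 * b ^ 2 + 4 * b * h + h ^ 2 + 2 * d‖ ≤ 31 + 9 * ‖w - b‖ + ‖w - b‖ ^ 2 := by
    refine (norm_add_le _ _).trans ((add_le_add_left ((norm_add_le _ _).trans
      (add_le_add_left (norm_add_le _ _) _)) _).trans ?_)
    simp only [norm_mul, norm_pow, Complex.norm_ofNat]
    have a1 : ‖b‖ ^ 2 ≤ (21 / 10) ^ 2 := by gcongr
    have a2 : ‖b‖ * ‖h‖ ≤ 21 / 10 * ‖w - b‖ := by gcongr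
    have a3 : ‖h‖ ^ 2 ≤ ‖w - b‖ ^ 2 := by gcongr
    nlinarith [norm_nonneg (w - b)]
  rw [key, norm_neg, norm_mul, norm_mul, norm_pow, norm_pow]
  calc ‖fixMult c d‖ ^ k * ‖h‖ ^ 2 * ‖6 * b ^ 2 + 4 * b * h + h ^ 2 + 2 * d‖
      ≤ 20 ^ k * ((1 / 10) ^ k * ‖w - b‖) ^ 2 * (31 + 9 * ‖w - b‖ + ‖w - b‖ ^ 2) := by
        gcongr
        exact norm_fixMult_le hc hd
    _ = _ := by
        have : (20 : ℝ) ^ k * ((1 / 10) ^ k) ^ 2 = (1 / 5) ^ k := by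
          rw [← pow_mul, mul_comm k 2, pow_mul, ← mul_pow]; norm_num
        rw [mul_pow, ← this]; ring

/-- The linearizing coordinate of `w ↦ (w² + d)² + c` at its fixed point near `2`, tangent to
`w - β` at the fixed point `β`. -/
noncomputable def koenigsLim (c d w : ℂ) : ℂ := limUnder atTop fun k => koenigsApprox k c d w

theorem tendsto_koenigsLim (hc : c ∈ nearHat) (hd : d ∈ nearHat) (hw : w ∈ halfPlane) :
    Tendsto (fun k => koenigsApprox k c d w) atTop (𝓝 (koenigsLim c d w)) := by
  refine (cauchySeq_of_le_geometric (1 / 5)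
    (‖w - fixPt c d‖ ^ 2 * (31 + 9 * ‖w - fixPt c d‖ + ‖w - fixPt c d‖ ^ 2)) (by norm_num)
    fun k => ?_).tendsto_limUnder
  rw [dist_comm, dist_eq_norm]
  exact norm_koenigsApprox_succ_sub hc hd hw k

theorem koenigsLim_fixPt (hc : c ∈ nearHat) (hd : d ∈ nearHat) :
    koenigsLim c d (fixPt c d) = 0 := by
  refine tendsto_nhds_unique (tendsto_koenigsLim hc hd (fixPt_mem hc hd))
    (tendsto_const_nhds.congr fun k => ?_)
  rw [koenigsApprox, invBranch_iterate_fixPt hc hd, sub_self, mul_zero]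

theorem fixMult_mul_koenigsLim_invBranch (hc : c ∈ nearHat) (hd : d ∈ nearHat)
    (hw : w ∈ halfPlane) :
    fixMult c d * koenigsLim c d (invBranch c d w) = koenigsLim c d w := by
  refine tendsto_nhds_unique
    ((tendsto_koenigsLim hc hd (invBranch_mem hc hd hw)).const_mul (fixMult c d))
    (((tendsto_add_atTop_iff_nat 1).2 (tendsto_koenigsLim hc hd hw)).congr fun k => ?_)
  rw [koenigsApprox, koenigsApprox, Function.iterate_succ_apply, pow_succ]
  ring

theorem fixMult_pow_mul_koenigsLim_iterate (hc : c ∈ nearHat) (hd : d ∈ nearHat)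
    (hw : w ∈ halfPlane) (k : ℕ) :
    fixMult c d ^ k * koenigsLim c d ((invBranch c d)^[k] w) = koenigsLim c d w := by
  induction k with
  | zero => simp
  | succ k ih =>
    rw [Function.iterate_succ_apply', pow_succ, mul_assoc,
      fixMult_mul_koenigsLim_invBranch hc hd (invBranch_iterate_mem hc hd hw k), ih]

attribute [irreducible] fixPt koenigsLim

end InverseBranch

/-! ### Joint holomorphy in the parameters and the point -/

section Holomorphy

/-- The triples `(c, d, w)` for which the linearizing coordinate is defined. -/
def paramDomain : Set (ℂ × ℂ × ℂ) := nearHat ×ˢ nearHat ×ˢ halfPlane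

theorem isOpen_paramDomain : IsOpen paramDomain :=
  isOpen_nearHat.prod (isOpen_nearHat.prod isOpen_halfPlane)

theorem mem_slitPlane_csqrt_sub {c w : ℂ} (hc : c ∈ nearHat) (hw : w ∈ halfPlane) :
    w - c ∈ Complex.slitPlane := by
  left
  have h1 := re_le_of_mem_nearHat hc
  have h2 : -1 < w.re := hw
  rw [Complex.sub_re]
  linarith

theorem differentiableAt_invBranch_iterate {p : ℂ × ℂ × ℂ} (hp : p ∈ paramDomain) (k : ℕ) :
    DifferentiableAt ℂ (fun p : ℂ × ℂ × ℂ => (invBranch p.1 p.2.1)^[k] p.2.2) p := by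
  obtain ⟨hc, hd, hw⟩ := hp
  induction k with
  | zero => exact differentiableAt_snd.comp p differentiableAt_snd
  | succ k ih =>
    simp only [Function.iterate_succ_apply']
    have hm := invBranch_iterate_mem hc hd hw k
    have h1 : DifferentiableAt ℂ
        (fun p : ℂ × ℂ × ℂ => Complex.sqrt ((invBranch p.1 p.2.1)^[k] p.2.2 - p.1)) p :=
      DifferentiableAt.fun_comp' (g := Complex.sqrt) p
        (Complex.differentiableAt_sqrt (mem_slitPlane_csqrt_sub hc hm))
        (ih.fun_sub differentiableAt_fst)
    refine DifferentiableAt.fun_comp' (g := Complex.sqrt) p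
      (Complex.differentiableAt_sqrt (mem_slitPlane_csqrt_sub hd ?_))
      (h1.fun_sub (differentiableAt_fst.comp p differentiableAt_snd))
    have := csqrt_sub_re hc hm
    change -1 < (Complex.sqrt ((invBranch p.1 p.2.1)^[k] p.2.2 - p.1)).re
    linarith

theorem differentiableAt_fixPt {p : ℂ × ℂ × ℂ} (hp : p ∈ paramDomain) :
    DifferentiableAt ℂ (fun p : ℂ × ℂ × ℂ => fixPt p.1 p.2.1) p := by
  obtain ⟨R, hR, hsub⟩ := Metric.isOpen_iff.1 isOpen_paramDomain p hp
  refine differentiableAt_of_tendstoUniformlyOn_ball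
    (f := fun k (p : ℂ × ℂ × ℂ) => (invBranch p.1 p.2.1)^[k] 2) hR (fun k q hq => ?_)
    (tendstoUniformlyOn_of_le_geometric (C := 5) (q := 1 / 6) (by norm_num) (by norm_num)
      (fun k q hq => ?_) fun q hq => ?_)
  · obtain ⟨hc, hd, -⟩ := hsub hq
    have h := differentiableAt_invBranch_iterate (p := (q.1, q.2.1, 2))
      ⟨hc, hd, two_mem_halfPlane⟩ k
    have h2 : DifferentiableAt ℂ (fun q : ℂ × ℂ × ℂ => (q.1, q.2.1, (2 : ℂ))) q := by fun_prop
    exact (h.comp q h2).differentiableWithinAt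
  · obtain ⟨hc, hd, -⟩ := hsub hq
    exact norm_invBranch_iterate_succ_sub hc hd k
  · obtain ⟨hc, hd, -⟩ := hsub hq
    exact tendsto_fixPt hc hd

theorem differentiableAt_fixMult {p : ℂ × ℂ × ℂ} (hp : p ∈ paramDomain) :
    DifferentiableAt ℂ (fun p : ℂ × ℂ × ℂ => fixMult p.1 p.2.1) p := by
  have h := differentiableAt_fixPt hp
  unfold fixMult
  fun_prop

theorem differentiableAt_koenigsLim {p : ℂ × ℂ × ℂ} (hp : p ∈ paramDomain) :
    DifferentiableAt ℂ (fun p : ℂ × ℂ × ℂ => koenigsLim p.1 p.2.1 p.2.2) p := by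
  obtain ⟨R₀, hR₀, hsub₀⟩ := Metric.isOpen_iff.1 isOpen_paramDomain p hp
  set R := min R₀ 1
  have hR : 0 < R := lt_min hR₀ one_pos
  have hsub : ball p R ⊆ paramDomain := (ball_subset_ball (min_le_left _ _)).trans hsub₀
  -- A uniform bound for `|w - β|` on the ball: the radius is at most `1` and `|β| ≤ 2.1`.
  set B := ‖p.2.2‖ + 4
  refine differentiableAt_of_tendstoUniformlyOn_ball
    (f := fun k (p : ℂ × ℂ × ℂ) => koenigsApprox k p.1 p.2.1 p.2.2) hR (fun k q hq => ?_)
    (tendstoUniformlyOn_of_le_geometric (C := B ^ 2 * (31 + 9 * B + B ^ 2)) (q := 1 / 5)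
      (by norm_num) (by norm_num) (fun k q hq => ?_) fun q hq => ?_)
  · have h1 := differentiableAt_fixPt (hsub hq)
    have h2 := differentiableAt_fixMult (hsub hq)
    have h3 := differentiableAt_invBranch_iterate (hsub hq) k
    exact ((h2.pow k).mul (h3.sub h1)).differentiableWithinAt
  · obtain ⟨hc, hd, hw⟩ := hsub hq
    refine (norm_koenigsApprox_succ_sub hc hd hw k).trans ?_
    have hB : ‖q.2.2 - fixPt q.1 q.2.1‖ ≤ B := by
      have h1 := norm_sub_le q.2.2 (fixPt q.1 q.2.1)
      have h2 := (norm_fixPt_le hc hd).1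
      have h3 : ‖q.2.2 - p.2.2‖ < 1 := by
        have : ‖q - p‖ < 1 := by
          rw [← dist_eq_norm]; exact (mem_ball.1 hq).trans_le (min_le_right _ _)
        exact ((norm_snd_le (q - p).2).trans (norm_snd_le (q - p))).trans_lt this
      have h4 := norm_add_le (q.2.2 - p.2.2) p.2.2
      rw [sub_add_cancel] at h4
      change _ ≤ ‖p.2.2‖ + 4
      linarith
    gcongr
  · obtain ⟨hc, hd, hw⟩ := hsub hq
    exact tendsto_koenigsLim hc hd hw

theorem differentiableAt_koenigsLim_right {c d w : ℂ} (hc : c ∈ nearHat) (hd : d ∈ nearHat)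
    (hw : w ∈ halfPlane) : DifferentiableAt ℂ (koenigsLim c d) w := by
  have hp : (c, d, w) ∈ paramDomain := ⟨hc, hd, hw⟩
  have h := differentiableAt_koenigsLim hp
  have h2 : DifferentiableAt ℂ (fun w : ℂ => (c, d, w)) w := by fun_prop
  have h3 := DifferentiableAt.fun_comp' w h h2
  exact h3

end Holomorphy

/-! ### The Chebyshev parameter `c = -2` -/

section Chebyshev

/-- Half-angle formula `2 cos θ + 2 = (2 cos (θ/2))²`; the condition on `θ` makes `cos (θ/2)`
positive and so selects the principal root. -/
theorem csqrt_two_cos {θ : ℝ} (hθ : |θ| < Real.pi) :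
    Complex.sqrt (((2 * Real.cos θ : ℝ) : ℂ) - -2) = ((2 * Real.cos (θ / 2) : ℝ) : ℂ) := by
  refine csqrt_eq_of_sq_eq ?_ ?_
  · rw [Complex.ofReal_re]
    have := abs_lt.1 hθ
    have := Real.cos_pos_of_mem_Ioo (x := θ / 2) ⟨by linarith, by linarith⟩
    linarith
  · have h := Real.cos_sq (θ / 2)
    rw [mul_div_cancel₀ θ two_ne_zero] at h
    have : (2 * Real.cos (θ / 2)) ^ 2 = 2 * Real.cos θ + 2 := by rw [mul_pow, h]; ring
    rw [← Complex.ofReal_pow, this]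
    push_cast; ring

theorem invBranch_two_cos {θ : ℝ} (hθ : |θ| < Real.pi) :
    invBranch (-2) (-2) ((2 * Real.cos θ : ℝ) : ℂ) = ((2 * Real.cos (θ / 4) : ℝ) : ℂ) := by
  have h2 : |θ / 2| < Real.pi := by
    rw [abs_div, abs_two]; linarith [abs_nonneg θ]
  rw [invBranch, csqrt_two_cos hθ, csqrt_two_cos h2]
  rw [show θ / 2 / 2 = θ / 4 by ring]

theorem invBranch_iterate_two_cos {θ : ℝ} (hθ : |θ| < Real.pi) (k : ℕ) :
    (invBranch (-2) (-2))^[k] ((2 * Real.cos θ : ℝ) : ℂ) =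
      ((2 * Real.cos (θ / 4 ^ k) : ℝ) : ℂ) := by
  induction k with
  | zero => simp
  | succ k ih =>
    rw [Function.iterate_succ_apply', ih, invBranch_two_cos, pow_succ, div_div]
    rw [abs_div, abs_of_pos (by positivity : (0 : ℝ) < 4 ^ k)]
    exact (div_le_self (abs_nonneg _) (one_le_pow₀ (by norm_num))).trans_lt hθ

theorem fixPt_neg_two : fixPt (-2) (-2) = 2 := by
  refine (eq_fixPt_of_fixed neg_two_mem_nearHat neg_two_mem_nearHat two_mem_halfPlane ?_).symm
  have := invBranch_two_cos (θ := 0) (by simpa using Real.pi_pos)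
  simpa using this

theorem fixMult_neg_two : fixMult (-2) (-2) = 16 := by
  rw [fixMult, fixPt_neg_two]; norm_num

/-- Here `2 cos x - 2 = -x² + O(x⁴)` at `x = θ / 4ᵏ`, and the error becomes `16ᵏ 4⁻⁴ᵏ = 16⁻ᵏ` up to
a constant. -/
theorem tendsto_two_cos_sub_two (θ : ℝ) :
    Tendsto (fun k : ℕ => (16 : ℝ) ^ k * (2 * Real.cos (θ / 4 ^ k) - 2)) atTop (𝓝 (-θ ^ 2)) := by
  have hx : Tendsto (fun k : ℕ => θ * (1 / 4) ^ k) atTop (𝓝 0) := by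
    simpa using (tendsto_pow_atTop_nhds_zero_of_lt_one (r := (1 / 4 : ℝ)) (by norm_num)
      (by norm_num)).const_mul θ
  have h16 : Tendsto (fun k : ℕ => |θ| ^ 4 * (5 / 48) * (1 / 16) ^ k) atTop (𝓝 0) := by
    simpa using (tendsto_pow_atTop_nhds_zero_of_lt_one (r := (1 / 16 : ℝ)) (by norm_num)
      (by norm_num)).const_mul (|θ| ^ 4 * (5 / 48))
  rw [tendsto_iff_norm_sub_tendsto_zero]
  refine squeeze_zero' (Eventually.of_forall fun _ => norm_nonneg _) ?_ h16
  have hev : ∀ᶠ k : ℕ in atTop, |θ * (1 / 4) ^ k| < 1 := by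
    have := hx.abs
    rw [abs_zero] at this
    exact this.eventually_lt_const one_pos
  filter_upwards [hev] with k hk
  have hdiv : θ / 4 ^ k = θ * (1 / 4) ^ k := by rw [one_div, inv_pow, div_eq_mul_inv]
  have hb := Real.cos_bound hk.le
  rw [hdiv, Real.norm_eq_abs]
  have e1 : (16 : ℝ) ^ k * ((1 / 4) ^ k) ^ 2 = 1 := by
    rw [← pow_mul, mul_comm k 2, pow_mul, ← mul_pow]; norm_num
  have e2 : (16 : ℝ) ^ k * ((1 / 4) ^ k) ^ 4 = (1 / 16) ^ k := by
    rw [← pow_mul, mul_comm k 4, pow_mul, ← mul_pow]; norm_num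
  have e3 : (16 : ℝ) ^ k * (2 * Real.cos (θ * (1 / 4) ^ k) - 2) - -θ ^ 2 =
      16 ^ k * 2 * (Real.cos (θ * (1 / 4) ^ k) - (1 - (θ * (1 / 4) ^ k) ^ 2 / 2)) := by
    linear_combination (-θ ^ 2) * e1
  rw [e3, abs_mul, abs_of_pos (by positivity : (0 : ℝ) < 16 ^ k * 2)]
  calc 16 ^ k * 2 * |Real.cos (θ * (1 / 4) ^ k) - (1 - (θ * (1 / 4) ^ k) ^ 2 / 2)|
      ≤ 16 ^ k * 2 * (|θ * (1 / 4) ^ k| ^ 4 * (5 / 96)) := by gcongr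
    _ = |θ| ^ 4 * (5 / 48) * (16 ^ k * ((1 / 4) ^ k) ^ 4) := by
        rw [abs_mul, abs_of_pos (by positivity : (0 : ℝ) < (1 / 4) ^ k)]; ring
    _ = _ := by rw [e2]

/-- At `c = -2` the linearizing coordinate is `-arccos² (w / 2)`. -/
theorem koenigsLim_two_cos {θ : ℝ} (hθ : |θ| < Real.pi) (hc : -1 < 2 * Real.cos θ) :
    koenigsLim (-2) (-2) ((2 * Real.cos θ : ℝ) : ℂ) = ((-θ ^ 2 : ℝ) : ℂ) := by
  have hw : ((2 * Real.cos θ : ℝ) : ℂ) ∈ halfPlane := hc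
  refine tendsto_nhds_unique
    (tendsto_koenigsLim neg_two_mem_nearHat neg_two_mem_nearHat hw)
    (((Complex.continuous_ofReal.tendsto _).comp (tendsto_two_cos_sub_two θ)).congr fun k => ?_)
  rw [koenigsApprox, invBranch_iterate_two_cos hθ, fixPt_neg_two, fixMult_neg_two]
  simp

theorem koenigsLim_neg_two_zero : koenigsLim (-2) (-2) 0 = ((-(Real.pi / 2) ^ 2 : ℝ) : ℂ) := by
  have h := koenigsLim_two_cos (θ := Real.pi / 2)
    (by rw [abs_of_pos (by positivity)]; linarith [Real.pi_pos]) (by simp)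
  simpa using h

theorem koenigsLim_neg_two_zero_ne : koenigsLim (-2) (-2) 0 ≠ 0 := by
  rw [koenigsLim_neg_two_zero, Complex.ofReal_ne_zero]
  exact neg_ne_zero.2 (pow_ne_zero 2 (half_pos Real.pi_pos).ne')

/-- Along `θ ↦ 2 cos θ` at `θ = π/2` the linearizer is `-θ²`, whose derivative `-π` is nonzero; the
chain rule excludes a critical point. -/
theorem deriv_koenigsLim_neg_two_zero_ne : deriv (koenigsLim (-2) (-2)) 0 ≠ 0 := by
  intro h0
  have h1 : HasDerivAt (koenigsLim (-2) (-2)) 0 (((2 * Real.cos (Real.pi / 2) : ℝ)) : ℂ) := by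
    rw [Real.cos_pi_div_two, mul_zero, Complex.ofReal_zero]
    simpa only [h0] using (differentiableAt_koenigsLim_right neg_two_mem_nearHat neg_two_mem_nearHat
      zero_mem_halfPlane).hasDerivAt
  have h2 : HasDerivAt (fun θ : ℝ => ((2 * Real.cos θ : ℝ) : ℂ))
      ((2 * -Real.sin (Real.pi / 2) : ℝ) : ℂ) (Real.pi / 2) :=
    ((Real.hasDerivAt_cos _).const_mul 2).ofReal_comp
  have h3 := h1.comp (Real.pi / 2) h2
  rw [zero_mul] at h3
  have h4 : HasDerivAt (fun θ : ℝ => ((-θ ^ 2 : ℝ) : ℂ))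
      ((-(2 * (Real.pi / 2)) : ℝ) : ℂ) (Real.pi / 2) := by
    have := ((hasDerivAt_pow 2 (Real.pi / 2)).neg).ofReal_comp
    simpa using this
  have h5 : (fun θ : ℝ => ((-θ ^ 2 : ℝ) : ℂ)) =ᶠ[𝓝 (Real.pi / 2)]
      koenigsLim (-2) (-2) ∘ fun θ : ℝ => ((2 * Real.cos θ : ℝ) : ℂ) := by
    have ha : ∀ᶠ θ : ℝ in 𝓝 (Real.pi / 2), |θ| < Real.pi :=
      continuous_abs.continuousAt.eventually_lt_const
        (by rw [abs_of_pos (by positivity)]; linarith [Real.pi_pos])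
    have hb : ∀ᶠ θ : ℝ in 𝓝 (Real.pi / 2), -1 < 2 * Real.cos θ :=
      (continuous_const.mul Real.continuous_cos).continuousAt.eventually_const_lt (by simp)
    filter_upwards [ha, hb] with θ h1 h2
    exact (koenigsLim_two_cos h1 h2).symm
  have h6 := (h3.congr_of_eventuallyEq h5).unique h4
  have := Complex.ofReal_eq_zero.1 h6.symm
  linarith [Real.pi_pos]

/-- The parametrization `2 cos θ` is critical at `θ = 0`, so the chain rule is useless and sizes are
compared: a zero derivative would give `θ² ≤ (2 - 2 cos θ) / 2 ≤ θ² / 2` for small `θ`. -/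
theorem deriv_koenigsLim_neg_two_two_ne : deriv (koenigsLim (-2) (-2)) 2 ≠ 0 := by
  intro h0
  have h1 : HasDerivAt (koenigsLim (-2) (-2)) 0 2 := by
    simpa only [h0] using (differentiableAt_koenigsLim_right neg_two_mem_nearHat neg_two_mem_nearHat
      two_mem_halfPlane).hasDerivAt
  have h2 := hasDerivAt_iff_isLittleO.1 h1
  have h3 : Tendsto (fun θ : ℝ => ((2 * Real.cos θ : ℝ) : ℂ)) (𝓝 0) (𝓝 2) := by
    have : Continuous fun θ : ℝ => ((2 * Real.cos θ : ℝ) : ℂ) := by fun_prop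
    simpa using this.tendsto 0
  have h4 := (h2.comp_tendsto h3).bound (half_pos one_pos)
  have h5 : koenigsLim (-2) (-2) 2 = 0 := by
    have := koenigsLim_fixPt neg_two_mem_nearHat neg_two_mem_nearHat
    rwa [fixPt_neg_two] at this
  have hb : ∀ᶠ θ : ℝ in 𝓝 0, -1 < 2 * Real.cos θ :=
    (continuous_const.mul Real.continuous_cos).continuousAt.eventually_const_lt (by simp; norm_num)
  have ha : ∀ᶠ θ : ℝ in 𝓝 (0 : ℝ), |θ| < Real.pi :=
    continuous_abs.continuousAt.eventually_lt_const (by simpa using Real.pi_pos)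
  obtain ⟨ε, hε, hball⟩ := Metric.eventually_nhds_iff_ball.1 (h4.and (ha.and hb))
  obtain ⟨i1, i2, i3⟩ := hball (ε / 2) (by
    rw [mem_ball, Real.dist_0_eq_abs, abs_of_pos (by positivity)]; linarith)
  simp only [Function.comp_apply, smul_zero, sub_zero, h5] at i1
  rw [koenigsLim_two_cos i2 i3, Complex.norm_real, Real.norm_eq_abs, abs_neg,
    abs_of_nonneg (by positivity)] at i1
  have e : (((2 * Real.cos (ε / 2) : ℝ) : ℂ) - 2) = ((2 * Real.cos (ε / 2) - 2 : ℝ) : ℂ) := by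
    push_cast; ring
  rw [e, Complex.norm_real, Real.norm_eq_abs] at i1
  have i4 := Real.one_sub_sq_div_two_le_cos (x := ε / 2)
  have i5 := Real.cos_le_one (ε / 2)
  rw [abs_of_nonpos (by linarith)] at i1
  nlinarith

end Chebyshev

/-! ### The ray of angle `0` and its landing point -/

section Ray

/-- The inverse branch of `antiQuad c` that fixes a point near `2`. -/
noncomputable def invStep (c w : ℂ) : ℂ := conj (Complex.sqrt (w - c))

variable {c w w' : ℂ}

theorem antiQuad_invStep (c w : ℂ) : antiQuad c (invStep c w) = w := by
  rw [antiQuad, invStep, Complex.conj_conj, csqrt_sq, sub_add_cancel]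

theorem invStep_re (hc : c ∈ nearHat) (hw : w ∈ halfPlane) : 99 / 100 ≤ (invStep c w).re := by
  rw [invStep, Complex.conj_re]
  exact csqrt_sub_re hc hw

theorem invStep_mem (hc : c ∈ nearHat) (hw : w ∈ halfPlane) : invStep c w ∈ halfPlane := by
  have := invStep_re hc hw
  change -1 < (invStep c w).re
  linarith

theorem mapsTo_invStep (hc : c ∈ nearHat) : Set.MapsTo (invStep c) halfPlane halfPlane :=
  fun _ hw => invStep_mem hc hw

theorem norm_invStep_sub (hc : c ∈ nearHat) (hw : w ∈ halfPlane) (hw' : w' ∈ halfPlane) :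
    ‖invStep c w - invStep c w'‖ ≤ 2 / 3 * ‖w - w'‖ := by
  have h1 := norm_sub_mul_le (csqrt_sub_re hc hw) (csqrt_sub_re hc hw')
  rw [csqrt_sq, csqrt_sq, sub_sub_sub_cancel_right] at h1
  rw [invStep, invStep, ← map_sub, RCLike.norm_conj]
  linarith [norm_nonneg (w - w')]

theorem norm_invStep_iterate_sub (hc : c ∈ nearHat) (hw : w ∈ halfPlane) (hw' : w' ∈ halfPlane)
    (k : ℕ) : ‖(invStep c)^[k] w - (invStep c)^[k] w'‖ ≤ (2 / 3) ^ k * ‖w - w'‖ := by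
  induction k with
  | zero => simp
  | succ k ih =>
    rw [Function.iterate_succ_apply', Function.iterate_succ_apply']
    refine (norm_invStep_sub hc ((mapsTo_invStep hc).iterate k hw)
      ((mapsTo_invStep hc).iterate k hw')).trans ?_
    rw [pow_succ]
    linarith

theorem continuousOn_invStep (hc : c ∈ nearHat) : ContinuousOn (invStep c) halfPlane := by
  intro w hw
  have h := (Complex.differentiableAt_sqrt (mem_slitPlane_csqrt_sub hc hw)).continuousAt
  have h2 : ContinuousAt (fun w : ℂ => w - c) w := by fun_prop
  exact (Complex.continuous_conj.continuousAt.comp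
    (ContinuousAt.comp (f := fun w : ℂ => w - c) h h2)).continuousWithinAt

/-- Conjugation commutes with the principal root off the cut. This is where the second parameter
becomes `conj c`. -/
theorem invStep_invStep (hc : c ∈ nearHat) (hw : w ∈ halfPlane) :
    invStep c (invStep c w) = invBranch c (conj c) w := by
  have h : 0 < (Complex.sqrt (w - c) - conj c).re := by
    have h1 := csqrt_sub_re hc hw
    have h2 := re_le_of_mem_nearHat hc
    rw [Complex.sub_re, Complex.conj_re]
    linarith
  have h2 : conj (Complex.sqrt (w - c)) - c = conj (Complex.sqrt (w - c) - conj c) := by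
    rw [map_sub, Complex.conj_conj]
  rw [invBranch, invStep, invStep, h2, csqrt_conj h, Complex.conj_conj]

/-- A map commutes with its square, so it sends the fixed point of the square to a fixed point of
the square, and that one is unique. -/
theorem invStep_fixPt (hc : c ∈ nearHat) : invStep c (fixPt c (conj c)) = fixPt c (conj c) := by
  have hd := conj_mem_nearHat hc
  have hb := fixPt_mem hc hd
  refine eq_fixPt_of_fixed hc hd (invStep_mem hc hb) ?_
  rw [← invStep_invStep hc (invStep_mem hc hb), invStep_invStep hc hb, invBranch_fixPt hc hd]

theorem ofReal_exp_mem {s : ℝ} : ((Real.exp s : ℝ) : ℂ) ∈ halfPlane := by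
  change -1 < ((Real.exp s : ℝ) : ℂ).re
  rw [Complex.ofReal_re]
  linarith [Real.exp_pos s]

/-- The pull-back of the real axis is almost the real axis: `|√(x² - c) - x| ≤ |c| / 1.99`.
Contraction then makes the successive ray approximations geometrically close. -/
theorem norm_invStep_sq_sub (hc : c ∈ nearHat) {x : ℝ} (hx : 1 ≤ x) :
    ‖invStep c ((x ^ 2 : ℝ) : ℂ) - x‖ ≤ 2 := by
  have hm : ((x ^ 2 : ℝ) : ℂ) ∈ halfPlane := by
    change -1 < ((x ^ 2 : ℝ) : ℂ).re
    rw [Complex.ofReal_re]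
    linarith [sq_nonneg x]
  have h1 := norm_sub_mul_le (b := (x : ℂ)) (s := 1) (csqrt_sub_re hc hm) (by simpa using hx)
  rw [csqrt_sq, Complex.ofReal_pow, sub_sub, add_comm c, ← sub_sub, sub_self, zero_sub,
    norm_neg] at h1
  have h2 := norm_le_of_mem_nearHat hc
  have h3 : invStep c ((x ^ 2 : ℝ) : ℂ) - x = conj (Complex.sqrt (((x ^ 2 : ℝ) : ℂ) - c) - x) := by
    rw [invStep, map_sub, Complex.conj_ofReal]
  rw [h3, RCLike.norm_conj, Complex.ofReal_pow]
  linarith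

/-- Approximations of the ray of angle `0`: pull-backs of the real axis near infinity. -/
noncomputable def rayApprox (c : ℂ) (k : ℕ) (s : ℝ) : ℂ :=
  (invStep c)^[k] (Real.exp (2 ^ k * s) : ℝ)

theorem rayApprox_mem (hc : c ∈ nearHat) (k : ℕ) (s : ℝ) : rayApprox c k s ∈ halfPlane :=
  (mapsTo_invStep hc).iterate k ofReal_exp_mem

theorem invStep_rayApprox (c : ℂ) (k : ℕ) (s : ℝ) :
    invStep c (rayApprox c k (2 * s)) = rayApprox c (k + 1) s := by
  rw [rayApprox, rayApprox, Function.iterate_succ_apply', pow_succ, mul_assoc]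

theorem norm_rayApprox_succ_sub (hc : c ∈ nearHat) (k : ℕ) {s : ℝ} (hs : 0 < s) :
    ‖rayApprox c (k + 1) s - rayApprox c k s‖ ≤ 2 * (2 / 3) ^ k := by
  have he : Real.exp (2 ^ (k + 1) * s) = Real.exp (2 ^ k * s) ^ 2 := by
    rw [← Real.exp_nat_mul]; push_cast; ring_nf
  rw [rayApprox, rayApprox, Function.iterate_succ_apply]
  refine (norm_invStep_iterate_sub hc (invStep_mem hc ofReal_exp_mem) ofReal_exp_mem k).trans ?_
  rw [mul_comm, he]
  gcongr
  exact norm_invStep_sq_sub hc (Real.one_le_exp (by positivity))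

/-- The ray of angle `0` of `antiQuad c`. -/
noncomputable def zeroRay (c : ℂ) (s : ℝ) : ℂ := limUnder atTop fun k => rayApprox c k s

theorem tendsto_zeroRay (hc : c ∈ nearHat) {s : ℝ} (hs : 0 < s) :
    Tendsto (fun k => rayApprox c k s) atTop (𝓝 (zeroRay c s)) := by
  refine (cauchySeq_of_le_geometric (2 / 3) 2 (by norm_num) fun k => ?_).tendsto_limUnder
  rw [dist_comm, dist_eq_norm]
  exact norm_rayApprox_succ_sub hc k hs

theorem zeroRay_re (hc : c ∈ nearHat) {s : ℝ} (hs : 0 < s) : 99 / 100 ≤ (zeroRay c s).re := by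
  refine ge_of_tendsto ((Complex.continuous_re.tendsto _).comp (tendsto_zeroRay hc hs)) ?_
  filter_upwards [eventually_ge_atTop 1] with k hk
  obtain ⟨m, rfl⟩ := Nat.exists_eq_add_of_le' hk
  rw [Function.comp_apply, ← invStep_rayApprox]
  exact invStep_re hc (rayApprox_mem hc _ _)

theorem zeroRay_mem (hc : c ∈ nearHat) {s : ℝ} (hs : 0 < s) : zeroRay c s ∈ halfPlane := by
  have := zeroRay_re hc hs
  change -1 < (zeroRay c s).re
  linarith

theorem zeroRay_ne_zero (hc : c ∈ nearHat) {s : ℝ} (hs : 0 < s) : zeroRay c s ≠ 0 := fun h => by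
  have := zeroRay_re hc hs
  rw [h, Complex.zero_re] at this
  linarith

theorem invStep_zeroRay (hc : c ∈ nearHat) {s : ℝ} (hs : 0 < s) :
    invStep c (zeroRay c (2 * s)) = zeroRay c s := by
  have h2 : 0 < 2 * s := by positivity
  refine tendsto_nhds_unique ?_ ((tendsto_add_atTop_iff_nat 1).2 (tendsto_zeroRay hc hs))
  simp only [← invStep_rayApprox]
  exact ((continuousOn_invStep hc).continuousAt
    (isOpen_halfPlane.mem_nhds (zeroRay_mem hc h2))).tendsto.comp (tendsto_zeroRay hc h2)

theorem norm_zeroRay_sub_exp (hc : c ∈ nearHat) {s : ℝ} (hs : 0 < s) :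
    ‖zeroRay c s - (Real.exp s : ℝ)‖ ≤ 6 := by
  have h := dist_le_of_le_geometric_of_tendsto₀ (2 / 3) 2 (by norm_num) (fun k => by
    rw [dist_comm, dist_eq_norm]; exact norm_rayApprox_succ_sub hc k hs) (tendsto_zeroRay hc hs)
  rw [dist_comm, dist_eq_norm] at h
  have h0 : rayApprox c 0 s = (Real.exp s : ℝ) := by simp [rayApprox]
  rw [h0] at h
  exact h.trans (by norm_num)

theorem isZeroRay_zeroRay (hc : c ∈ nearHat) : IsZeroRay c (zeroRay c) where
  continuousOn := by
    have hU : TendstoUniformlyOn (rayApprox c) (zeroRay c) atTop (Set.Ioi 0) :=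
      tendstoUniformlyOn_of_le_geometric (C := 2) (q := 2 / 3) (by norm_num) (by norm_num)
        (fun k s hs => norm_rayApprox_succ_sub hc k hs) fun s hs => tendsto_zeroRay hc hs
    refine hU.continuousOn (Eventually.of_forall fun k => ?_).frequently
    refine ((continuousOn_invStep hc).iterate (mapsTo_invStep hc) k).comp (by fun_prop)
      fun s _ => ofReal_exp_mem
  map_eq s hs := by rw [← invStep_zeroRay hc hs, antiQuad_invStep]
  asymptotic := by
    rw [tendsto_iff_norm_sub_tendsto_zero]
    have h6 : Tendsto (fun s : ℝ => 6 * Real.exp (-s)) atTop (𝓝 0) := by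
      simpa using Real.tendsto_exp_neg_atTop_nhds_zero.const_mul 6
    refine squeeze_zero' (Eventually.of_forall fun _ => norm_nonneg _) ?_ h6
    filter_upwards [eventually_gt_atTop 0] with s hs
    have hne : ((Real.exp s : ℝ) : ℂ) ≠ 0 := Complex.ofReal_ne_zero.2 (Real.exp_pos s).ne'
    rw [div_sub_one hne, norm_div, Complex.norm_real, Real.norm_eq_abs,
      abs_of_pos (Real.exp_pos s), Real.exp_neg, div_eq_mul_inv]
    gcongr
    exact norm_zeroRay_sub_exp hc hs

theorem zeroRay_eq_invStep_iterate (hc : c ∈ nearHat) {s : ℝ} (hs : 0 < s) (k : ℕ) :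
    zeroRay c s = (invStep c)^[k] (zeroRay c (2 ^ k * s)) := by
  induction k with
  | zero => simp
  | succ k ih =>
    rw [Function.iterate_succ_apply, pow_succ', mul_assoc, invStep_zeroRay hc (by positivity), ih]

theorem tendsto_zeroRay_fixPt (hc : c ∈ nearHat) :
    Tendsto (zeroRay c) (𝓝[>] 0) (𝓝 (fixPt c (conj c))) := by
  have hd := conj_mem_nearHat hc
  rw [Metric.tendsto_nhds]
  intro ε hε
  -- For `2ᵏ s ≤ 1` the ray point at `2ᵏ s` is within `6 + 3 + 2.1 < 12` of `β`; `k` inverse steps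
  -- shrink this by `(2/3)ᵏ`.
  have ht : Tendsto (fun k : ℕ => (2 / 3 : ℝ) ^ k * 12) atTop (𝓝 0) := by
    simpa using (tendsto_pow_atTop_nhds_zero_of_lt_one (r := (2 / 3 : ℝ)) (by norm_num)
      (by norm_num)).mul_const 12
  obtain ⟨k, hk⟩ := (ht.eventually_lt_const hε).exists
  have hpos : (0 : ℝ) < (2 ^ k)⁻¹ := by positivity
  filter_upwards [Ioo_mem_nhdsGT hpos] with s hs
  have hs0 : 0 < s := hs.1
  have hks : 0 < 2 ^ k * s := by positivity
  have hs1 : 2 ^ k * s ≤ 1 := by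
    have := mul_le_mul_of_nonneg_left hs.2.le (by positivity : (0 : ℝ) ≤ 2 ^ k)
    rwa [mul_inv_cancel₀ (by positivity)] at this
  have hfix : (invStep c)^[k] (fixPt c (conj c)) = fixPt c (conj c) :=
    Function.iterate_fixed (invStep_fixPt hc) k
  rw [dist_eq_norm, zeroRay_eq_invStep_iterate hc hs0 k, ← hfix]
  refine (norm_invStep_iterate_sub hc (zeroRay_mem hc hks) (fixPt_mem hc hd) k).trans_lt
    (lt_of_le_of_lt ?_ hk)
  gcongr
  have h1 := norm_zeroRay_sub_exp hc hks
  have h2 := (norm_fixPt_le hc hd).1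
  have h3 : ‖((Real.exp (2 ^ k * s) : ℝ) : ℂ)‖ ≤ 3 := by
    rw [Complex.norm_real, Real.norm_eq_abs, abs_of_pos (Real.exp_pos _)]
    exact (Real.exp_le_exp.2 hs1).trans (by linarith [Real.exp_one_lt_d9])
  have h4 := norm_add_le (zeroRay c (2 ^ k * s) - (Real.exp (2 ^ k * s) : ℝ))
    (Real.exp (2 ^ k * s) : ℝ)
  rw [sub_add_cancel] at h4
  have h5 := norm_sub_le (zeroRay c (2 ^ k * s)) (fixPt c (conj c))
  linarith

theorem norm_antiQuad_sub (c z w : ℂ) :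
    ‖antiQuad c z - antiQuad c w‖ = ‖z + w‖ * ‖z - w‖ := by
  have : antiQuad c z - antiQuad c w = conj ((z + w) * (z - w)) := by
    simp only [antiQuad, map_mul, map_add, map_sub]; ring
  rw [this, RCLike.norm_conj, norm_mul]

/-- Two rays of angle `0` agree near infinity. -/
theorem IsZeroRay.eventually_eq {γ₁ γ₂ : ℝ → ℂ} (h₁ : IsZeroRay c γ₁) (h₂ : IsZeroRay c γ₂) :
    ∃ S > 0, ∀ s ≥ S, γ₁ s = γ₂ s := by
  have hb : ∀ {γ : ℝ → ℂ}, IsZeroRay c γ →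
      ∀ᶠ s : ℝ in atTop, ‖γ s / (Real.exp s : ℂ) - 1‖ < 1 / 4 := fun h =>
    (tendsto_iff_norm_sub_tendsto_zero.1 h.asymptotic).eventually_lt_const (by norm_num)
  obtain ⟨S, hS⟩ := eventually_atTop.1 ((hb h₁).and (hb h₂))
  refine ⟨max S 1, by positivity, fun s hs => ?_⟩
  -- The relative distance of the rays is multiplied at `2s` by the modulus of the sum of the
  -- normalized points, at least `3/2` for large `s`. Being bounded by `1`, it must vanish.
  set r : ℝ → ℝ := fun s => ‖γ₁ s / (Real.exp s : ℂ) - γ₂ s / (Real.exp s : ℂ)‖ with hr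
  have hr1 : ∀ s ≥ S, r s ≤ 1 := fun s hs => by
    obtain ⟨a, b⟩ := hS s hs
    have := norm_sub_le (γ₁ s / (Real.exp s : ℂ) - 1) (γ₂ s / (Real.exp s : ℂ) - 1)
    rw [sub_sub_sub_cancel_right] at this
    simp only [hr]; linarith
  have hne : ∀ s : ℝ, (Real.exp s : ℂ) ≠ 0 := fun s =>
    Complex.ofReal_ne_zero.2 (Real.exp_pos s).ne'
  have hr2 : ∀ s ≥ max S 1, 3 / 2 * r s ≤ r (2 * s) := fun s hs => by
    have hs0 : 0 < s := lt_of_lt_of_le (by positivity) hs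
    obtain ⟨a, b⟩ := hS s ((le_max_left _ _).trans hs)
    have hsum : 3 / 2 ≤ ‖γ₁ s / (Real.exp s : ℂ) + γ₂ s / (Real.exp s : ℂ)‖ := by
      have e : (2 : ℂ) = (γ₁ s / (Real.exp s : ℂ) + γ₂ s / (Real.exp s : ℂ)) -
          ((γ₁ s / (Real.exp s : ℂ) - 1) + (γ₂ s / (Real.exp s : ℂ) - 1)) := by ring
      have h1 := norm_sub_le (γ₁ s / (Real.exp s : ℂ) + γ₂ s / (Real.exp s : ℂ))
        ((γ₁ s / (Real.exp s : ℂ) - 1) + (γ₂ s / (Real.exp s : ℂ) - 1))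
      rw [← e, Complex.norm_ofNat] at h1
      have h2 := norm_add_le (γ₁ s / (Real.exp s : ℂ) - 1) (γ₂ s / (Real.exp s : ℂ) - 1)
      linarith
    have hexp : (Real.exp (2 * s) : ℂ) = (Real.exp s : ℂ) * (Real.exp s : ℂ) := by
      rw [← Complex.ofReal_mul, ← Real.exp_add, two_mul]
    have key : r (2 * s) = ‖γ₁ s / (Real.exp s : ℂ) + γ₂ s / (Real.exp s : ℂ)‖ * r s := by
      simp only [hr]
      rw [← sub_div, ← sub_div, ← add_div, norm_div, norm_div, norm_div, ← h₁.map_eq s hs0,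
        ← h₂.map_eq s hs0, norm_antiQuad_sub, hexp, norm_mul, mul_div_mul_comm]
    rw [key]
    gcongr
  have hr3 : ∀ k : ℕ, (3 / 2) ^ k * r s ≤ r (2 ^ k * s) ∧ max S 1 ≤ 2 ^ k * s := fun k => by
    induction k with
    | zero => simpa using hs
    | succ k ih =>
      have h1 := hr2 _ ih.2
      rw [pow_succ' 2 k, mul_assoc]
      refine ⟨le_trans ?_ h1, ?_⟩
      · rw [pow_succ', mul_assoc]
        exact mul_le_mul_of_nonneg_left ih.1 (by norm_num)
      · have : (1 : ℝ) ≤ 2 ^ k * s := (le_max_right _ _).trans ih.2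
        linarith [ih.2]
  have hr0 : r s = 0 := by
    by_contra hne0
    have hpos : 0 < r s := lt_of_le_of_ne (norm_nonneg _) (Ne.symm hne0)
    obtain ⟨k, hk⟩ := pow_unbounded_of_one_lt (r s)⁻¹ (by norm_num : (1 : ℝ) < 3 / 2)
    have h1 := (hr3 k).1.trans (hr1 _ ((le_max_left _ _).trans (hr3 k).2))
    have h2 := mul_lt_mul_of_pos_right hk hpos
    rw [inv_mul_cancel₀ hne0] at h2
    linarith
  have := sub_eq_zero.1 (norm_eq_zero.1 hr0)
  exact (div_left_inj' (hne s)).1 this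

/-- Agreement near infinity is pulled back by halving the potential: the squares agree on a
half-line, and continuity, connectedness and nonvanishing of `zeroRay` fix the sign. -/
theorem IsZeroRay.eq_zeroRay (hc : c ∈ nearHat) {γ : ℝ → ℂ} (h : IsZeroRay c γ) {s : ℝ}
    (hs : 0 < s) : γ s = zeroRay c s := by
  have hz := isZeroRay_zeroRay hc
  obtain ⟨S, hS0, hS⟩ := h.eventually_eq hz
  have key : ∀ k : ℕ, Set.EqOn γ (zeroRay c) (Set.Ici (S / 2 ^ k)) := fun k => by
    induction k with
    | zero => intro s hs; exact hS s (by simpa using hs)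
    | succ k ih =>
      have hsub : Set.Ici (S / 2 ^ (k + 1)) ⊆ Set.Ioi 0 := fun s hs =>
        lt_of_lt_of_le (by positivity : 0 < S / 2 ^ (k + 1)) hs
      have hS' : S ∈ Set.Ici (S / 2 ^ (k + 1)) :=
        div_le_self hS0.le (one_le_pow₀ (by norm_num))
      refine isPreconnected_Ici.eq_of_sq_eq (h.continuousOn.mono hsub) (hz.continuousOn.mono hsub)
        (fun s hs => ?_) (fun {s} hs => zeroRay_ne_zero hc (hsub hs)) hS' (hS S le_rfl)
      have h2 : 2 * s ∈ Set.Ici (S / 2 ^ k) := by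
        have : S / 2 ^ (k + 1) ≤ s := hs
        rw [pow_succ, ← div_div] at this
        change S / 2 ^ k ≤ 2 * s
        linarith
      have h3 := ih h2
      rw [← h.map_eq s (hsub hs), ← hz.map_eq s (hsub hs), antiQuad, antiQuad, add_left_inj,
        ← map_pow, ← map_pow] at h3
      exact (starRingEnd ℂ).injective h3
  obtain ⟨k, hk⟩ := pow_unbounded_of_one_lt (S / s) (by norm_num : (1 : ℝ) < 2)
  refine key k ?_
  change S / 2 ^ k ≤ s
  rw [div_lt_iff₀ hs] at hk
  rw [div_le_iff₀ (by positivity)]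
  linarith

theorem zeroRayLandsAt_iff (hc : c ∈ nearHat) {b : ℂ} :
    ZeroRayLandsAt c b ↔ b = fixPt c (conj c) := by
  constructor
  · rintro ⟨γ, hγ, hb⟩
    refine tendsto_nhds_unique hb ((tendsto_zeroRay_fixPt hc).congr' ?_)
    filter_upwards [self_mem_nhdsWithin] with s hs
    exact (hγ.eq_zeroRay hc hs).symm
  · rintro rfl
    exact ⟨zeroRay c, isZeroRay_zeroRay hc, tendsto_zeroRay_fixPt hc⟩

theorem betaPt_eq (hc : c ∈ nearHat) : betaPt c = fixPt c (conj c) := by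
  rw [← zeroRayLandsAt_iff hc]
  exact Classical.epsilon_spec ⟨_, (zeroRayLandsAt_iff hc).2 rfl⟩

theorem antiQuad_iterate_two (c w : ℂ) : (antiQuad c)^[2] w = (w ^ 2 + conj c) ^ 2 + c := by
  simp [antiQuad]

theorem mult_eq (hc : c ∈ nearHat) : mult c = fixMult c (conj c) := by
  have h : (antiQuad c)^[2] = fun w => (w ^ 2 + conj c) ^ 2 + c :=
    funext (antiQuad_iterate_two c)
  rw [mult, betaPt_eq hc, h, fixMult]
  set b := fixPt c (conj c)
  have : HasDerivAt (fun w : ℂ => (w ^ 2 + conj c) ^ 2 + c)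
      (((2 : ℕ) : ℂ) * (b ^ 2 + conj c) ^ (2 - 1) * (((2 : ℕ) : ℂ) * b ^ (2 - 1))) b :=
    ((((hasDerivAt_pow 2 b).add_const _).fun_pow 2)).add_const _
  rw [this.deriv]
  push_cast
  ring

theorem bigLambda_eq : bigLambda = 16 := by
  rw [bigLambda, cHat, mult_eq neg_two_mem_nearHat, show conj (-2 : ℂ) = -2 by
    simp [Complex.conj_ofNat], fixMult_neg_two, Complex.norm_ofNat]

end Ray

/-! ### Uniqueness and normalization of the Koenigs coordinate -/

section Koenigs

variable {c d w : ℂ}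

/-- The linearizing coordinate normalized to take the value `1` at `0`. -/
noncomputable def normKoenigs (c d w : ℂ) : ℂ := koenigsLim c d w / koenigsLim c d 0

theorem invBranch_rightInverse (hw : 0 < w.re) (hw' : 0 < (w ^ 2 + d).re) :
    invBranch c d ((w ^ 2 + d) ^ 2 + c) = w := by
  rw [invBranch, add_sub_cancel_right, csqrt_eq_of_sq_eq hw' rfl, add_sub_cancel_right,
    csqrt_eq_of_sq_eq hw rfl]

theorem continuous_quartic (c d : ℂ) : Continuous fun w : ℂ => (w ^ 2 + d) ^ 2 + c := by fun_prop

theorem eventually_quartic_mem (hc : c ∈ nearHat) (hd : d ∈ nearHat) :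
    ∀ᶠ w in 𝓝 (fixPt c d), w ∈ halfPlane ∧ (w ^ 2 + d) ^ 2 + c ∈ halfPlane ∧
      invBranch c d ((w ^ 2 + d) ^ 2 + c) = w := by
  have h1 : ∀ᶠ w in 𝓝 (fixPt c d), w ∈ halfPlane := isOpen_halfPlane.mem_nhds (fixPt_mem hc hd)
  have h2 : ∀ᶠ w in 𝓝 (fixPt c d), (w ^ 2 + d) ^ 2 + c ∈ halfPlane :=
    (continuous_quartic c d).continuousAt.eventually_mem
      (isOpen_halfPlane.mem_nhds (by rw [fixPt_eq hc hd]; exact fixPt_mem hc hd))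
  have h3 : ∀ᶠ w in 𝓝 (fixPt c d), 0 < w.re :=
    Complex.continuous_re.continuousAt.eventually_const_lt (by linarith [fixPt_re hc hd])
  have h4 : ∀ᶠ w in 𝓝 (fixPt c d), 0 < (w ^ 2 + d).re :=
    Tendsto.eventually_const_lt (f := fun w : ℂ => (w ^ 2 + d).re)
      (by linarith [fixPt_sq_add_re hc hd])
      (Continuous.continuousAt (by fun_prop : Continuous fun w : ℂ => (w ^ 2 + d).re))
  filter_upwards [h1, h2, h3, h4] with w a1 a2 a3 a4
  exact ⟨a1, a2, invBranch_rightInverse a3 a4⟩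

theorem differentiableOn_koenigsLim (hc : c ∈ nearHat) (hd : d ∈ nearHat) :
    DifferentiableOn ℂ (koenigsLim c d) halfPlane := fun _ hw =>
  (differentiableAt_koenigsLim_right hc hd hw).differentiableWithinAt

theorem isKoenigs_normKoenigs (hc : c ∈ nearHat) (h0 : koenigsLim c (conj c) 0 ≠ 0) :
    IsKoenigs c halfPlane (normKoenigs c (conj c)) where
  isOpen := isOpen_halfPlane
  convex := convex_halfPlane
  beta_mem := by rw [betaPt_eq hc]; exact fixPt_mem hc (conj_mem_nearHat hc)
  zero_mem := zero_mem_halfPlane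
  differentiableOn := (differentiableOn_koenigsLim hc (conj_mem_nearHat hc)).div_const _
  map_eq := by
    rw [betaPt_eq hc, mult_eq hc]
    filter_upwards [eventually_quartic_mem hc (conj_mem_nearHat hc)] with w ⟨_, h2, h3⟩
    rw [antiQuad_iterate_two, normKoenigs, normKoenigs,
      ← fixMult_mul_koenigsLim_invBranch hc (conj_mem_nearHat hc) h2, h3, mul_div_assoc]
  map_beta := by
    rw [betaPt_eq hc, normKoenigs, koenigsLim_fixPt hc (conj_mem_nearHat hc), zero_div]
  map_zero := div_self h0

/-- A function with the functional equation of the linearizing coordinate is a multiple of it. -/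
theorem eventually_eq_deriv_mul_koenigsLim (hc : c ∈ nearHat) (hd : d ∈ nearHat) {K : ℂ → ℂ}
    (hK : DifferentiableAt ℂ K (fixPt c d)) (hK0 : K (fixPt c d) = 0)
    (hmap : ∀ᶠ w in 𝓝 (fixPt c d), K ((w ^ 2 + d) ^ 2 + c) = fixMult c d * K w) :
    ∀ᶠ w in 𝓝 (fixPt c d), K w = deriv K (fixPt c d) * koenigsLim c d w := by
  set b := fixPt c d with hb
  have hU : ∀ᶠ w in 𝓝 b, w ∈ halfPlane := isOpen_halfPlane.mem_nhds (fixPt_mem hc hd)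
  obtain ⟨r, hr, hball⟩ := Metric.eventually_nhds_iff_ball.1 (hmap.and hU)
  filter_upwards [ball_mem_nhds b hr] with w hw
  have hwU : w ∈ halfPlane := (hball w hw).2
  have hmem : ∀ k, (invBranch c d)^[k] w ∈ ball b r := fun k => by
    rw [mem_ball, dist_eq_norm] at hw ⊢
    refine (invBranch_iterate_sub_fixPt hc hd hwU k).trans_lt (lt_of_le_of_lt ?_ hw)
    exact mul_le_of_le_one_left (norm_nonneg _) (pow_le_one₀ (by norm_num) (by norm_num))
  have hit : ∀ k, K w = fixMult c d ^ k * K ((invBranch c d)^[k] w) := fun k => by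
    induction k with
    | zero => simp
    | succ k ih =>
      have h1 := (hball _ (hmem (k + 1))).1
      rw [Function.iterate_succ_apply', invBranch_leftInverse] at h1
      rw [ih, h1, Function.iterate_succ_apply', pow_succ, mul_assoc]
  set m := deriv K b with hm
  have hlo := hasDerivAt_iff_isLittleO.1 hK.hasDerivAt
  have htend := tendsto_invBranch_iterate hc hd hwU
  have hlo2 := hlo.comp_tendsto htend
  have hΦ := tendsto_koenigsLim hc hd hwU
  -- In `K w = λᵏ K(Gᵏ w)` the Taylor remainder of `K` contributes `λᵏ o(Gᵏ w - β) = o(1)`, because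
  -- `λᵏ (Gᵏ w - β)` converges.
  have hlo3 := (Asymptotics.isBigO_refl (fun k : ℕ => fixMult c d ^ k) atTop).mul_isLittleO hlo2
  have hO : (fun k : ℕ => fixMult c d ^ k * ((fun x' => x' - b) ∘
      fun k => (invBranch c d)^[k] w) k) =O[atTop] (fun _ => (1 : ℝ)) := hΦ.isBigO_one ℝ
  have hzero := (Asymptotics.isLittleO_one_iff ℝ).1 (hlo3.trans_isBigO hO)
  have hsum := hzero.add (hΦ.const_mul m)
  rw [zero_add] at hsum
  refine tendsto_nhds_unique (tendsto_const_nhds.congr fun k => ?_) hsum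
  simp only [Function.comp_apply, hK0, sub_zero, koenigsApprox, smul_eq_mul, ← hb, ← hm]
  rw [hit k]
  ring

/-- Near `β` any such `K` is a multiple of `koenigsLim`; the intersection of the two convex domains
is connected, so the identity theorem carries this to `0`. There `K 0 = 1` both determines the
multiple and shows that `koenigsLim` is nonzero. -/
theorem IsKoenigs.eqOn (hc : c ∈ nearHat) {U : Set ℂ} {K : ℂ → ℂ} (hK : IsKoenigs c U K) :
    Set.EqOn K (normKoenigs c (conj c)) (U ∩ halfPlane) := by
  have hd := conj_mem_nearHat hc
  have hbU : fixPt c (conj c) ∈ U := by rw [← betaPt_eq hc]; exact hK.beta_mem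
  have hmap := hK.map_eq
  have h0 := hK.map_beta
  rw [betaPt_eq hc] at h0
  rw [betaPt_eq hc, mult_eq hc] at hmap
  simp only [antiQuad_iterate_two] at hmap
  have hev := eventually_eq_deriv_mul_koenigsLim hc hd
    (hK.differentiableOn.differentiableAt (hK.isOpen.mem_nhds hbU)) h0 hmap
  set m := deriv K (fixPt c (conj c))
  have hopen : IsOpen (U ∩ halfPlane) := hK.isOpen.inter isOpen_halfPlane
  have hA : AnalyticOnNhd ℂ K (U ∩ halfPlane) :=
    (hK.differentiableOn.mono Set.inter_subset_left).analyticOnNhd hopen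
  have hB : AnalyticOnNhd ℂ (fun w => m * koenigsLim c (conj c) w) (U ∩ halfPlane) :=
    (((differentiableOn_koenigsLim hc hd).mono Set.inter_subset_right).const_mul m).analyticOnNhd
      hopen
  have heq := hA.eqOn_of_preconnected_of_eventuallyEq hB
    (hK.convex.inter convex_halfPlane).isPreconnected ⟨hbU, fixPt_mem hc hd⟩ hev
  have h1 := heq ⟨hK.zero_mem, zero_mem_halfPlane⟩
  simp only [hK.map_zero] at h1
  have hne : koenigsLim c (conj c) 0 ≠ 0 := fun h => by rw [h, mul_zero] at h1; norm_num at h1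
  intro w hw
  rw [heq hw, normKoenigs, eq_div_iff hne]
  linear_combination (-koenigsLim c (conj c) w) * h1

theorem koenigs_eq (hc : c ∈ nearHat) (h0 : koenigsLim c (conj c) 0 ≠ 0) (hw : w ∈ halfPlane) :
    koenigs c w = normKoenigs c (conj c) w := by
  have hex : ∃ v, ∃ (U : Set ℂ) (K : ℂ → ℂ), IsKoenigs c U K ∧ w ∈ U ∧ K w = v :=
    ⟨_, halfPlane, _, isKoenigs_normKoenigs hc h0, hw, rfl⟩
  obtain ⟨U, K, hK, hwU, hKw⟩ := Classical.epsilon_spec hex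
  rw [koenigs, ← hKw]
  exact hK.eqOn hc ⟨hwU, hw⟩

theorem isKoenigs_koenigs (hc : c ∈ nearHat) (h0 : koenigsLim c (conj c) 0 ≠ 0) :
    IsKoenigs c halfPlane (koenigs c) := by
  have h := isKoenigs_normKoenigs hc h0
  refine ⟨h.isOpen, h.convex, h.beta_mem, h.zero_mem,
    h.differentiableOn.congr fun w hw => koenigs_eq hc h0 hw, ?_, ?_, ?_⟩
  · have hq := eventually_quartic_mem hc (conj_mem_nearHat hc)
    rw [← betaPt_eq hc] at hq
    filter_upwards [h.map_eq, hq] with w h1 ⟨h2, h3, _⟩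
    rw [antiQuad_iterate_two] at h1 ⊢
    rw [koenigs_eq hc h0 h3, koenigs_eq hc h0 h2, h1]
  · rw [koenigs_eq hc h0 h.beta_mem, h.map_beta]
  · rw [koenigs_eq hc h0 h.zero_mem, h.map_zero]

theorem continuous_diag (w : ℂ) : Continuous fun c : ℂ => (c, conj c, w) := by fun_prop

theorem conj_neg_two : conj (-2 : ℂ) = -2 := by simp [Complex.conj_ofNat]

theorem mem_paramDomain_neg_two (hw : w ∈ halfPlane) : (-2, -2, w) ∈ paramDomain :=
  ⟨neg_two_mem_nearHat, neg_two_mem_nearHat, hw⟩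

/-- The parameters near `-2` for which the Koenigs coordinate can be normalized. -/
def regularParam : Set ℂ := {c | c ∈ nearHat ∧ koenigsLim c (conj c) 0 ≠ 0}

theorem regularParam_mem_nhds : regularParam ∈ 𝓝 (-2 : ℂ) := by
  have hp : ((-2 : ℂ), conj (-2 : ℂ), (0 : ℂ)) ∈ paramDomain := by
    rw [conj_neg_two]; exact mem_paramDomain_neg_two zero_mem_halfPlane
  have h := (differentiableAt_koenigsLim hp).continuousAt
  have hd : ContinuousAt (fun c : ℂ => (c, conj c, (0 : ℂ))) (-2) :=
    (continuous_diag 0).continuousAt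
  have h2 := ContinuousAt.comp' (x := (-2 : ℂ)) h hd
  have h3 := h2.eventually_ne (by
    simp only [conj_neg_two]; exact koenigsLim_neg_two_zero_ne)
  filter_upwards [h3, nearHat_mem_nhds] with c h1 h2 using ⟨h2, h1⟩

theorem antiQuad_iterate_three (c z : ℂ) :
    (antiQuad c)^[3] z = ((conj z ^ 2 + c) ^ 2 + conj c) ^ 2 + c := by
  simp [antiQuad]

theorem eventually_iterate_three_mem : ∀ᶠ c in 𝓝 (-2 : ℂ), (antiQuad c)^[3] 0 ∈ halfPlane := by
  have h : ContinuousAt (fun c : ℂ => (antiQuad c)^[3] 0) (-2) := by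
    simp only [antiQuad_iterate_three]
    fun_prop
  refine h.eventually_mem (isOpen_halfPlane.mem_nhds ?_)
  rw [antiQuad_iterate_three, map_zero, conj_neg_two]
  norm_num [halfPlane]

end Koenigs

/-! ### The coefficients `a`, `A_2`, `b₀`, `b₀*` as partial derivatives -/

section Coefficients

/-- The normalized linearizing coordinate as a function of the parameters and the point. -/
noncomputable def jointKoenigs (p : ℂ × ℂ × ℂ) : ℂ := normKoenigs p.1 p.2.1 p.2.2

/-- The Koenigs coordinate of the third iterate as a function of the parameters and of `u = z̄²`. -/
noncomputable def jointThird (p : ℂ × ℂ × ℂ) : ℂ :=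
  normKoenigs p.1 p.2.1 (((p.2.2 + p.1) ^ 2 + p.2.1) ^ 2 + p.1)

/-- The base point `(ĉ, conj ĉ, 0)`. -/
def basePt : ℂ × ℂ × ℂ := (-2, -2, 0)

theorem eventually_differentiableAt_jointKoenigs {w : ℂ} (hw : w ∈ halfPlane) :
    ∀ᶠ p in 𝓝 ((-2, -2, w) : ℂ × ℂ × ℂ), DifferentiableAt ℂ jointKoenigs p := by
  have hmem : ∀ p ∈ paramDomain, (p.1, p.2.1, (0 : ℂ)) ∈ paramDomain :=
    fun p hp => ⟨hp.1, hp.2.1, zero_mem_halfPlane⟩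
  have hden : ∀ p ∈ paramDomain,
      DifferentiableAt ℂ (fun p : ℂ × ℂ × ℂ => koenigsLim p.1 p.2.1 0) p := fun p hp => by
    have h2 : DifferentiableAt ℂ (fun p : ℂ × ℂ × ℂ => (p.1, p.2.1, (0 : ℂ))) p := by fun_prop
    have h3 := DifferentiableAt.fun_comp' p (differentiableAt_koenigsLim (hmem p hp)) h2
    exact h3
  have hw' := mem_paramDomain_neg_two hw
  have hne := (hden _ hw').continuousAt.eventually_ne koenigsLim_neg_two_zero_ne
  filter_upwards [isOpen_paramDomain.mem_nhds hw', hne] with p hp hp0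
  unfold jointKoenigs normKoenigs
  simp only [div_eq_mul_inv]
  exact (differentiableAt_koenigsLim hp).fun_mul ((hden p hp).fun_inv hp0)

theorem eventually_differentiableAt_jointThird :
    ∀ᶠ p in 𝓝 basePt, DifferentiableAt ℂ jointThird p := by
  set q : ℂ × ℂ × ℂ → ℂ × ℂ × ℂ :=
    fun p => (p.1, p.2.1, ((p.2.2 + p.1) ^ 2 + p.2.1) ^ 2 + p.1) with hq
  have hqd : Differentiable ℂ q := by simp only [hq]; fun_prop
  have hq0 : q basePt = (-2, -2, 2) := by simp only [hq, basePt]; norm_num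
  have h := eventually_differentiableAt_jointKoenigs two_mem_halfPlane
  rw [← hq0] at h
  filter_upwards [hqd.continuous.continuousAt.eventually h] with p hp
  exact DifferentiableAt.comp (g := jointKoenigs) p hp (hqd p)

theorem hasDerivAt_jointKoenigs :
    HasDerivAt (fun w => jointKoenigs (-2, -2, w)) (fderiv ℂ jointKoenigs basePt (0, 0, 1)) 0 := by
  have h : HasFDerivAt jointKoenigs (fderiv ℂ jointKoenigs basePt) (-2, -2, 0) :=
    (eventually_differentiableAt_jointKoenigs zero_mem_halfPlane).self_of_nhds.hasFDerivAt
  have h2 : HasDerivAt (fun w : ℂ => ((-2, -2, w) : ℂ × ℂ × ℂ)) (0, 0, 1) 0 :=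
    (hasDerivAt_const _ _).prodMk ((hasDerivAt_const _ _).prodMk (hasDerivAt_id (0 : ℂ)))
  exact h.comp_hasDerivAt (0 : ℂ) h2

theorem hasDerivAt_jointThird :
    HasDerivAt (fun u => jointThird (-2, -2, u)) (fderiv ℂ jointThird basePt (0, 0, 1)) 0 := by
  have h : HasFDerivAt jointThird (fderiv ℂ jointThird basePt) (-2, -2, 0) :=
    eventually_differentiableAt_jointThird.self_of_nhds.hasFDerivAt
  have h2 : HasDerivAt (fun w : ℂ => ((-2, -2, w) : ℂ × ℂ × ℂ)) (0, 0, 1) 0 :=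
    (hasDerivAt_const _ _).prodMk ((hasDerivAt_const _ _).prodMk (hasDerivAt_id (0 : ℂ)))
  exact h.comp_hasDerivAt (0 : ℂ) h2

theorem neg_two_mem_regularParam : (-2 : ℂ) ∈ regularParam := mem_of_mem_nhds regularParam_mem_nhds

theorem koenigs_eq_jointKoenigs {c w : ℂ} (hc : c ∈ regularParam) (hw : w ∈ halfPlane) :
    koenigs c w = jointKoenigs (c, conj c, w) := koenigs_eq hc.1 hc.2 hw

theorem koenigs_iterate_three {c z : ℂ} (hc : c ∈ regularParam)
    (hz : (antiQuad c)^[3] z ∈ halfPlane) :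
    koenigs c ((antiQuad c)^[3] z) = jointThird (c, conj c, conj z ^ 2) := by
  rw [koenigs_eq_jointKoenigs hc hz, antiQuad_iterate_three]
  rfl

theorem aCoeff_cHat : aCoeff cHat = fderiv ℂ jointKoenigs basePt (0, 0, 1) := by
  rw [aCoeff, cHat, ← hasDerivAt_jointKoenigs.deriv]
  refine EventuallyEq.deriv_eq ?_
  filter_upwards [isOpen_halfPlane.mem_nhds zero_mem_halfPlane] with w hw
  rw [koenigs_eq_jointKoenigs neg_two_mem_regularParam hw, conj_neg_two]

theorem aCoeff_cHat_ne_zero : aCoeff cHat ≠ 0 := by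
  have h : HasDerivAt (fun w => jointKoenigs (-2, -2, w))
      (deriv (koenigsLim (-2) (-2)) 0 / koenigsLim (-2) (-2) 0) 0 :=
    (differentiableAt_koenigsLim_right neg_two_mem_nearHat neg_two_mem_nearHat
      zero_mem_halfPlane).hasDerivAt.div_const (koenigsLim (-2) (-2) 0)
  rw [aCoeff_cHat, hasDerivAt_jointKoenigs.unique h]
  exact div_ne_zero deriv_koenigsLim_neg_two_zero_ne koenigsLim_neg_two_zero_ne

/-- The second Taylor coefficient at `0` of `w ↦ H (w²)`. -/
theorem iteratedDeriv_two_comp_sq {H : ℂ → ℂ} (hH : AnalyticAt ℂ H 0) :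
    iteratedDeriv 2 (fun w => H (w ^ 2)) 0 = 2 * deriv H 0 := by
  have hsq : Tendsto (fun w : ℂ => w ^ 2) (𝓝 0) (𝓝 0) := by
    have : Continuous fun w : ℂ => w ^ 2 := by fun_prop
    simpa using this.tendsto 0
  have h1 : deriv (fun w => H (w ^ 2)) =ᶠ[𝓝 0] fun w => deriv H (w ^ 2) * (2 * w) := by
    have hd := hH.eventually_analyticAt.mono fun w hw => hw.differentiableAt
    filter_upwards [hsq.eventually hd] with w hw
    have h2 : HasDerivAt (fun w : ℂ => w ^ 2) (2 * w) w := by simpa using hasDerivAt_pow 2 w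
    exact (hw.hasDerivAt.comp w h2).deriv
  rw [iteratedDeriv_succ, iteratedDeriv_one, h1.deriv_eq]
  have h3 : DifferentiableAt ℂ (fun w : ℂ => deriv H (w ^ 2)) 0 := by
    have := hH.deriv.differentiableAt
    refine DifferentiableAt.fun_comp' (0 : ℂ) (g := deriv H) ?_ (by fun_prop)
    simpa using this
  have h4 : HasDerivAt (fun w : ℂ => 2 * w) 2 0 := by
    simpa using (hasDerivAt_id (0 : ℂ)).const_mul 2
  rw [(h3.hasDerivAt.fun_mul h4).deriv]
  simp [mul_comm]

theorem analyticAt_jointThird : AnalyticAt ℂ (fun u => jointThird (-2, -2, u)) 0 := by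
  rw [Complex.analyticAt_iff_eventually_differentiableAt]
  have hq : Continuous fun u : ℂ => ((-2, -2, u) : ℂ × ℂ × ℂ) := by fun_prop
  filter_upwards [(hq.tendsto 0).eventually eventually_differentiableAt_jointThird] with u hu
  have h2 : DifferentiableAt ℂ (fun u : ℂ => ((-2, -2, u) : ℂ × ℂ × ℂ)) u := by fun_prop
  exact DifferentiableAt.comp (g := jointThird) u hu h2

theorem ACoeff_two_cHat : ACoeff 2 cHat = fderiv ℂ jointThird basePt (0, 0, 1) := by
  have h : (fun w => koenigs (-2) ((antiQuad (-2))^[3] (conj w))) =ᶠ[𝓝 0]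
      fun w => jointThird (-2, -2, w ^ 2) := by
    have hc : ContinuousAt (fun w : ℂ => (antiQuad (-2))^[3] (conj w)) 0 := by
      simp only [antiQuad_iterate_three]
      fun_prop
    have h2 := hc.eventually_mem (isOpen_halfPlane.mem_nhds (by
      rw [map_zero]; exact eventually_iterate_three_mem.self_of_nhds))
    filter_upwards [h2] with w hw
    rw [koenigs_iterate_three neg_two_mem_regularParam hw, conj_neg_two, Complex.conj_conj]
  rw [ACoeff, cHat, h.iteratedDeriv_eq,
    iteratedDeriv_two_comp_sq (H := fun u => jointThird (-2, -2, u)) analyticAt_jointThird,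
    hasDerivAt_jointThird.deriv]
  simp

/-- As a function of `u = z̄²`, the third iterate at `ĉ` has value `2` and derivative `-16` at `u =
0`, and the linearizer is not critical at `2`. -/
theorem ACoeff_two_cHat_ne_zero : ACoeff 2 cHat ≠ 0 := by
  have hX : HasDerivAt (fun u : ℂ => ((u + -2) ^ 2 + -2) ^ 2 + -2) (-16) 0 := by
    have h1 : HasDerivAt (fun u : ℂ => (u + -2) ^ 2 + -2) (-4) 0 :=
      ((((hasDerivAt_id (0 : ℂ)).add_const (-2)).fun_pow 2).add_const (-2)).congr_deriv
        (by norm_num)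
    exact ((h1.fun_pow 2).add_const (-2)).congr_deriv (by norm_num)
  have hX0 : ((0 + -2) ^ 2 + -2 : ℂ) ^ 2 + -2 = 2 := by norm_num
  have hΦ : HasDerivAt (koenigsLim (-2) (-2)) (deriv (koenigsLim (-2) (-2)) 2)
      (((0 + -2) ^ 2 + -2) ^ 2 + -2) := by
    rw [hX0]
    exact (differentiableAt_koenigsLim_right neg_two_mem_nearHat neg_two_mem_nearHat
      two_mem_halfPlane).hasDerivAt
  have h : HasDerivAt (fun u => jointThird (-2, -2, u))
      (deriv (koenigsLim (-2) (-2)) 2 * -16 / koenigsLim (-2) (-2) 0) 0 :=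
    (HasDerivAt.comp (0 : ℂ) hΦ hX).div_const (koenigsLim (-2) (-2) 0)
  rw [ACoeff_two_cHat, hasDerivAt_jointThird.unique h]
  exact div_ne_zero (mul_ne_zero deriv_koenigsLim_neg_two_two_ne (by norm_num))
    koenigsLim_neg_two_zero_ne

theorem eventually_ACoeff_zero : ∀ᶠ c in 𝓝 cHat, ACoeff 0 c = jointThird (c, conj c, 0) := by
  rw [cHat]
  filter_upwards [regularParam_mem_nhds, eventually_iterate_three_mem] with c hc hm
  have := koenigs_iterate_three hc hm
  simp only [map_zero, ne_eq, OfNat.ofNat_ne_zero, not_false_eq_true, zero_pow] at this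
  simp only [ACoeff, iteratedDeriv_zero, map_zero, Nat.factorial_zero, Nat.cast_one, div_one, this]

theorem hasFDerivAt_ACoeff_zero : HasFDerivAt (ACoeff 0)
    (((fderiv ℂ jointThird basePt).restrictScalars ℝ).comp
      ((ContinuousLinearMap.id ℝ ℂ).prod
        ((Complex.conjCLE : ℂ →L[ℝ] ℂ).prod (0 : ℂ →L[ℝ] ℂ)))) cHat := by
  refine HasFDerivAt.congr_of_eventuallyEq ?_ eventually_ACoeff_zero
  have h : HasFDerivAt jointThird ((fderiv ℂ jointThird basePt).restrictScalars ℝ)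
      (cHat, conj cHat, 0) := by
    rw [cHat, conj_neg_two]
    exact eventually_differentiableAt_jointThird.self_of_nhds.hasFDerivAt.restrictScalars ℝ
  exact h.comp cHat ((hasFDerivAt_id cHat).prodMk
    ((Complex.conjCLE : ℂ →L[ℝ] ℂ).hasFDerivAt.prodMk (hasFDerivAt_const (0 : ℂ) cHat)))

theorem differentiableAt_ACoeff_zero : DifferentiableAt ℝ (ACoeff 0) cHat :=
  hasFDerivAt_ACoeff_zero.differentiableAt

/-- On the slice `d = conj c` the partial derivatives in `c` and `d` of a holomorphic function
become the Wirtinger derivatives, so `b₀`, `b₀*` and `A_2` are the three partials at the base point.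
-/
theorem fderiv_jointThird_apply (x y z : ℂ) :
    fderiv ℂ jointThird basePt (x, y, z) = b0 * x + b0Star * y + ACoeff 2 cHat * z := by
  set D := fderiv ℂ jointThird basePt with hD
  have hdec : ∀ x y z : ℂ, D (x, y, z) = x * D (1, 0, 0) + y * D (0, 1, 0) + z * D (0, 0, 1) := by
    intro x y z
    rw [← smul_eq_mul, ← smul_eq_mul, ← smul_eq_mul, ← map_smul, ← map_smul, ← map_smul,
      ← map_add, ← map_add]
    simp
  have h1 : fderiv ℝ (ACoeff 0) cHat 1 = D (1, 1, 0) := by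
    rw [hasFDerivAt_ACoeff_zero.fderiv]; simp [hD]
  have hI : fderiv ℝ (ACoeff 0) cHat Complex.I = D (Complex.I, -Complex.I, 0) := by
    rw [hasFDerivAt_ACoeff_zero.fderiv]; simp [hD]
  rw [b0, b0Star, ACoeff_two_cHat, h1, hI, ← hD, hdec x y z, hdec 1 1 0, hdec Complex.I]
  linear_combination (x * D (1, 0, 0) / 2 - x * D (0, 1, 0) / 2 - y * D (1, 0, 0) / 2
    + y * D (0, 1, 0) / 2) * Complex.I_sq

end Coefficients

/-! ### The real centres: existence, positivity of the orbit, first decay bound -/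

section Centers

/-- The critical orbit of a real parameter. -/
def realOrbit (c : ℝ) (j : ℕ) : ℝ := (fun x : ℝ => x ^ 2 + c)^[j] 0

theorem realOrbit_zero (c : ℝ) : realOrbit c 0 = 0 := rfl

theorem realOrbit_succ (c : ℝ) (j : ℕ) : realOrbit c (j + 1) = realOrbit c j ^ 2 + c := by
  rw [realOrbit, Function.iterate_succ_apply']; rfl

theorem continuous_realOrbit (j : ℕ) : Continuous fun c => realOrbit c j := by
  induction j with
  | zero => exact continuous_const
  | succ j ih => simp only [realOrbit_succ]; fun_prop

theorem quad_iterate_ofReal (c : ℝ) (j : ℕ) : (quad (c : ℂ))^[j] 0 = (realOrbit c j : ℂ) := by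
  induction j with
  | zero => simp [realOrbit_zero]
  | succ j ih => rw [Function.iterate_succ_apply', ih, realOrbit_succ, quad]; push_cast; rfl

theorem mem_centerSet {n : ℕ} {c : ℝ} : c ∈ centerSet n ↔ realOrbit c (2 * n + 3) = 0 := by
  rw [centerSet, Set.mem_ofPred_eq, quad_iterate_ofReal, Complex.ofReal_eq_zero]

theorem le_abs_realOrbit {c : ℝ} (hc : c < -2) (j : ℕ) : -c ≤ |realOrbit c (j + 1)| := by
  induction j with
  | zero => rw [realOrbit_succ, realOrbit_zero]; simpa using neg_le_abs c
  | succ j ih =>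
    rw [realOrbit_succ]
    refine le_trans ?_ (le_abs_self _)
    have : (-c) ^ 2 ≤ realOrbit c (j + 1) ^ 2 := by
      rw [← sq_abs (realOrbit c (j + 1))]
      exact pow_le_pow_left₀ (by linarith) ih 2
    nlinarith

theorem realOrbit_neg_two (j : ℕ) : realOrbit (-2) (j + 2) = 2 := by
  induction j with
  | zero => norm_num [realOrbit_succ, realOrbit_zero]
  | succ j ih => rw [realOrbit_succ, ih]; norm_num

theorem realOrbit_neg_one (k : ℕ) : realOrbit (-1) (2 * k + 1) = -1 := by
  induction k with
  | zero => norm_num [realOrbit_succ, realOrbit_zero]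
  | succ k ih =>
    rw [show 2 * (k + 1) + 1 = 2 * k + 1 + 1 + 1 by ring, realOrbit_succ, realOrbit_succ, ih]
    norm_num

theorem bddBelow_centerSet (n : ℕ) : -2 ∈ lowerBounds (centerSet n) := by
  intro c hc
  by_contra! h
  have h1 := le_abs_realOrbit h (2 * n + 2)
  rw [mem_centerSet.1 hc, abs_zero] at h1
  linarith

theorem exists_zero_of_nonpos {c : ℝ} (hc : -2 ≤ c) {j : ℕ} (h : realOrbit c (j + 2) ≤ 0) :
    ∃ c' ∈ Set.Icc (-2) c, realOrbit c' (j + 2) = 0 := by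
  have := intermediate_value_Icc' hc (continuous_realOrbit (j + 2)).continuousOn
  obtain ⟨c', hc', h'⟩ := this ⟨h, by rw [realOrbit_neg_two]; norm_num⟩
  exact ⟨c', hc', h'⟩

/-- The set is closed and bounded below by `-2`. It is nonempty by the intermediate value theorem:
the iterate is `2` at `c = -2` and, its index being odd, `-1` at `c = -1`. -/
theorem isLeast_center (n : ℕ) : IsLeast (centerSet n) (center n) := by
  have hbdd : BddBelow (centerSet n) := ⟨-2, bddBelow_centerSet n⟩
  have hclosed : IsClosed (centerSet n) := by
    have : centerSet n = (fun c => realOrbit c (2 * n + 3)) ⁻¹' {0} := by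
      ext c; rw [mem_centerSet]; rfl
    rw [this]
    exact isClosed_singleton.preimage (continuous_realOrbit _)
  obtain ⟨c, -, hc⟩ := exists_zero_of_nonpos (c := -1) (by norm_num) (j := 2 * n + 1) (by
    rw [show 2 * n + 1 + 2 = 2 * (n + 1) + 1 by ring, realOrbit_neg_one]; norm_num)
  exact ⟨hclosed.csInf_mem ⟨c, mem_centerSet.2 hc⟩ hbdd, fun x hx => csInf_le hbdd hx⟩

theorem realOrbit_center (n : ℕ) : realOrbit (center n) (2 * n + 3) = 0 :=
  mem_centerSet.1 (isLeast_center n).1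

theorem center_mem_Icc (n : ℕ) : center n ∈ Set.Icc (-2) (-1) := by
  refine ⟨bddBelow_centerSet n (isLeast_center n).1, ?_⟩
  obtain ⟨c, hc, hc0⟩ := exists_zero_of_nonpos (c := -1) (by norm_num) (j := 2 * n + 1) (by
    rw [show 2 * n + 1 + 2 = 2 * (n + 1) + 1 by ring, realOrbit_neg_one]; norm_num)
  exact ((isLeast_center n).2 (mem_centerSet.2 hc0)).trans hc.2

/-- A parameter with a nonpositive point in its critical orbit has smaller parameters with zeros at
all later times. -/
theorem exists_later_zero {c : ℝ} (hc : -2 ≤ c) (hc' : c ≤ -1) {j : ℕ}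
    (h : realOrbit c (j + 2) ≤ 0) (m : ℕ) :
    ∃ c' ∈ Set.Ico (-2) c, realOrbit c' (j + m + 3) = 0 := by
  induction m generalizing c j with
  | zero =>
    obtain ⟨c₁, ⟨h1, h2⟩, h0⟩ := exists_zero_of_nonpos hc h
    -- After a zero the next orbit point is `c₁ < 0`, so the sign change against the value `2` at
    -- `-2` recurs one step later, at a strictly smaller parameter.
    have hneg : realOrbit c₁ (j + 1 + 2) < 0 := by
      rw [show j + 1 + 2 = j + 2 + 1 by ring, realOrbit_succ, h0]; linarith
    obtain ⟨c₂, ⟨h3, h4⟩, h5⟩ := exists_zero_of_nonpos h1 hneg.le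
    refine ⟨c₂, ⟨h3, lt_of_lt_of_le (lt_of_le_of_ne h4 fun e => ?_) h2⟩, h5⟩
    rw [← e, h5] at hneg
    exact lt_irrefl _ hneg
  | succ m ih =>
    obtain ⟨c₁, ⟨h1, h2⟩, h0⟩ := exists_zero_of_nonpos hc h
    have hneg : realOrbit c₁ (j + 1 + 2) ≤ 0 := by
      rw [show j + 1 + 2 = j + 2 + 1 by ring, realOrbit_succ, h0]; linarith
    obtain ⟨c', hc1, hc2⟩ := ih h1 (h2.trans hc') hneg
    exact ⟨c', ⟨hc1.1, hc1.2.trans_le h2⟩, by rw [← hc2]; congr 1; ring⟩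

/-- An earlier nonpositive orbit point would produce a smaller parameter with a zero at time `2n +
3`, against minimality. -/
theorem realOrbit_center_pos {n j : ℕ} (hj : 2 ≤ j) (hj' : j < 2 * n + 3) :
    0 < realOrbit (center n) j := by
  by_contra! h
  obtain ⟨i, rfl⟩ := Nat.exists_eq_add_of_le' hj
  obtain ⟨c', hc1, hc2⟩ := exists_later_zero (center_mem_Icc n).1 (center_mem_Icc n).2 h
    (2 * n - i)
  rw [show i + (2 * n - i) + 3 = 2 * n + 3 by omega] at hc2
  exact absurd ((isLeast_center n).2 (mem_centerSet.2 hc2)) (not_le.2 hc1.2)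

/-- The positive fixed point of `x ↦ x² + c`. -/
noncomputable def realBeta (c : ℝ) : ℝ := (1 + √(1 - 4 * c)) / 2

theorem realBeta_eq {c : ℝ} (hc : c ≤ -1) : realBeta c ^ 2 + c = realBeta c := by
  have h := Real.sq_sqrt (by linarith : 0 ≤ 1 - 4 * c)
  rw [realBeta]
  linear_combination h / 4

theorem le_realBeta {c : ℝ} (hc : c ∈ Set.Icc (-2 : ℝ) (-1)) : 2 - (c + 2) / 2 ≤ realBeta c := by
  have h : 3 - (c + 2) ≤ √(1 - 4 * c) := Real.le_sqrt_of_sq_le (by nlinarith [hc.1, hc.2])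
  rw [realBeta]
  linarith

theorem le_realBeta' {c : ℝ} (hc : c ∈ Set.Icc (-2 : ℝ) (-1)) : 8 / 5 ≤ realBeta c := by
  have h : 11 / 5 ≤ √(1 - 4 * c) := Real.le_sqrt_of_sq_le (by nlinarith [hc.1, hc.2])
  rw [realBeta]
  linarith

theorem realBeta_le {c : ℝ} (hc : -2 ≤ c) : realBeta c ≤ 2 := by
  have h : √(1 - 4 * c) ≤ 3 := Real.sqrt_le_iff.2 ⟨by norm_num, by linarith⟩
  rw [realBeta]
  linarith

/-- The gap to the fixed point expands: `β - x_{j+1} = (β + x_j)(β - x_j)` with `x_j > 0` and `β ≥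
8/5`. -/
theorem add_two_mul_pow_le {n k : ℕ} (hk : k + 2 ≤ 2 * n + 3) :
    (center n + 2) * (8 / 5) ^ k ≤ realBeta (center n) - realOrbit (center n) (k + 2) := by
  have hc := center_mem_Icc n
  induction k with
  | zero =>
    have h := le_realBeta hc
    simp only [realOrbit_succ, realOrbit_zero, pow_zero, mul_one]
    nlinarith [hc.1, hc.2]
  | succ k ih =>
    have h1 := ih (by omega)
    have h2 := realOrbit_center_pos (n := n) (j := k + 2) (by omega) (by omega)
    have h3 := le_realBeta' hc
    have h4 : 0 ≤ (center n + 2) * (8 / 5 : ℝ) ^ k :=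
      mul_nonneg (by linarith [hc.1]) (by positivity)
    rw [show k + 1 + 2 = k + 2 + 1 by ring, realOrbit_succ, pow_succ]
    have h5 : realBeta (center n) - (realOrbit (center n) (k + 2) ^ 2 + center n) =
        (realBeta (center n) + realOrbit (center n) (k + 2)) *
          (realBeta (center n) - realOrbit (center n) (k + 2)) := by
      linear_combination -realBeta_eq hc.2
    rw [h5]
    nlinarith

/-- The final gap is `β ≤ 2`. This crude rate only serves to compare `λ_{c_n}ⁿ` with `16ⁿ`, from
which the true rate `16⁻ⁿ` follows. -/
theorem center_add_two_le (n : ℕ) : center n + 2 ≤ 2 * (5 / 8) ^ n := by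
  have hc := center_mem_Icc n
  have h := add_two_mul_pow_le (n := n) (k := 2 * n + 1) le_rfl
  rw [show 2 * n + 1 + 2 = 2 * n + 3 by ring, realOrbit_center, sub_zero] at h
  have h2 := h.trans (realBeta_le hc.1)
  have h3 : (8 / 5 : ℝ) ^ n ≤ (8 / 5) ^ (2 * n + 1) :=
    pow_le_pow_right₀ (by norm_num) (by omega)
  have h4 : (center n + 2) * (8 / 5 : ℝ) ^ n ≤ 2 :=
    (mul_le_mul_of_nonneg_left h3 (by linarith [hc.1])).trans h2
  have h5 : (5 / 8 : ℝ) ^ n * (8 / 5) ^ n = 1 := by rw [← mul_pow]; norm_num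
  have h6 : (0 : ℝ) < (5 / 8) ^ n := by positivity
  calc center n + 2 = (center n + 2) * (8 / 5) ^ n * (5 / 8) ^ n := by
        rw [mul_assoc, mul_comm ((8 / 5 : ℝ) ^ n), h5, mul_one]
    _ ≤ _ := by gcongr

theorem norm_center_add_two (n : ℕ) : ‖(center n : ℂ) + 2‖ = center n + 2 := by
  rw [show (center n : ℂ) + 2 = ((center n + 2 : ℝ) : ℂ) by push_cast; rfl, Complex.norm_real,
    Real.norm_eq_abs, abs_of_nonneg (by linarith [(center_mem_Icc n).1])]

theorem tendsto_center : Tendsto (fun n : ℕ => (center n : ℂ)) atTop (𝓝 cHat) := by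
  rw [tendsto_iff_norm_sub_tendsto_zero]
  have h : Tendsto (fun n : ℕ => 2 * (5 / 8 : ℝ) ^ n) atTop (𝓝 0) := by
    simpa using (tendsto_pow_atTop_nhds_zero_of_lt_one (r := (5 / 8 : ℝ)) (by norm_num)
      (by norm_num)).const_mul 2
  refine squeeze_zero (fun _ => norm_nonneg _) (fun n => ?_) h
  rw [cHat, sub_neg_eq_add, norm_center_add_two]
  exact center_add_two_le n

theorem fixPt_ofReal {c : ℝ} (hc : (c : ℂ) ∈ nearHat) (hc' : c ∈ Set.Icc (-2 : ℝ) (-1)) :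
    fixPt c c = realBeta c := by
  have h1 : ((realBeta c : ℝ) : ℂ) ^ 2 + c = realBeta c := by
    exact_mod_cast congrArg (Complex.ofReal) (realBeta_eq hc'.2)
  have hpos : 0 < ((realBeta c : ℝ) : ℂ).re := by
    rw [Complex.ofReal_re]; linarith [le_realBeta' hc']
  refine (eq_fixPt_of_fixed hc hc ?_ ?_).symm
  · change -1 < ((realBeta c : ℝ) : ℂ).re
    linarith
  · have := invBranch_rightInverse (c := (c : ℂ)) (d := (c : ℂ)) hpos (by rwa [h1])
    rwa [h1, h1] at this

/-- The backward orbit of `0` along the inverse branch is the critical orbit of the centre. -/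
theorem invBranch_iterate_realOrbit_center {n m k : ℕ} (hm : 2 ≤ m) (hk : m + 2 * k ≤ 2 * n + 3) :
    (invBranch (center n : ℂ) (center n : ℂ))^[k] (realOrbit (center n) (m + 2 * k) : ℂ) =
      (realOrbit (center n) m : ℂ) := by
  induction k with
  | zero => simp
  | succ k ih =>
    -- Positivity of the orbit is what makes both principal roots undo the forward steps.
    have h1 := realOrbit_center_pos (n := n) (j := m + 2 * k) (by omega) (by omega)
    have h2 := realOrbit_center_pos (n := n) (j := m + 2 * k + 1) (by omega) (by omega)
    have e1 : ((realOrbit (center n) (m + 2 * k) : ℝ) : ℂ) ^ 2 + center n =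
        (realOrbit (center n) (m + 2 * k + 1) : ℂ) := by
      rw [realOrbit_succ]; push_cast; rfl
    have e2 : ((realOrbit (center n) (m + 2 * k + 1) : ℝ) : ℂ) ^ 2 + center n =
        (realOrbit (center n) (m + 2 * k + 2) : ℂ) := by
      rw [realOrbit_succ _ (m + 2 * k + 1)]; push_cast; rfl
    rw [← ih (by omega), Function.iterate_succ_apply, show m + 2 * (k + 1) = m + 2 * k + 2 by ring,
      ← e2, ← e1, invBranch_rightInverse (by simpa using h1) (by rw [e1]; simpa using h2)]

end Centers

/-! ### Local inversion of the linearizer, the return map, sharp centre bounds -/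

section LocalDynamics

theorem norm_triple_le {x y z : ℂ} {r : ℝ} (hx : ‖x‖ ≤ r) (hy : ‖y‖ ≤ r) (hz : ‖z‖ ≤ r) :
    ‖((x, y, z) : ℂ × ℂ × ℂ)‖ ≤ r :=
  norm_prod_le_iff.2 ⟨hx, norm_prod_le_iff.2 ⟨hy, hz⟩⟩

theorem norm_conj_add_two (c : ℂ) : ‖conj c + 2‖ = ‖c + 2‖ := by
  rw [← RCLike.norm_conj (c + 2), map_add, Complex.conj_ofNat]

theorem norm_diag_sub_le {c w w₀ : ℂ} :
    ‖((c, conj c, w) : ℂ × ℂ × ℂ) - (-2, -2, w₀)‖ ≤ ‖c + 2‖ + ‖w - w₀‖ := by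
  have h1 := norm_nonneg (w - w₀)
  have h2 := norm_nonneg (c + 2)
  refine norm_triple_le ?_ ?_ ?_
  · rw [sub_neg_eq_add]; linarith
  · rw [sub_neg_eq_add, norm_conj_add_two]; linarith
  · linarith

/-- A holomorphic function with nonzero derivative in the last variable is uniformly expanding in
that variable. -/
theorem exists_lower_bound {f : ℂ × ℂ × ℂ → ℂ} {w₀ : ℂ}
    (hf : ∀ᶠ p in 𝓝 ((-2, -2, w₀) : ℂ × ℂ × ℂ), DifferentiableAt ℂ f p)
    (hne : fderiv ℂ f (-2, -2, w₀) (0, 0, 1) ≠ 0) :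
    ∃ r > 0, ∃ κ > 0, ∀ c w w' : ℂ, ‖c + 2‖ < r → ‖w - w₀‖ < r → ‖w' - w₀‖ < r →
      κ * ‖w - w'‖ ≤ ‖f (c, conj c, w) - f (c, conj c, w')‖ := by
  obtain ⟨r, hr, L, hL, -, -, hT⟩ := exists_taylor_bound hf
  set a := fderiv ℂ f (-2, -2, w₀) (0, 0, 1) with ha
  have ha0 : 0 < ‖a‖ := norm_pos_iff.2 hne
  -- With radius `‖a‖ / (8 L)` the Taylor error is at most half of the linear term.
  refine ⟨min (r / 2) (‖a‖ / (8 * L)), by positivity, ‖a‖ / 2, by positivity,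
    fun c w w' hc hw hw' => ?_⟩
  have m1 := min_le_left (r / 2) (‖a‖ / (8 * L))
  have m2 := min_le_right (r / 2) (‖a‖ / (8 * L))
  have hp := norm_diag_sub_le (c := c) (w := w) (w₀ := w₀)
  have hq := norm_diag_sub_le (c := c) (w := w') (w₀ := w₀)
  have h := hT (c, conj c, w) (by rw [mem_ball, dist_eq_norm]; linarith) (c, conj c, w')
    (by rw [mem_ball, dist_eq_norm]; linarith)
  have e1 : ((c, conj c, w) : ℂ × ℂ × ℂ) - (c, conj c, w') = (w - w') • (0, 0, 1) := by simp
  have e2 : ‖((c, conj c, w) : ℂ × ℂ × ℂ) - (c, conj c, w')‖ = ‖w - w'‖ := by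
    simp [Prod.norm_def]
  rw [e2, e1, map_smul, ← ha, smul_eq_mul] at h
  have hsmall : L * (‖((c, conj c, w) : ℂ × ℂ × ℂ) - (-2, -2, w₀)‖ +
      ‖((c, conj c, w') : ℂ × ℂ × ℂ) - (-2, -2, w₀)‖) ≤ ‖a‖ / 2 := by
    have : L * (4 * (‖a‖ / (8 * L))) = ‖a‖ / 2 := by field_simp; norm_num
    rw [← this]
    gcongr
    linarith
  have h2 : ‖(w - w') * a‖ ≤ ‖f (c, conj c, w) - f (c, conj c, w')‖ +
      ‖f (c, conj c, w) - f (c, conj c, w') - (w - w') * a‖ := by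
    have := norm_sub_le (f (c, conj c, w) - f (c, conj c, w'))
      (f (c, conj c, w) - f (c, conj c, w') - (w - w') * a)
    rwa [sub_sub_cancel] at this
  have h3 := mul_le_mul_of_nonneg_right hsmall (norm_nonneg (w - w'))
  rw [norm_mul] at h2
  linarith

theorem hasStrictFDerivAt_of_eventually {E F : Type*} [NormedAddCommGroup E] [NormedSpace ℂ E]
    [NormedAddCommGroup F] [NormedSpace ℂ F] {f : E → F} {x : E}
    (hf : ∀ᶠ y in 𝓝 x, DifferentiableAt ℂ f y) : HasStrictFDerivAt f (fderiv ℂ f x) x := by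
  obtain ⟨r, hr, L, hL, -, -, hT⟩ := exists_taylor_bound hf
  rw [hasStrictFDerivAt_iff_isLittleO]
  refine Asymptotics.IsLittleO.of_bound fun ε hε => ?_
  have hcont : ContinuousAt (fun p : E × E => L * (‖p.1 - x‖ + ‖p.2 - x‖)) (x, x) := by fun_prop
  have h1 : ∀ᶠ p : E × E in 𝓝 (x, x), L * (‖p.1 - x‖ + ‖p.2 - x‖) < ε :=
    hcont.eventually_lt_const (by simpa using hε)
  have h2 : ball x r ×ˢ ball x r ∈ 𝓝 (x, x) :=
    prod_mem_nhds (ball_mem_nhds _ hr) (ball_mem_nhds _ hr)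
  filter_upwards [h1, h2] with p hp hp'
  exact (hT p.1 hp'.1 p.2 hp'.2).trans (mul_le_mul_of_nonneg_right hp.le (norm_nonneg _))

theorem jointKoenigs_zero {c d : ℂ} (h : koenigsLim c d 0 ≠ 0) : jointKoenigs (c, d, 0) = 1 :=
  div_self h

/-- All values near `1` of the normalized Koenigs coordinate are attained near `0`. -/
theorem eventually_exists_jointKoenigs_eq {ε : ℝ} (hε : 0 < ε) :
    ∃ r > 0, ∀ c v : ℂ, ‖c + 2‖ < r → ‖v - 1‖ < r →
      ∃ w : ℂ, ‖w‖ < ε ∧ jointKoenigs (c, conj c, w) = v := by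
  -- Keeping the parameters as coordinates makes the derivative surjective as soon as `a ≠ 0`;
  -- openness at the base point then gives a radius uniform in `c`.
  set θ : ℂ × ℂ × ℂ → ℂ × ℂ × ℂ := fun p => (p.1, p.2.1, jointKoenigs p) with hθ
  set D := fderiv ℂ jointKoenigs basePt with hD
  have hs : HasStrictFDerivAt jointKoenigs D basePt :=
    hasStrictFDerivAt_of_eventually (eventually_differentiableAt_jointKoenigs zero_mem_halfPlane)
  have h1 : HasStrictFDerivAt θ ((ContinuousLinearMap.fst ℂ ℂ (ℂ × ℂ)).prod
      (((ContinuousLinearMap.fst ℂ ℂ ℂ).comp (ContinuousLinearMap.snd ℂ ℂ (ℂ × ℂ))).prod D))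
      basePt :=
    hasStrictFDerivAt_fst.prodMk ((hasStrictFDerivAt_fst.comp _ hasStrictFDerivAt_snd).prodMk hs)
  have hne : D (0, 0, 1) ≠ 0 := by rw [hD, ← aCoeff_cHat]; exact aCoeff_cHat_ne_zero
  have hsurj : Function.Surjective ((ContinuousLinearMap.fst ℂ ℂ (ℂ × ℂ)).prod
      (((ContinuousLinearMap.fst ℂ ℂ ℂ).comp (ContinuousLinearMap.snd ℂ ℂ (ℂ × ℂ))).prod D)) := by
    rintro ⟨x, y, z⟩
    refine ⟨(x, y, (z - D (x, y, 0)) / D (0, 0, 1)), ?_⟩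
    have : D (x, y, (z - D (x, y, 0)) / D (0, 0, 1)) = z := by
      have e : ((x, y, (z - D (x, y, 0)) / D (0, 0, 1)) : ℂ × ℂ × ℂ) =
          (x, y, 0) + ((z - D (x, y, 0)) / D (0, 0, 1)) • (0, 0, 1) := by simp
      rw [e, map_add, map_smul, smul_eq_mul, div_mul_cancel₀ _ hne]
      ring
    simp [this]
  have hmap := h1.map_nhds_eq_of_surj (LinearMap.range_eq_top.2 hsurj)
  have hb : θ basePt = (-2, -2, 1) := by
    simp only [hθ, basePt]
    rw [jointKoenigs_zero koenigsLim_neg_two_zero_ne]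
  have himg : θ '' ball basePt ε ∈ 𝓝 ((-2, -2, 1) : ℂ × ℂ × ℂ) := by
    rw [← hb, ← hmap]
    exact image_mem_map (ball_mem_nhds _ hε)
  obtain ⟨r, hr, hball⟩ := Metric.mem_nhds_iff.1 himg
  refine ⟨r / 2, half_pos hr, fun c v hc hv => ?_⟩
  obtain ⟨p, hp, hpe⟩ := hball (show (c, conj c, v) ∈ ball ((-2, -2, 1) : ℂ × ℂ × ℂ) r by
    rw [mem_ball, dist_eq_norm]
    have := norm_diag_sub_le (c := c) (w := v) (w₀ := 1)
    linarith)
  obtain ⟨p1, p2, p3⟩ := p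
  simp only [hθ, Prod.mk.injEq] at hpe
  obtain ⟨rfl, rfl, h3⟩ := hpe
  refine ⟨p3, ?_, h3⟩
  rw [mem_ball, dist_eq_norm] at hp
  refine lt_of_le_of_lt ?_ hp
  simp [basePt]

theorem fderiv_jointKoenigs_two_ne : fderiv ℂ jointKoenigs (-2, -2, 2) (0, 0, 1) ≠ 0 := by
  have h : HasFDerivAt jointKoenigs (fderiv ℂ jointKoenigs (-2, -2, 2)) (-2, -2, 2) :=
    (eventually_differentiableAt_jointKoenigs two_mem_halfPlane).self_of_nhds.hasFDerivAt
  have h2 : HasDerivAt (fun w : ℂ => ((-2, -2, w) : ℂ × ℂ × ℂ)) (0, 0, 1) 2 :=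
    (hasDerivAt_const _ _).prodMk ((hasDerivAt_const _ _).prodMk (hasDerivAt_id (2 : ℂ)))
  have h3 := h.comp_hasDerivAt (2 : ℂ) h2
  have h4 : HasDerivAt (fun w => jointKoenigs (-2, -2, w))
      (deriv (koenigsLim (-2) (-2)) 2 / koenigsLim (-2) (-2) 0) 2 :=
    (differentiableAt_koenigsLim_right neg_two_mem_nearHat neg_two_mem_nearHat
      two_mem_halfPlane).hasDerivAt.div_const (koenigsLim (-2) (-2) 0)
  rw [h3.unique h4]
  exact div_ne_zero deriv_koenigsLim_neg_two_two_ne koenigsLim_neg_two_zero_ne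

theorem antiQuad_iterate_invBranch (c w : ℂ) (n : ℕ) :
    ((antiQuad c)^[2])^[n] ((invBranch c (conj c))^[n] w) = w := by
  have h : Function.LeftInverse (antiQuad c)^[2] (invBranch c (conj c)) := fun w => by
    rw [antiQuad_iterate_two, invBranch_leftInverse]
  exact h.iterate n w

theorem tendsto_fixPt_diag : Tendsto (fun c : ℂ => fixPt c (conj c)) (𝓝 (-2)) (𝓝 2) := by
  have hp : ((-2 : ℂ), conj (-2 : ℂ), (0 : ℂ)) ∈ paramDomain := by
    rw [conj_neg_two]; exact mem_paramDomain_neg_two zero_mem_halfPlane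
  have h := (differentiableAt_fixPt hp).continuousAt
  have hd : ContinuousAt (fun c : ℂ => (c, conj c, (0 : ℂ))) (-2) :=
    (continuous_diag 0).continuousAt
  have h2 := ContinuousAt.comp' (x := (-2 : ℂ)) h hd
  have h3 := h2.tendsto
  simp only [conj_neg_two, fixPt_neg_two] at h3
  exact h3

theorem jointThird_eq_jointKoenigs (c d u : ℂ) :
    jointThird (c, d, u) = jointKoenigs (c, d, ((u + c) ^ 2 + d) ^ 2 + c) := rfl

theorem fixMult_pow_mul_jointKoenigs_iterate {c w : ℂ} (hc : c ∈ nearHat) (hw : w ∈ halfPlane)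
    (n : ℕ) : fixMult c (conj c) ^ n *
      jointKoenigs (c, conj c, (invBranch c (conj c))^[n] w) = jointKoenigs (c, conj c, w) := by
  have := fixMult_pow_mul_koenigsLim_iterate hc (conj_mem_nearHat hc) hw n
  simp only [jointKoenigs, normKoenigs]
  rw [← mul_div_assoc, this]

/-- The orbit of a point near `0` passes near the fixed point and returns near `0`, at the place
prescribed by the linearizing coordinate. -/
theorem exists_return :
    ∃ r > 0, ∃ κ > 0, ∃ n₁ : ℕ, ∀ ε > 0, ∃ r' > 0, ∀ c z : ℂ, ∀ n ≥ n₁,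
      ‖c + 2‖ < r → ‖c + 2‖ < r' → ‖conj z ^ 2‖ < r →
      ‖fixMult c (conj c) ^ n * jointThird (c, conj c, conj z ^ 2) - 1‖ < r' →
      jointKoenigs (c, conj c, (antiQuad c)^[2 * n + 3] z) =
          fixMult c (conj c) ^ n * jointThird (c, conj c, conj z ^ 2) ∧
        ‖(antiQuad c)^[2 * n + 3] z‖ < ε ∧
        κ * ‖(antiQuad c)^[2 * n + 3] z‖ ≤
          ‖fixMult c (conj c) ^ n * jointThird (c, conj c, conj z ^ 2) - 1‖ := by
  obtain ⟨r₀, hr₀, κ, hκ, hlow₀⟩ := exists_lower_bound (w₀ := 0)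
    (eventually_differentiableAt_jointKoenigs zero_mem_halfPlane)
    (by have := aCoeff_cHat_ne_zero; rwa [aCoeff_cHat] at this)
  obtain ⟨r₂, hr₂, κ₂, hκ₂, hlow₂⟩ := exists_lower_bound (w₀ := 2)
    (eventually_differentiableAt_jointKoenigs two_mem_halfPlane) fderiv_jointKoenigs_two_ne
  have hX : Tendsto (fun p : ℂ × ℂ => ((p.2 + p.1) ^ 2 + conj p.1) ^ 2 + p.1) (𝓝 (-2, 0))
      (𝓝 2) := by
    have hcont : Continuous fun p : ℂ × ℂ => ((p.2 + p.1) ^ 2 + conj p.1) ^ 2 + p.1 := by fun_prop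
    have := hcont.tendsto (-2, 0)
    simp only [conj_neg_two] at this
    convert this using 2
    norm_num
  have ev1 := hX.eventually (ball_mem_nhds 2 hr₂)
  obtain ⟨s₁, hs₁, hball₁⟩ := Metric.eventually_nhds_iff_ball.1 ev1
  have ev2 := (tendsto_fixPt_diag.eventually (ball_mem_nhds 2 (half_pos hr₂))).and
    regularParam_mem_nhds
  obtain ⟨s₂, hs₂, hball₂⟩ := Metric.eventually_nhds_iff_ball.1 ev2
  have ht : Tendsto (fun k : ℕ => (1 / 10 : ℝ) ^ k * 4) atTop (𝓝 0) := by
    simpa using (tendsto_pow_atTop_nhds_zero_of_lt_one (r := (1 / 10 : ℝ)) (by norm_num)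
      (by norm_num)).mul_const 4
  obtain ⟨n₁, hn₁⟩ := eventually_atTop.1 (ht.eventually_lt_const (half_pos hr₂))
  refine ⟨min (min r₀ r₂) (min s₁ s₂), by positivity, κ, hκ, n₁, fun ε hε => ?_⟩
  obtain ⟨r', hr', hex⟩ := eventually_exists_jointKoenigs_eq
    (ε := min ε (min r₀ 1)) (by positivity)
  refine ⟨r', hr', fun c z n hn hc hc' hz hv => ?_⟩
  simp only [lt_min_iff] at hc hz
  obtain ⟨⟨hc0, hc2⟩, hcs1, hcs2⟩ := hc
  set v := fixMult c (conj c) ^ n * jointThird (c, conj c, conj z ^ 2) with hvdef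
  -- The candidate for the return point: the solution near `0` of `φ_c(w) = λⁿ ψ`.
  obtain ⟨w, hw, hwv⟩ := hex c v hc' hv
  simp only [lt_min_iff] at hw
  obtain ⟨hwε, hwr, hw1⟩ := hw
  obtain ⟨hβ, hreg⟩ := hball₂ c (by rw [mem_ball, dist_eq_norm, sub_neg_eq_add]; exact hcs2)
  have hcN := hreg.1
  have hdN := conj_mem_nearHat hcN
  have hwU : w ∈ halfPlane := by
    change -1 < w.re
    have := (abs_le.1 (Complex.abs_re_le_norm w)).1
    linarith
  have hG : ‖(invBranch c (conj c))^[n] w - 2‖ < r₂ := by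
    have h1 := invBranch_iterate_sub_fixPt hcN hdN hwU n
    have h2 : ‖w - fixPt c (conj c)‖ ≤ 4 := by
      have := norm_sub_le w (fixPt c (conj c))
      linarith [(norm_fixPt_le hcN hdN).1]
    have h3 : (1 / 10 : ℝ) ^ n * ‖w - fixPt c (conj c)‖ ≤ (1 / 10) ^ n * 4 := by gcongr
    rw [dist_eq_norm] at hβ
    have h4 := norm_sub_le_norm_sub_add_norm_sub ((invBranch c (conj c))^[n] w)
      (fixPt c (conj c)) 2
    have := hn₁ n hn
    linarith
  have hz3 : ‖(antiQuad c)^[3] z - 2‖ < r₂ := by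
    have := hball₁ (c, conj z ^ 2) (by
      rw [mem_ball, dist_eq_norm]
      exact (norm_prod_le_iff (r := max ‖c + 2‖ ‖conj z ^ 2‖)).2 ⟨by simp, by simp⟩ |>.trans_lt
        (max_lt hcs1 hz.2.1))
    rw [dist_eq_norm] at this
    rwa [antiQuad_iterate_three]
  -- Both points lie near `2`, where the linearizer is injective, and `λⁿ` times its value is the
  -- same at both.
  have hinj : (invBranch c (conj c))^[n] w = (antiQuad c)^[3] z := by
    have h1 := hlow₂ c _ _ hc2 hG hz3
    have h2 : jointKoenigs (c, conj c, (invBranch c (conj c))^[n] w) =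
        jointKoenigs (c, conj c, (antiQuad c)^[3] z) := by
      have h3 := fixMult_pow_mul_jointKoenigs_iterate hcN hwU n
      rw [hwv, hvdef, jointThird_eq_jointKoenigs, ← antiQuad_iterate_three] at h3
      exact mul_left_cancel₀ (pow_ne_zero n (fixMult_ne_zero hcN hdN)) h3
    rw [h2, sub_self, norm_zero] at h1
    have h3 : ‖(invBranch c (conj c))^[n] w - (antiQuad c)^[3] z‖ ≤ 0 :=
      le_of_mul_le_mul_left (by rwa [mul_zero]) hκ₂
    exact sub_eq_zero.1 (norm_le_zero_iff.1 h3)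
  have hret : (antiQuad c)^[2 * n + 3] z = w := by
    rw [Function.iterate_add_apply, Function.iterate_mul, ← hinj, antiQuad_iterate_invBranch]
  rw [hret]
  refine ⟨hwv, hwε, ?_⟩
  have h := hlow₀ c w 0 hc0 (by simpa using hwr) (by simpa using hr₀)
  rwa [sub_zero, hwv, jointKoenigs_zero hreg.2] at h

/-- Telescoping gives `n |x - y| Mⁿ⁻¹` with `M = 16 + ε`; since `n ε ≤ 1`, `Mⁿ ≤ 3 * 16ⁿ`, and
dividing by `M ≥ 16` absorbs the `3`. -/
theorem norm_pow_sub_pow_le {x y : ℂ} {ε : ℝ} {n : ℕ} (hx : ‖x - 16‖ ≤ ε) (hy : ‖y - 16‖ ≤ ε)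
    (hε : n * ε ≤ 1) : ‖x ^ n - y ^ n‖ ≤ n * ‖x - y‖ * 16 ^ n := by
  have hε0 : 0 ≤ ε := (norm_nonneg _).trans hx
  set M := 16 + ε with hM
  have hbound : ∀ {z : ℂ}, ‖z - 16‖ ≤ ε → ‖z‖ ≤ M := fun {z} hz => by
    have := norm_add_le (z - 16) 16
    rw [sub_add_cancel, Complex.norm_ofNat] at this
    linarith
  have hind : ∀ m : ℕ, ‖x ^ m - y ^ m‖ * M ≤ m * ‖x - y‖ * M ^ m := fun m => by
    induction m with
    | zero => simp
    | succ m ih =>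
      have e : x ^ (m + 1) - y ^ (m + 1) = x * (x ^ m - y ^ m) + (x - y) * y ^ m := by ring
      have h1 : ‖x ^ (m + 1) - y ^ (m + 1)‖ ≤ M * ‖x ^ m - y ^ m‖ + ‖x - y‖ * M ^ m := by
        rw [e]
        refine (norm_add_le _ _).trans ?_
        rw [norm_mul, norm_mul, norm_pow]
        gcongr
        · exact hbound hx
        · exact hbound hy
      have h2 := mul_le_mul_of_nonneg_right h1 (by positivity : 0 ≤ M)
      have h3 := mul_le_mul_of_nonneg_left ih (by positivity : 0 ≤ M)
      push_cast
      rw [pow_succ M]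
      linarith
  have hpow : M ^ n ≤ 3 * 16 ^ n := by
    have h1 : M = 16 * (1 + ε / 16) := by rw [hM]; ring
    have h2 : (1 + ε / 16) ^ n ≤ 3 := by
      calc (1 + ε / 16) ^ n ≤ Real.exp (ε / 16) ^ n := by
            gcongr
            linarith [Real.add_one_le_exp (ε / 16)]
        _ = Real.exp (n * (ε / 16)) := by rw [← Real.exp_nat_mul]
        _ ≤ Real.exp 1 := Real.exp_le_exp.2 (by linarith)
        _ ≤ 3 := by linarith [Real.exp_one_lt_d9]
    rw [h1, mul_pow]
    nlinarith [pow_pos (by norm_num : (0 : ℝ) < 16) n]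
  have h := hind n
  have h4 : (n : ℝ) * ‖x - y‖ * M ^ n ≤ n * ‖x - y‖ * (3 * 16 ^ n) := by gcongr
  have h5 : ‖x ^ n - y ^ n‖ * 16 ≤ ‖x ^ n - y ^ n‖ * M := by gcongr; linarith
  have h6 : 0 ≤ (n : ℝ) * ‖x - y‖ * 16 ^ n := by positivity
  linarith

theorem exists_fixMult_lipschitz : ∃ r > 0, ∃ L > 0, ∀ c c' : ℂ, ‖c + 2‖ < r → ‖c' + 2‖ < r →
    ‖fixMult c (conj c) - fixMult c' (conj c')‖ ≤ L * ‖c - c'‖ := by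
  have hev : ∀ᶠ p in 𝓝 basePt, DifferentiableAt ℂ (fun p : ℂ × ℂ × ℂ => fixMult p.1 p.2.1) p := by
    filter_upwards [isOpen_paramDomain.mem_nhds (mem_paramDomain_neg_two zero_mem_halfPlane)]
      with p hp using differentiableAt_fixMult hp
  obtain ⟨r, hr, L, hL, -, hLip, -⟩ := exists_taylor_bound hev
  refine ⟨r, hr, L, hL, fun c c' hc hc' => ?_⟩
  have hmem : ∀ c : ℂ, ‖c + 2‖ < r → (c, conj c, (0 : ℂ)) ∈ ball basePt r := fun c hc => by
    rw [mem_ball, dist_eq_norm]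
    refine lt_of_le_of_lt norm_diag_sub_le ?_
    simpa using hc
  refine (hLip _ (hmem c hc) _ (hmem c' hc')).trans ?_
  gcongr
  refine norm_triple_le le_rfl ?_ (by simp)
  rw [← map_sub, RCLike.norm_conj]

theorem tendsto_nat_mul_pow {q : ℝ} (hq0 : 0 ≤ q) (hq : q < 1) (C : ℝ) :
    Tendsto (fun n : ℕ => (n : ℝ) * (C * q ^ n)) atTop (𝓝 0) := by
  have := (tendsto_self_mul_const_pow_of_lt_one hq0 hq).const_mul C
  rw [mul_zero] at this
  exact this.congr fun n => by ring

/-- The centres satisfy `λⁿ A_0 = 1` and converge to `-2` with speed `16⁻ⁿ`. -/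
theorem exists_center_bounds : ∃ C > 0, ∃ n₀ : ℕ, ∀ n ≥ n₀,
    fixMult (center n) (conj (center n : ℂ)) ^ n *
        jointThird (center n, conj (center n : ℂ), 0) = 1 ∧
      16 ^ n / 2 ≤ ‖fixMult (center n) (conj (center n : ℂ)) ^ n‖ ∧
      ‖(center n : ℂ) + 2‖ ≤ C / 16 ^ n := by
  obtain ⟨r₂, hr₂, κ, hκ, hlow⟩ := exists_lower_bound (w₀ := 2)
    (eventually_differentiableAt_jointKoenigs two_mem_halfPlane) fderiv_jointKoenigs_two_ne
  obtain ⟨r₃, hr₃, L, hL, hLip⟩ := exists_fixMult_lipschitz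
  have hX : Tendsto (fun c : ℂ => (c ^ 2 + c) ^ 2 + c) (𝓝 (-2)) (𝓝 2) := by
    have hcont : Continuous fun c : ℂ => (c ^ 2 + c) ^ 2 + c := by fun_prop
    have := hcont.tendsto (-2)
    convert this using 2
    norm_num
  have ev := (((tendsto_fixPt_diag.eventually (ball_mem_nhds 2 hr₂)).and
    regularParam_mem_nhds).and ((hX.eventually (ball_mem_nhds 2 hr₂)).and
    ((eventually_mem_set.2 (ball_mem_nhds (-2 : ℂ) hr₂)).and (ball_mem_nhds (-2 : ℂ) hr₃))))
  have ev2 := tendsto_center.eventually ev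
  have ev3 := (tendsto_nat_mul_pow (by norm_num : (0 : ℝ) ≤ 5 / 8) (by norm_num)
    (L * 2)).eventually_lt_const (half_pos one_pos)
  obtain ⟨n₀, hn₀⟩ := eventually_atTop.1 (ev2.and ev3)
  -- From `|A_0(c_n)| = |λ|⁻ⁿ ≤ 2 / 16ⁿ` and `κ (c_n + 2) ≤ κ |x₃ - β| ≤ |A_0(c_n)|`, where `x₃` is
  -- the third critical orbit point.
  refine ⟨2 / κ, by positivity, n₀, fun n hn => ?_⟩
  obtain ⟨⟨⟨hβ, hreg⟩, h3, hr2, hr3⟩, hsmall⟩ := hn₀ n hn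
  rw [dist_eq_norm] at hβ h3
  rw [mem_ball] at hr2
  rw [dist_eq_norm, sub_neg_eq_add] at hr2 hr3
  have hcN := hreg.1
  have hdN := conj_mem_nearHat hcN
  set x : ℝ := realOrbit (center n) 3 with hx
  have hx3 : (x : ℂ) = ((center n : ℂ) ^ 2 + center n) ^ 2 + center n := by
    rw [hx]; simp [realOrbit_succ, realOrbit_zero]
  have hconj : conj (center n : ℂ) = center n := Complex.conj_ofReal _
  have hT : jointThird (center n, conj (center n : ℂ), 0) =
      jointKoenigs (center n, conj (center n : ℂ), (x : ℂ)) := by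
    rw [jointThird_eq_jointKoenigs, hx3, hconj, zero_add]
  have hone : fixMult (center n) (conj (center n : ℂ)) ^ n *
      jointThird (center n, conj (center n : ℂ), 0) = 1 := by
    have h := fixMult_pow_mul_jointKoenigs_iterate hcN zero_mem_halfPlane n
    have h2 := invBranch_iterate_realOrbit_center (n := n) (m := 3) (k := n) (by norm_num)
      (by omega)
    rw [show 3 + 2 * n = 2 * n + 3 by ring, realOrbit_center, Complex.ofReal_zero, ← hx] at h2
    rw [jointKoenigs_zero hreg.2, hconj, h2] at h
    rw [hT, hconj, h]
  have hlam : 16 ^ n / 2 ≤ ‖fixMult (center n) (conj (center n : ℂ)) ^ n‖ := by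
    -- Since `n |λ - 16| → 0`, the power `λⁿ` stays within `16ⁿ / 2` of `16ⁿ`.
    have h1 : ‖fixMult (center n) (conj (center n : ℂ)) - 16‖ ≤ L * 2 * (5 / 8) ^ n := by
      have := hLip (center n) (-2) hr3 (by simpa using hr₃)
      rw [conj_neg_two, fixMult_neg_two, sub_neg_eq_add, norm_center_add_two] at this
      refine this.trans ?_
      rw [mul_assoc]
      gcongr
      exact center_add_two_le n
    have h2 := norm_pow_sub_pow_le h1 (y := 16) (n := n) (by simp; positivity) (by linarith)
    have h3 : (n : ℝ) * ‖fixMult (center n) (conj (center n : ℂ)) - 16‖ * 16 ^ n ≤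
        1 / 2 * 16 ^ n := by
      gcongr
      exact (mul_le_mul_of_nonneg_left h1 (Nat.cast_nonneg n)).trans hsmall.le
    have h4 := norm_sub_norm_le ((16 : ℂ) ^ n) (fixMult (center n) (conj (center n : ℂ)) ^ n)
    rw [norm_sub_rev, norm_pow 16, Complex.norm_ofNat] at h4
    linarith
  refine ⟨hone, hlam, ?_⟩
  have hβeq : fixPt (center n) (conj (center n : ℂ)) = realBeta (center n) := by
    rw [hconj] at hdN ⊢
    exact fixPt_ofReal hcN (center_mem_Icc n)
  have hlow' := hlow (center n) x (fixPt (center n) (conj (center n : ℂ))) hr2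
    (by rw [hx3]; exact h3) hβ
  have hKβ : jointKoenigs (center n, conj (center n : ℂ),
      fixPt (center n) (conj (center n : ℂ))) = 0 := by
    simp only [jointKoenigs, normKoenigs]
    rw [koenigsLim_fixPt hcN hdN, zero_div]
  rw [hKβ, sub_zero, ← hT] at hlow'
  have hinv : ‖jointThird (center n, conj (center n : ℂ), 0)‖ ≤ 2 / 16 ^ n := by
    have h := congrArg norm hone
    rw [norm_mul, norm_one] at h
    rw [le_div_iff₀ (by positivity)]
    nlinarith [norm_nonneg (jointThird (center n, conj (center n : ℂ), 0))]
  have hdist : center n + 2 ≤ ‖(x : ℂ) - fixPt (center n) (conj (center n : ℂ))‖ := by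
    rw [hβeq, ← Complex.ofReal_sub, Complex.norm_real, Real.norm_eq_abs, abs_sub_comm]
    refine le_trans ?_ (le_abs_self _)
    have h := add_two_mul_pow_le (n := n) (k := 1) (by omega)
    have := (center_mem_Icc n).1
    linarith
  rw [norm_center_add_two, div_div, div_eq_mul_inv, mul_inv, mul_comm κ⁻¹, ← mul_assoc,
    ← div_eq_mul_inv, ← div_eq_mul_inv, le_div_iff₀ hκ]
  have := mul_le_mul_of_nonneg_left hdist hκ.le
  linarith

end LocalDynamics

/-! ### First order expansion of the return map -/

section Renormalization

set_option maxHeartbeats 2000000 in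
/-- First order expansion of the return map near the centres, in the unscaled coordinate. -/
theorem exists_return_estimate {s : ℕ → ℝ} (hs0 : ∀ n, 0 < s n)
    (hlim : Tendsto (fun n : ℕ => 16 ^ n * s n) atTop (𝓝 0))
    (hlow : ∀ n, 1 ≤ 16 ^ n * 16 ^ n * s n) {K : ℝ} (hK : 0 < K) :
    ∃ C > 0, ∃ n₀ : ℕ, ∀ n ≥ n₀, ∀ ρ z : ℂ, ‖ρ‖ ≤ K * s n → ‖conj z ^ 2‖ ≤ K * s n →
      ‖aCoeff cHat * (antiQuad (center n + ρ))^[2 * n + 3] z -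
        (fixMult (center n) (conj (center n : ℂ)) ^ n * (b0 * ρ + b0Star * conj ρ) +
          16 ^ n * (ACoeff 2 cHat * conj z ^ 2))‖ ≤ C * (n + 1) * (16 ^ n * s n) ^ 2 := by
  obtain ⟨rT, hrT, LT, hLT, -, hTLip, hTTay⟩ :=
    exists_taylor_bound eventually_differentiableAt_jointThird
  obtain ⟨rK, hrK, LK, hLK, -, -, hKTay⟩ :=
    exists_taylor_bound (x := basePt) (eventually_differentiableAt_jointKoenigs zero_mem_halfPlane)
  obtain ⟨rM, hrM, LM, hLM, hMLip⟩ := exists_fixMult_lipschitz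
  obtain ⟨rR, hrR, κ, hκ, nR, hret⟩ := exists_return
  obtain ⟨r', hr', hret'⟩ := hret (rK / 2) (half_pos hrK)
  obtain ⟨Cc, hCc, nC, hcen⟩ := exists_center_bounds
  obtain ⟨rP, hrP, hreg⟩ := Metric.mem_nhds_iff.1 regularParam_mem_nhds
  -- `C₁ 16⁻ⁿ` will bound `|c + 2|` and `|z̄²|`, `C₂ 16ⁿ s` will bound `|φ(w) - 1|`, and `C₃ 16ⁿ s`
  -- will bound the return point `w`.
  set C₁ := Cc + K with hC₁
  have hC₁0 : 0 < C₁ := by positivity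
  set C₂ := 2 * LT * K + K * (2 + LT * K) / C₁ with hC₂
  have hC₂0 : 0 < C₂ := by positivity
  set C₃ := C₂ / κ with hC₃
  have hC₃0 : 0 < C₃ := by positivity
  set r₀ := min (min rT rK) (min (min rM rR) (min r' rP)) with hr₀
  have hr₀0 : 0 < r₀ := by positivity
  have hinv : Tendsto (fun n : ℕ => 2 * C₁ * (1 / 16 : ℝ) ^ n) atTop (𝓝 0) := by
    simpa using (tendsto_pow_atTop_nhds_zero_of_lt_one (r := (1 / 16 : ℝ)) (by norm_num)
      (by norm_num)).const_mul (2 * C₁)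
  have hninv := tendsto_nat_mul_pow (q := 1 / 16) (by norm_num) (by norm_num) (LM * C₁)
  have hlimC : Tendsto (fun n : ℕ => C₂ * (16 ^ n * s n)) atTop (𝓝 0) := by
    simpa using hlim.const_mul C₂
  obtain ⟨n₀, hn₀⟩ := eventually_atTop.1 ((eventually_ge_atTop (max nR nC)).and
    (((hinv.eventually_lt_const (lt_min hr₀0 (half_pos hrK))).and
      (hninv.eventually_lt_const one_pos)).and
    ((hlim.eventually_lt_const one_pos).and (hlimC.eventually_lt_const hr'))))
  set A := ‖ACoeff 2 cHat‖ with hA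
  have hA0 : 0 ≤ A := norm_nonneg _
  refine ⟨LK * C₃ * (2 * C₁ + C₃) + 6 * LT * C₁ * K + (LM * C₁ * A * K + LM * K * (2 + LT * K)),
    by positivity, n₀, fun n hn ρ z hρ hu => ?_⟩
  obtain ⟨hnn, ⟨hCr, hn1⟩, hQs1, hC₂r⟩ := hn₀ n hn
  have hnR : nR ≤ n := (le_max_left _ _).trans hnn
  have hnC : nC ≤ n := (le_max_right _ _).trans hnn
  set Q : ℝ := 16 ^ n with hQ
  set h : ℝ := (1 / 16) ^ n with hh
  have hQ0 : 0 < Q := by positivity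
  have hh0 : 0 < h := by positivity
  have hQh : Q * h = 1 := by rw [hQ, hh, ← mul_pow]; norm_num
  set S := s n with hS
  have hS0 : 0 < S := hs0 n
  have hSh : S ≤ h := by
    have := mul_le_mul_of_nonneg_right hQs1.le hh0.le
    have e : Q * S * h = S := by rw [mul_right_comm, hQh, one_mul]
    linarith
  set X := (Q * S) ^ 2 with hX
  have hX0 : 0 < X := by positivity
  -- The lower bound on `s` lets errors of order `s` be absorbed into `(16ⁿ s)²`.
  have hSX : S ≤ X := by
    have := mul_le_mul_of_nonneg_right (hlow n) hS0.le
    rw [hX]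
    calc S = 1 * S := (one_mul S).symm
      _ ≤ Q * Q * S * S := this
      _ = (Q * S) ^ 2 := by ring
  obtain ⟨hone, hlamlow, hcn⟩ := hcen n hnC
  set cn : ℂ := (center n : ℂ) with hcndef
  set c : ℂ := cn + ρ with hc
  set u : ℂ := conj z ^ 2 with hu'
  have hcn' : ‖cn + 2‖ ≤ C₁ * h := by
    have : Cc / Q = Cc * h := by rw [div_eq_iff hQ0.ne', mul_assoc, mul_comm h, hQh, mul_one]
    rw [this] at hcn
    nlinarith
  have hc2 : ‖c + 2‖ ≤ C₁ * h := by
    have h1 : ‖c + 2‖ ≤ ‖cn + 2‖ + ‖ρ‖ := by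
      rw [show c + 2 = (cn + 2) + ρ by rw [hc]; ring]; exact norm_add_le _ _
    have h2 : Cc / Q = Cc * h := by rw [div_eq_iff hQ0.ne', mul_assoc, mul_comm h, hQh, mul_one]
    have h3 := mul_le_mul_of_nonneg_left hSh hK.le
    rw [h2] at hcn
    rw [hC₁, add_mul]
    linarith
  have hKS : K * S ≤ C₁ * h := by
    have := mul_le_mul_of_nonneg_left hSh hK.le
    rw [hC₁]; nlinarith
  have hub : ‖u‖ ≤ C₁ * h := hu.trans hKS
  have hsmall : 2 * (C₁ * h) < r₀ := by
    have := hCr.trans_le (min_le_left _ _); linarith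
  have hsmallK : 2 * (C₁ * h) < rK / 2 := by
    have := hCr.trans_le (min_le_right _ _); linarith
  have hC₁h : 0 < C₁ * h := by positivity
  rw [hr₀, lt_min_iff, lt_min_iff, lt_min_iff, lt_min_iff, lt_min_iff] at hsmall
  obtain ⟨⟨hs1, hs2⟩, ⟨hs3, hs4⟩, hs5, hs6⟩ := hsmall
  have hcreg : c ∈ regularParam := hreg (by
    rw [mem_ball, dist_eq_norm, sub_neg_eq_add]; linarith)
  have hp : ‖((c, conj c, u) : ℂ × ℂ × ℂ) - basePt‖ ≤ 2 * (C₁ * h) := by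
    refine norm_diag_sub_le.trans ?_
    rw [sub_zero]; linarith
  have hq : ‖((cn, conj cn, 0) : ℂ × ℂ × ℂ) - basePt‖ ≤ C₁ * h := by
    refine norm_diag_sub_le.trans ?_
    rw [sub_zero, norm_zero, add_zero]; exact hcn'
  have hpq_eq : ((c, conj c, u) : ℂ × ℂ × ℂ) - (cn, conj cn, 0) = (ρ, conj ρ, u) := by
    simp [hc]
  have hpq : ‖((c, conj c, u) : ℂ × ℂ × ℂ) - (cn, conj cn, 0)‖ ≤ K * S := by
    rw [hpq_eq]
    exact norm_triple_le hρ (by rwa [RCLike.norm_conj]) hu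
  have hpm : ((c, conj c, u) : ℂ × ℂ × ℂ) ∈ ball basePt rT := by
    rw [mem_ball, dist_eq_norm]; linarith
  have hqm : ((cn, conj cn, 0) : ℂ × ℂ × ℂ) ∈ ball basePt rT := by
    rw [mem_ball, dist_eq_norm]; linarith
  set ψp := jointThird (c, conj c, u) with hψp
  set ψq := jointThird (cn, conj cn, 0) with hψq
  set Δ := b0 * ρ + b0Star * conj ρ + ACoeff 2 cHat * u with hΔ
  have he1 : ‖ψp - ψq - Δ‖ ≤ LT * (3 * (C₁ * h)) * (K * S) := by
    have h1 := hTTay _ hpm _ hqm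
    rw [hpq_eq, fderiv_jointThird_apply, ← hpq_eq] at h1
    refine h1.trans ?_
    gcongr
    linarith
  have hψdiff : ‖ψp - ψq‖ ≤ LT * (K * S) := (hTLip _ hpm _ hqm).trans (by gcongr)
  set lc := fixMult c (conj c) with hlc
  set ln := fixMult cn (conj cn) with hln
  have hψq1 : ‖ψq‖ ≤ 2 * h := by
    have h1 := congrArg norm hone
    rw [norm_mul, norm_one] at h1
    have h2 : Q / 2 * ‖ψq‖ ≤ 1 := by
      rw [← h1]; gcongr
    have h3 := mul_le_mul_of_nonneg_left h2 hh0.le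
    have e : h * (Q / 2 * ‖ψq‖) = ‖ψq‖ / 2 := by
      rw [← mul_assoc, ← mul_div_assoc, mul_comm h, hQh]; ring
    linarith
  have hψp1 : ‖ψp‖ ≤ (2 + LT * K) * h := by
    have h1 := norm_add_le (ψp - ψq) ψq
    rw [sub_add_cancel] at h1
    have h2 : LT * (K * S) ≤ LT * (K * h) := by gcongr
    linarith
  have hl16 : ∀ c : ℂ, ‖c + 2‖ ≤ C₁ * h → ‖fixMult c (conj c) - 16‖ ≤ LM * C₁ * h := fun c hc => by
    have h1 := hMLip c (-2) (by linarith) (by simpa using hrM)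
    rw [conj_neg_two, fixMult_neg_two, sub_neg_eq_add] at h1
    refine h1.trans ?_
    rw [mul_assoc]
    gcongr
  have hnat : (0 : ℝ) ≤ n := Nat.cast_nonneg n
  have hln16 : ‖ln ^ n - 16 ^ n‖ ≤ n * (LM * C₁ * h) * Q := by
    refine (norm_pow_sub_pow_le (hl16 cn hcn') (y := 16) (by simp; positivity) hn1.le).trans ?_
    gcongr
    exact hl16 cn hcn'
  have hlnup : ‖ln ^ n‖ ≤ 2 * Q := by
    have h1 := norm_add_le (ln ^ n - 16 ^ n) (16 ^ n)
    rw [sub_add_cancel, norm_pow (16 : ℂ), Complex.norm_ofNat] at h1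
    have h2 : n * (LM * C₁ * h) * Q ≤ 1 * Q := by gcongr
    linarith
  have hlcln : ‖lc ^ n - ln ^ n‖ ≤ n * (LM * (K * S)) * Q := by
    refine (norm_pow_sub_pow_le (hl16 c hc2) (hl16 cn hcn') hn1.le).trans ?_
    gcongr
    refine (hMLip c cn (by linarith) (by linarith)).trans ?_
    gcongr
    rwa [hc, add_sub_cancel_left]
  set v := lc ^ n * ψp with hv
  -- Here `1` is replaced by `λ_{c_n}ⁿ ψ` at the centre.
  have hv1 : v - 1 = ln ^ n * (ψp - ψq) + (lc ^ n - ln ^ n) * ψp := by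
    rw [hv, ← hone]; ring
  have hsecond : ‖(lc ^ n - ln ^ n) * ψp‖ ≤ n * (LM * K * (2 + LT * K)) * S := by
    rw [norm_mul]
    calc ‖lc ^ n - ln ^ n‖ * ‖ψp‖
        ≤ (n * (LM * (K * S)) * Q) * ((2 + LT * K) * h) := by gcongr
      _ = n * (LM * K * (2 + LT * K)) * S * (Q * h) := by ring
      _ = _ := by rw [hQh, mul_one]
  have hvn : ‖v - 1‖ ≤ C₂ * (Q * S) := by
    rw [hv1]
    refine (norm_add_le _ _).trans ?_
    have h1 : ‖ln ^ n * (ψp - ψq)‖ ≤ 2 * Q * (LT * (K * S)) := by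
      rw [norm_mul]; gcongr
    have h2 : n * (LM * K * (2 + LT * K)) * S ≤ K * (2 + LT * K) / C₁ * (Q * S) := by
      have h3 : n * LM ≤ Q / C₁ := by
        rw [le_div_iff₀ hC₁0]
        have := mul_le_mul_of_nonneg_right hn1.le hQ0.le
        calc n * LM * C₁ = n * (LM * C₁ * h) * Q := by
              rw [← mul_one (n * LM * C₁), ← hQh]; ring
          _ ≤ 1 * Q := this
          _ = Q := one_mul Q
      calc n * (LM * K * (2 + LT * K)) * S = (n * LM) * (K * (2 + LT * K) * S) := by ring
        _ ≤ (Q / C₁) * (K * (2 + LT * K) * S) := by gcongr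
        _ = _ := by ring
    rw [hC₂, add_mul]
    linarith
  obtain ⟨hKw, hwr, hwκ⟩ := hret' c z n hnR (by linarith) (by linarith) (by linarith)
    (hvn.trans_lt hC₂r)
  set w := (antiQuad c)^[2 * n + 3] z with hw
  have hwn : ‖w‖ ≤ C₃ * (Q * S) := by
    rw [hC₃, div_mul_eq_mul_div, le_div_iff₀ hκ, mul_comm]
    exact hwκ.trans hvn
  have he2 : ‖v - 1 - aCoeff cHat * w‖ ≤ LK * C₃ * (2 * C₁ + C₃) * X := by
    have hm1 : ‖((c, conj c, w) : ℂ × ℂ × ℂ) - basePt‖ ≤ C₁ * h + ‖w‖ := by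
      refine norm_diag_sub_le.trans ?_
      rw [sub_zero]; linarith
    have hm2 : ‖((c, conj c, 0) : ℂ × ℂ × ℂ) - basePt‖ ≤ C₁ * h := by
      refine norm_diag_sub_le.trans ?_
      rw [sub_zero, norm_zero, add_zero]; exact hc2
    have h1 := hKTay (c, conj c, w) (by rw [mem_ball, dist_eq_norm]; linarith) (c, conj c, 0)
      (by rw [mem_ball, dist_eq_norm]; linarith)
    have e : ((c, conj c, w) : ℂ × ℂ × ℂ) - (c, conj c, 0) = w • (0, 0, 1) := by simp
    have en : ‖((c, conj c, w) : ℂ × ℂ × ℂ) - (c, conj c, 0)‖ = ‖w‖ := by simp [Prod.norm_def]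
    rw [en, e, map_smul, ← aCoeff_cHat, smul_eq_mul, mul_comm w, hKw,
      jointKoenigs_zero hcreg.2] at h1
    refine h1.trans ?_
    have h2 : C₁ * h * (Q * S) ≤ C₁ * X := by
      have : C₁ * h * (Q * S) = C₁ * S := by rw [← mul_one (C₁ * S), ← hQh]; ring
      rw [this]; gcongr
    calc LK * (‖((c, conj c, w) : ℂ × ℂ × ℂ) - basePt‖ +
            ‖((c, conj c, 0) : ℂ × ℂ × ℂ) - basePt‖) * ‖w‖
        ≤ LK * (2 * (C₁ * h) + C₃ * (Q * S)) * (C₃ * (Q * S)) :=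
          mul_le_mul (mul_le_mul_of_nonneg_left (by linarith) hLK.le) hwn (norm_nonneg _)
            (by positivity)
      _ = LK * C₃ * (2 * (C₁ * h * (Q * S)) + C₃ * X) := by rw [hX]; ring
      _ ≤ LK * C₃ * (2 * (C₁ * X) + C₃ * X) := by gcongr
      _ = _ := by ring
  -- Four errors: nonlinearity of `φ` at `0`, nonlinearity of `ψ`, `λ_{c_n}ⁿ` against `16ⁿ`, and
  -- `λ_cⁿ` against `λ_{c_n}ⁿ`. The first is `O((16ⁿ s)²)`, the second `O(s)`, the others `O(n s)`.
  have hfinal : aCoeff cHat * w - (ln ^ n * (b0 * ρ + b0Star * conj ρ) +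
      16 ^ n * (ACoeff 2 cHat * u)) = -(v - 1 - aCoeff cHat * w) + ln ^ n * (ψp - ψq - Δ) +
      (ln ^ n - 16 ^ n) * (ACoeff 2 cHat * u) + (lc ^ n - ln ^ n) * ψp := by
    rw [hv1, hΔ]; ring
  have ht1 : ‖ln ^ n * (ψp - ψq - Δ)‖ ≤ 6 * LT * C₁ * K * S := by
    rw [norm_mul]
    calc ‖ln ^ n‖ * ‖ψp - ψq - Δ‖ ≤ 2 * Q * (LT * (3 * (C₁ * h)) * (K * S)) := by gcongr
      _ = 6 * LT * C₁ * K * S * (Q * h) := by ring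
      _ = _ := by rw [hQh, mul_one]
  have ht2 : ‖(ln ^ n - 16 ^ n) * (ACoeff 2 cHat * u)‖ ≤ n * (LM * C₁ * A * K) * S := by
    rw [norm_mul, norm_mul, ← hA]
    calc ‖ln ^ n - 16 ^ n‖ * (A * ‖u‖) ≤ n * (LM * C₁ * h) * Q * (A * (K * S)) := by gcongr
      _ = n * (LM * C₁ * A * K) * S * (Q * h) := by ring
      _ = _ := by rw [hQh, mul_one]
  rw [hfinal]
  refine (norm_add_le _ _).trans ((add_le_add_left ((norm_add_le _ _).trans
    (add_le_add_left (norm_add_le _ _) _)) _).trans ?_)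
  rw [norm_neg]
  set P₁ := LK * C₃ * (2 * C₁ + C₃) with hP₁
  set P₂ := 6 * LT * C₁ * K with hP₂
  set P₃ := LM * C₁ * A * K with hP₃
  set P₄ := LM * K * (2 + LT * K) with hP₄
  have hP₁0 : 0 ≤ P₁ := by positivity
  have hP₂0 : 0 ≤ P₂ := by positivity
  have hP₃0 : 0 ≤ P₃ := by positivity
  have hP₄0 : 0 ≤ P₄ := by positivity
  calc ‖v - 1 - aCoeff cHat * w‖ + ‖ln ^ n * (ψp - ψq - Δ)‖ +
        ‖(ln ^ n - 16 ^ n) * (ACoeff 2 cHat * u)‖ + ‖(lc ^ n - ln ^ n) * ψp‖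
      ≤ P₁ * X + P₂ * S + n * P₃ * S + n * P₄ * S :=
        add_le_add (add_le_add (add_le_add he2 ht1) ht2) hsecond
    _ ≤ P₁ * X + P₂ * X + n * P₃ * X + n * P₄ * X := by gcongr
    _ ≤ (P₁ + P₂ + (P₃ + P₄)) * (n + 1) * X := by
        have : 0 ≤ ((P₁ + P₂) * n + (P₃ + P₄)) * X := by positivity
        linarith

end Renormalization

/-! ### Rescaling and the exponential rate -/

section Scaling

theorem mult_cHat : mult cHat = 16 := by
  rw [cHat, mult_eq neg_two_mem_nearHat, conj_neg_two, fixMult_neg_two]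

theorem scaleBase_ne_zero (n : ℕ) : scaleBase n ≠ 0 := by
  rw [scaleBase, mult_cHat]
  exact div_ne_zero (mul_ne_zero (pow_ne_zero n (by norm_num)) ACoeff_two_cHat_ne_zero)
    aCoeff_cHat_ne_zero

theorem norm_scaleBase (n : ℕ) :
    ‖scaleBase n‖ = 16 ^ n * (‖ACoeff 2 cHat‖ / ‖aCoeff cHat‖) := by
  rw [scaleBase, mult_cHat, norm_div, norm_mul, norm_pow, Complex.norm_ofNat, mul_div_assoc]

theorem IsScaling.ne_zero {n : ℕ} {α : ℂ} (h : IsScaling n α) : α ≠ 0 := by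
  rw [← norm_pos_iff, h.1, norm_pos_iff]
  exact scaleBase_ne_zero n

/-- The argument condition makes `α³` times the base positive, hence equal to `|α|⁴ = (α conj α)²`;
cancel `α²`. This identity normalizes the coefficient of `Z̄²` to `1`. -/
theorem IsScaling.mul_scaleBase {n : ℕ} {α : ℂ} (h : IsScaling n α) :
    α * scaleBase n = conj α ^ 2 := by
  have hα := h.ne_zero
  have hs := scaleBase_ne_zero n
  have harg : (((α ^ 3 * scaleBase n).arg : ℝ) : Real.Angle) = ((0 : ℝ) : Real.Angle) := by
    rw [Complex.arg_mul_coe_angle (pow_ne_zero 3 hα) hs, Complex.arg_pow_coe_angle, h.2,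
      neg_add_cancel, Real.Angle.coe_zero]
  have harg0 : (α ^ 3 * scaleBase n).arg = 0 := by
    have := congrArg Real.Angle.toReal harg
    rwa [Complex.arg_coe_angle_toReal_eq_arg, Real.Angle.coe_zero, Real.Angle.toReal_zero] at this
  have h1 : α ^ 3 * scaleBase n = ((‖α‖ ^ 4 : ℝ) : ℂ) := by
    have h2 := Complex.norm_mul_exp_arg_mul_I (α ^ 3 * scaleBase n)
    rw [harg0, Complex.ofReal_zero, zero_mul, Complex.exp_zero, mul_one, norm_mul, norm_pow,
      ← h.1] at h2
    rw [← h2]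
    push_cast
    ring
  have h3 : (α * conj α) ^ 2 = ((‖α‖ ^ 4 : ℝ) : ℂ) := by
    rw [Complex.mul_conj, Complex.normSq_eq_norm_sq]
    push_cast
    ring
  refine mul_left_cancel₀ (pow_ne_zero 2 hα) ?_
  rw [← mul_pow, h3, ← h1]
  ring

/-- `ρ_n` is the adjugate of the real-linear map `ρ ↦ b₀ ρ + b₀* conj ρ` applied to `k_n t`: the
`conj t` terms cancel and the determinant remains. -/
theorem b0_mul_rho_add (n : ℕ) (α t : ℂ) :
    b0 * rho n α t + b0Star * conj (rho n α t) =
      kConst n α * (((‖b0‖ ^ 2 - ‖b0Star‖ ^ 2 : ℝ) : ℂ) * t) := by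
  have h : ∀ z : ℂ, ((‖z‖ ^ 2 : ℝ) : ℂ) = z * conj z := fun z => by
    rw [Complex.mul_conj, Complex.normSq_eq_norm_sq]
  rw [Complex.ofReal_sub, h, h, rho]
  simp only [map_sub, map_mul, Complex.conj_conj]
  ring

theorem norm_rho_le (n : ℕ) (α t : ℂ) :
    ‖rho n α t‖ ≤ ‖kConst n α‖ * (‖b0‖ + ‖b0Star‖) * ‖t‖ := by
  rw [rho]
  refine (norm_sub_le _ _).trans_eq ?_
  simp only [norm_mul, RCLike.norm_conj]
  ring

theorem rpow_mul_nat (x : ℝ) (n : ℕ) : (16 : ℝ) ^ (x * (n : ℝ)) = ((16 : ℝ) ^ x) ^ n := by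
  rw [Real.rpow_mul (by norm_num), Real.rpow_natCast]

/-- The rescaled return maps converge exponentially fast. -/
theorem exists_renorm_estimate {δ γ : ℝ} (hδ : 3 / 4 < δ) (hγ : 1 / 2 < γ)
    (hγ1 : γ < 1) :
    ∃ η : ℝ, 0 < η ∧ η < 1 ∧
      ∀ M₁ M₂ : ℝ, ∃ (C : ℝ) (n₀ : ℕ), ∀ n : ℕ, n₀ ≤ n →
        ∀ α : ℂ, IsScaling n α →
          ∀ Z t : ℂ,
            ‖Z‖ ≤ M₁ * bigLambda ^ ((1 - δ) * (n : ℝ)) →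
            ‖t‖ ≤ M₂ * bigLambda ^ ((1 - γ) * (n : ℝ)) →
            ‖renorm n α ((center n : ℂ) + rho n α t) Z -
              (conj Z ^ 2 + ((‖b0‖ ^ 2 - ‖b0Star‖ ^ 2 : ℝ) : ℂ) * t)‖
              ≤ C * η ^ n := by
  -- Since `|k_n| = O(16⁻²ⁿ)` and `|α_n| ≍ 16ⁿ`, the parameter shift is `O(16^(-(1+γ)n))` and
  -- `|Z/α|²` is `O(16^(-2δn))`; thus `s_n = 16^(-mn)` controls both, and the hypotheses say `3/2 <
  -- m < 2`.
  set m := min (1 + γ) (2 * δ) with hm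
  have hm1 : 3 / 2 < m := lt_min (by linarith) (by linarith)
  have hm2 : m < 2 := (min_le_left _ _).trans_lt (by linarith)
  set θ : ℝ := 16 ^ (-m) with hθ
  have hθ0 : 0 < θ := by positivity
  have h16 : (0 : ℝ) < 16 := by norm_num
  have hη1 : 64 * θ < 1 := by
    have h64 : (64 : ℝ) = 16 ^ (3 / 2 : ℝ) := by
      rw [show (16 : ℝ) = 4 ^ (2 : ℝ) by norm_num, ← Real.rpow_mul (by norm_num)]
      norm_num
    rw [h64, hθ, ← Real.rpow_add h16]
    exact Real.rpow_lt_one_of_one_lt_of_neg (by norm_num) (by linarith)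
  have hθ256 : 1 ≤ 256 * θ := by
    have h256 : (256 : ℝ) = 16 ^ (2 : ℝ) := by norm_num
    rw [h256, hθ, ← Real.rpow_add h16]
    exact Real.one_le_rpow (by norm_num) (by linarith)
  -- The scaled error is of order `n 16ⁿ (16ⁿ θⁿ)² = n (64 θ)²ⁿ`, as `16³ = 64²`. One factor `(64
  -- θ)ⁿ` absorbs `n + 1`, the other is the rate.
  refine ⟨64 * θ, by positivity, hη1, fun M₁ M₂ => ?_⟩
  have hlim : Tendsto (fun n : ℕ => (16 : ℝ) ^ n * θ ^ n) atTop (𝓝 0) := by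
    simp only [← mul_pow]
    exact tendsto_pow_atTop_nhds_zero_of_lt_one (by positivity) (by linarith)
  have hlow : ∀ n : ℕ, (1 : ℝ) ≤ 16 ^ n * 16 ^ n * θ ^ n := fun n => by
    rw [← mul_pow, ← mul_pow]
    exact one_le_pow₀ (by linarith)
  set a := aCoeff cHat with ha
  have ha0 : 0 < ‖a‖ := norm_pos_iff.2 aCoeff_cHat_ne_zero
  set A := ‖ACoeff 2 cHat‖ / ‖a‖ with hA
  have hA0 : 0 < A := div_pos (norm_pos_iff.2 ACoeff_two_cHat_ne_zero) ha0
  set K₁ := 2 * ‖a‖ / A * (‖b0‖ + ‖b0Star‖) * |M₂| with hK₁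
  set K₂ := M₁ ^ 2 / A ^ 2 with hK₂
  have hK₁0 : 0 ≤ K₁ := by positivity
  have hK₂0 : 0 ≤ K₂ := by positivity
  -- The summand `1` keeps the constant positive, since `K₁` and `K₂` may vanish.
  obtain ⟨C, hC, n₁, hmain⟩ := exists_return_estimate (s := fun n => θ ^ n)
    (fun n => by positivity) hlim hlow (K := K₁ + K₂ + 1) (by positivity)
  obtain ⟨Cc, hCc, n₂, hcen⟩ := exists_center_bounds
  have hnη : Tendsto (fun n : ℕ => ((n : ℝ) + 1) * (64 * θ) ^ n) atTop (𝓝 0) := by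
    have h1 := tendsto_self_mul_const_pow_of_lt_one (by positivity : 0 ≤ 64 * θ) hη1
    have h2 := tendsto_pow_atTop_nhds_zero_of_lt_one (by positivity : 0 ≤ 64 * θ) hη1
    simpa [add_mul] using h1.add h2
  have hreg := tendsto_center.eventually (show nearHat ∈ 𝓝 cHat from nearHat_mem_nhds)
  obtain ⟨n₀, hn₀⟩ := eventually_atTop.1 ((hnη.eventually_lt_const one_pos).and
    (hreg.and (eventually_ge_atTop (max n₁ n₂))))
  refine ⟨A / ‖a‖ * C, n₀, fun n hn α hα Z t hZ ht => ?_⟩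
  obtain ⟨hsmall, hcN, hnn⟩ := hn₀ n hn
  obtain ⟨-, hlam, -⟩ := hcen n ((le_max_right _ _).trans hnn)
  rw [bigLambda_eq, rpow_mul_nat] at hZ ht
  have hα0 := hα.ne_zero
  have hαn : ‖α‖ = 16 ^ n * A := by rw [hα.1, norm_scaleBase]
  set l := fixMult (center n) (conj (center n : ℂ)) with hl
  have hl0 : l ^ n ≠ 0 := pow_ne_zero n (fixMult_ne_zero hcN (conj_mem_nearHat hcN))
  have hk : kConst n α = a / (α * l ^ n) := by rw [kConst, mult_eq hcN]
  set Q : ℝ := 16 ^ n with hQ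
  have hQ0 : 0 < Q := by positivity
  have hkn : ‖kConst n α‖ ≤ 2 * ‖a‖ / A * (1 / (Q * Q)) := by
    rw [hk, norm_div, norm_mul, hαn]
    calc ‖a‖ / (Q * A * ‖l ^ n‖) ≤ ‖a‖ / (Q * A * (Q / 2)) := by gcongr
      _ = _ := by field_simp
  have hpow : ∀ x : ℝ, x ≤ 2 - m → ((16 : ℝ) ^ x) ^ n * (1 / (Q * Q)) ≤ θ ^ n := fun x hx => by
    have e : (1 / (Q * Q) : ℝ) = ((16 : ℝ) ^ (-2 : ℝ)) ^ n := by
      rw [hQ, ← mul_pow, one_div, ← inv_pow]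
      congr 1
      rw [Real.rpow_neg (by norm_num)]
      norm_num
    rw [e, ← mul_pow, ← Real.rpow_add h16, hθ]
    gcongr
    · norm_num
    · linarith
  have hρ : ‖rho n α t‖ ≤ (K₁ + K₂ + 1) * θ ^ n := by
    have h1 : ‖rho n α t‖ ≤ K₁ * θ ^ n := by
      calc ‖rho n α t‖ ≤ ‖kConst n α‖ * (‖b0‖ + ‖b0Star‖) * ‖t‖ := norm_rho_le n α t
        _ ≤ (2 * ‖a‖ / A * (1 / (Q * Q))) * (‖b0‖ + ‖b0Star‖) *
            (|M₂| * ((16 : ℝ) ^ (1 - γ)) ^ n) := by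
          gcongr
          exact ht.trans (by gcongr; exact le_abs_self _)
        _ = K₁ * (((16 : ℝ) ^ (1 - γ)) ^ n * (1 / (Q * Q))) := by rw [hK₁]; ring
        _ ≤ K₁ * θ ^ n := by
          gcongr
          exact hpow _ (by have := min_le_left (1 + γ) (2 * δ); linarith)
    refine h1.trans ?_
    gcongr
    linarith
  have hu : ‖conj (Z / α) ^ 2‖ ≤ (K₁ + K₂ + 1) * θ ^ n := by
    have h1 : ‖conj (Z / α) ^ 2‖ ≤ K₂ * θ ^ n := by
      rw [norm_pow, RCLike.norm_conj, norm_div, hαn, div_pow]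
      have h2 : ‖Z‖ ^ 2 ≤ (M₁ * ((16 : ℝ) ^ (1 - δ)) ^ n) ^ 2 := by gcongr
      calc ‖Z‖ ^ 2 / (Q * A) ^ 2 ≤ (M₁ * ((16 : ℝ) ^ (1 - δ)) ^ n) ^ 2 / (Q * A) ^ 2 := by gcongr
        _ = K₂ * (((16 : ℝ) ^ ((1 - δ) + (1 - δ))) ^ n * (1 / (Q * Q))) := by
          rw [Real.rpow_add h16, mul_pow ((16 : ℝ) ^ (1 - δ)), hK₂]
          field_simp
        _ ≤ K₂ * θ ^ n := by
          gcongr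
          exact hpow _ (by have := min_le_right (1 + γ) (2 * δ); linarith)
    refine h1.trans ?_
    gcongr
    linarith
  have hest := hmain n ((le_max_left _ _).trans hnn) (rho n α t) (Z / α) hρ hu
  rw [b0_mul_rho_add, ← hl, ← ha] at hest
  set w := (antiQuad (center n + rho n α t))^[2 * n + 3] (Z / α) with hw
  set D : ℂ := ((‖b0‖ ^ 2 - ‖b0Star‖ ^ 2 : ℝ) : ℂ) with hD
  have hane : a ≠ 0 := aCoeff_cHat_ne_zero
  have hZ2 : α / a * (16 ^ n * (ACoeff 2 cHat * conj (Z / α) ^ 2)) = conj Z ^ 2 := by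
    have h1 := hα.mul_scaleBase
    rw [scaleBase, mult_cHat, ← ha] at h1
    have h2 : conj α ≠ 0 := (map_ne_zero _).2 hα0
    calc α / a * (16 ^ n * (ACoeff 2 cHat * conj (Z / α) ^ 2))
        = α * (16 ^ n * ACoeff 2 cHat / a) * conj (Z / α) ^ 2 := by ring
      _ = conj Z ^ 2 := by
        rw [h1, map_div₀, div_pow, mul_div_cancel₀ _ (pow_ne_zero 2 h2)]
  have hDt : α / a * (l ^ n * (kConst n α * (D * t))) = D * t := by
    rw [hk]
    field_simp
  have hid : renorm n α ((center n : ℂ) + rho n α t) Z - (conj Z ^ 2 + D * t) =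
      α / a * (a * w - (l ^ n * (kConst n α * (D * t)) +
        16 ^ n * (ACoeff 2 cHat * conj (Z / α) ^ 2))) := by
    rw [mul_sub, mul_add, hZ2, hDt, renorm, ← hw, ← mul_assoc, div_mul_cancel₀ _ hane]
    ring
  rw [hid, norm_mul, norm_div, hαn]
  have hη2 : ((n : ℝ) + 1) * (Q * (Q * θ ^ n) ^ 2) ≤ (64 * θ) ^ n := by
    have e : Q * (Q * θ ^ n) ^ 2 = (64 * θ) ^ n * (64 * θ) ^ n := by
      rw [hQ, ← mul_pow, ← pow_mul, mul_comm n 2, pow_mul, ← mul_pow, ← mul_pow]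
      congr 1
      ring
    rw [e, ← mul_assoc]
    exact mul_le_of_le_one_left (by positivity) hsmall.le
  calc Q * A / ‖a‖ * ‖a * w - (l ^ n * (kConst n α * (D * t)) +
        16 ^ n * (ACoeff 2 cHat * conj (Z / α) ^ 2))‖
      ≤ Q * A / ‖a‖ * (C * (n + 1) * (Q * θ ^ n) ^ 2) := by gcongr
    _ = A / ‖a‖ * C * (((n : ℝ) + 1) * (Q * (Q * θ ^ n) ^ 2)) := by ring
    _ ≤ A / ‖a‖ * C * (64 * θ) ^ n := by gcongr

end Scaling

end Tricorn

theorem theorem3 :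
    -- the objects in the claim are well defined
    (∀ n : ℕ, IsLeast (Tricorn.centerSet n) (Tricorn.center n)) ∧
    Tendsto (fun n : ℕ => (Tricorn.center n : ℂ)) atTop (𝓝 Tricorn.cHat) ∧
    (∀ᶠ c in 𝓝 Tricorn.cHat, (∃! b : ℂ, Tricorn.ZeroRayLandsAt c b) ∧
      ∃ U : Set ℂ, Tricorn.IsKoenigs c U (Tricorn.koenigs c) ∧ (Tricorn.antiQuad c)^[3] 0 ∈ U) ∧
    Tricorn.bigLambda = 16 ∧
    Tricorn.aCoeff Tricorn.cHat ≠ 0 ∧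
    Tricorn.ACoeff 2 Tricorn.cHat ≠ 0 ∧
    DifferentiableAt ℝ (Tricorn.ACoeff 0) Tricorn.cHat ∧
    -- the scaling limit
    (∀ δ γ : ℝ, 3 / 4 < δ → δ < 1 → 1 / 2 < γ → γ < 1 →
      ∃ η : ℝ, 0 < η ∧ η < 1 ∧
        ∀ M₁ M₂ : ℝ, ∃ (C : ℝ) (n₀ : ℕ), ∀ n : ℕ, n₀ ≤ n →
          ∀ α : ℂ, Tricorn.IsScaling n α →
            ∀ Z t : ℂ,
              ‖Z‖ ≤ M₁ * Tricorn.bigLambda ^ ((1 - δ) * (n : ℝ)) →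
              ‖t‖ ≤ M₂ * Tricorn.bigLambda ^ ((1 - γ) * (n : ℝ)) →
              ‖Tricorn.renorm n α ((Tricorn.center n : ℂ) + Tricorn.rho n α t) Z -
                (conj Z ^ 2 + ((‖Tricorn.b0‖ ^ 2 - ‖Tricorn.b0Star‖ ^ 2 : ℝ) : ℂ) * t)‖
                ≤ C * η ^ n) := by
  refine ⟨Tricorn.isLeast_center, Tricorn.tendsto_center, ?_, Tricorn.bigLambda_eq,
    Tricorn.aCoeff_cHat_ne_zero, Tricorn.ACoeff_two_cHat_ne_zero,
    Tricorn.differentiableAt_ACoeff_zero, fun δ γ hδ _ hγ hγ1 =>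
      Tricorn.exists_renorm_estimate hδ hγ hγ1⟩
  rw [Tricorn.cHat]
  filter_upwards [Tricorn.regularParam_mem_nhds, Tricorn.eventually_iterate_three_mem] with c hc hm
  exact ⟨⟨_, (Tricorn.zeroRayLandsAt_iff hc.1).2 rfl,
    fun b hb => (Tricorn.zeroRayLandsAt_iff hc.1).1 hb⟩,
    Tricorn.halfPlane, Tricorn.isKoenigs_koenigs hc.1 hc.2, hm⟩
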